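/- For $n\ge 0$ let the Birkhoff polytope $B_n$ be the convex hull of all $n\times n$ permutation matrices. The combinatorial type of a polytope $P$ is its face lattice, i.e. the set of all faces of $P$ (including $\varnothing$ and $P$) ordered by inclusion, up to isomorphism of partially ordered sets. For the combinatorial type $\mathcal L$ of a nonempty face of some Birkhoff polytope, the Birkhoff dimension $\mathrm{bdim}(\mathcal L)$ is the smallest $n$ such that $B_n$ has a face of combinatorial type $\mathcal L$. For polytopes $Q_i\subset\mathbb R^m$, $i\in I$, with $I$ finite, the Cayley sum is $\mathrm{Cay}(Q_i : i\in I)=\mathrm{conv}\bigl(\bigcup_{i\in I} Q_i\times\{e_i\}\bigr)\subset\mathbb R^m\times\mathbb R^I$, where $e_i$ are the unit vectors. For polytopes $P_1,\dots,P_k$ with $P_i\subset\mathbb R^{d_i}$ of dimension $d_i$ put $Q_0=P_1\times\cdots\times P_k$ and $Q_i=P_1\times\cdots\times P_{i-1}\times\{0\}\times P_{i+1}\times\cdots\times P_k$ for $1\le i\le k$. The joined product of $P_1,\dots,P_k$ is $\mathrm{Cay}(Q_1,\dots,Q_k)$, and their reduced joined product is $\mathrm{Cay}(Q_0,Q_1,\dots,Q_k)$.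 The $a$-cube is $[0,1]^a$, for $a\ge 0$ (a point if $a=0$). **Theorem.** Let $d\ge 2$ and let $\mathcal L$ be the combinatorial type of a $d$-dimensional face of some Birkhoff polytope with $\mathrm{bdim}(\mathcal L)\ge 2d-3$. Then $\mathcal L$ is the combinatorial type of at least one of the following: 1. a product $F_1\times F_2$, where $F_1$ and $F_2$ are faces of Birkhoff polytopes, both of dimension at least $1$; 2. a pyramid over the product of an $a$-cube and a triangle, for some $a\ge 0$; 3. a reduced joined product of an $a$-cube and a $b$-cube, for some $a,b\ge 0$; 4. a joined product of an $a$-cube, a $b$-cube and a $c$-cube, for some $a,b,c\ge 1$. -/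

import Mathlib

/-- The face lattice of a polytope `P`: all faces of `P`, ordered by inclusion. A face is the empty
set, `P` itself, or the intersection of `P` with a supporting hyperplane, i.e. an exposed subset. -/
abbrev FaceLattice {E : Type*} [AddCommMonoid E] [TopologicalSpace E] [Module ℝ E]
    (P : Set E) : Type _ :=
  {F : Set E // IsExposed ℝ P F}

/-- `P` is a geometric realization of the partially ordered set `L`. -/
def Realizes {E : Type*} [AddCommMonoid E] [TopologicalSpace E] [Module ℝ E]
    (P : Set E) (L : Type*) [PartialOrder L] : Prop :=
  Nonempty (L ≃o FaceLattice P)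

/-- The dimension of the affine hull of `P` (of a nonempty `P`). -/
noncomputable def polytopeDim {E : Type*} [AddCommGroup E] [Module ℝ E] (P : Set E) : ℕ :=
  Module.finrank ℝ (vectorSpan ℝ P)

/-- The Birkhoff polytope: the convex hull of all `n × n` permutation matrices. -/
def birkhoffPolytope (n : ℕ) : Set (Matrix (Fin n) (Fin n) ℝ) :=
  convexHull ℝ {σ.permMatrix ℝ | σ : Equiv.Perm (Fin n)}

/-- `F` is a nonempty face of the `n`-th Birkhoff polytope. -/
def IsBirkhoffFace (n : ℕ) (F : Set (Matrix (Fin n) (Fin n) ℝ)) : Prop :=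
  F.Nonempty ∧ IsExposed ℝ (birkhoffPolytope n) F

/-- `L` is the combinatorial type of a `d`-dimensional face of some Birkhoff polytope. -/
def IsBirkhoffType (L : Type*) [PartialOrder L] (d : ℕ) : Prop :=
  ∃ (n : ℕ) (F : Set (Matrix (Fin n) (Fin n) ℝ)),
    IsBirkhoffFace n F ∧ polytopeDim F = d ∧ Realizes F L

/-- The Birkhoff dimension of `L`: the smallest `n` such that the `n`-th Birkhoff polytope has a
face of combinatorial type `L`. -/
noncomputable def bdim (L : Type*) [PartialOrder L] : ℕ :=
  sInf {n : ℕ | ∃ F : Set (Matrix (Fin n) (Fin n) ℝ), IsBirkhoffFace n F ∧ Realizes F L}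

/-- The `k`-dimensional cube `[0,1]^k`, the convex hull of all `0/1`-vectors; a point if `k = 0`. -/
def cube (k : ℕ) : Set (Fin k → ℝ) :=
  Set.Icc 0 1

/-- A triangle. -/
def triangle : Set (Fin 3 → ℝ) :=
  stdSimplex ℝ (Fin 3)

/-- The pyramid over `P`, i.e. the join of `P` and a point. -/
def pyramid {E : Type*} [AddCommGroup E] [Module ℝ E] (P : Set E) : Set (E × ℝ) :=
  convexHull ℝ (P ×ˢ {0} ∪ {(0, 1)})

/-- The Cayley sum `conv (⋃ i, Q i × {e i})`. -/
def cayleySum {E ι : Type*} [AddCommGroup E] [Module ℝ E] [DecidableEq ι]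
    (Q : ι → Set E) : Set (E × (ι → ℝ)) :=
  convexHull ℝ (⋃ i, Q i ×ˢ {Pi.single i 1})

/-- The product of all `P j`, with the factor `P i` replaced by the zero vector. -/
def omitFactor {ι : Type*} [DecidableEq ι] {E : ι → Type*} [∀ i, AddCommGroup (E i)]
    (P : ∀ i, Set (E i)) (i : ι) : Set (∀ i, E i) :=
  Set.univ.pi (Function.update P i {0})

/-- The joined product of the polytopes `P i`. -/
def joinedProduct {ι : Type*} [DecidableEq ι] {E : ι → Type*} [∀ i, AddCommGroup (E i)]
    [∀ i, Module ℝ (E i)] (P : ∀ i, Set (E i)) : Set ((∀ i, E i) × (ι → ℝ)) :=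
  cayleySum (omitFactor P)

/-- The reduced joined product of the polytopes `P i`: the Cayley sum of the full product
(the summand with index `none`) and of the products with one factor replaced by zero. -/
def reducedJoinedProduct {ι : Type*} [DecidableEq ι] {E : ι → Type*} [∀ i, AddCommGroup (E i)]
    [∀ i, Module ℝ (E i)] (P : ∀ i, Set (E i)) : Set ((∀ i, E i) × (Option ι → ℝ)) :=
  cayleySum (fun o : Option ι => o.elim (Set.univ.pi P) (omitFactor P))

/-! A nonempty face of a Birkhoff polytope is the polytope of fractional perfect matchings of the
bipartite graph of its support (`IsBirkhoffFace.exists_matchPoly`). Multigraphs give Birkhoff faces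
too: replacing an edge by a path of length three does not change the polytope up to affine
equivalence, so superfluous parallel edges can be removed at the cost of one row each
(`exists_birkhoffFace_affEq`).

Among all multigraphs that represent a given face and carry a strictly positive matching, take one
with the fewest left vertices. If it is disconnected, the face is a product, and factors that are
points can be dropped. If a vertex of degree two has two distinct neighbours, it can be contracted
(`exists_contraction`). So either alternative 1 holds, or the graph is connected with all degrees at
least three (`IsBirkhoffFace.exists_prod_or_reduced`).

In the second case let there be `a` vertices on each side, `e` edges and `s` edges up to
parallelism. Linear algebra gives `d ≥ e - 2a + 1`, and subdivision gives a Birkhoff face of size `a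
+ e - s`. Hence `bdim ≥ 2d - 3` forces `e + s ≤ 5a + 1`. On the other hand `e ≥ 3a`, and `s ≥ 2a` if
`a ≥ 2`. This leaves few graphs (`isPyramidOrJoinedProduct_of_reduced`):

If `s = 2a`, the underlying graph is an even cycle. For `e = 3a`, simple and double edges alternate,
and the polytope is a pyramid over a cube. For `e = 3a + 1`, either one of the double edges has
become triple, which gives a pyramid over a cube times a triangle, or some left vertex has two
double edges. Then the polytope is a join of two cubes, which a special graph realizes in size `2a`,
one less than the general construction; this contradicts the bound
(`exists_birkhoffFace_affEq_joinModel`).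

If `s = 2a + 1` and `e = 3a`, the graph consists of three paths between two vertices with three
simple edges each. The weights of the simple edges on the three paths are the Cayley coordinates,
and the double edges on a path are the coordinates of one cube (`exists_classModel_of_three_paths`).
A path without double edges turns the joined product into a reduced one.

If `a = 1`, the polytope is a simplex with at most five vertices, and five vertices are excluded
because the 4-simplex is a face of the fourth Birkhoff polytope. -/

/-! ### Affine equivalence and face lattices -/

/-- The function `f` preserves affine combinations of two points. -/
def PreservesLines {E E' : Type*} [AddCommGroup E] [Module ℝ E] [AddCommGroup E'] [Module ℝ E']
    (f : E → E') : Prop :=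
  ∀ (x y : E) (t : ℝ), f ((1 - t) • x + t • y) = (1 - t) • f x + t • f y

/-- The map `f - f 0` is homogeneous by looking at lines through the origin, and additive because `x
+ y` is the midpoint of `2x` and `2y`. -/
theorem PreservesLines.exists_affineMap {E E' : Type*} [AddCommGroup E] [Module ℝ E]
    [AddCommGroup E'] [Module ℝ E'] {f : E → E'} (hf : PreservesLines f) :
    ∃ g : E →ᵃ[ℝ] E', ∀ x, g x = f x := by
  have hsmul : ∀ (t : ℝ) (y : E), f (t • y) - f 0 = t • (f y - f 0) := by
    intro t y
    have h := hf 0 y t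
    rw [smul_zero, zero_add] at h
    rw [h]
    module
  have hadd : ∀ x y : E, f (x + y) - f 0 = (f x - f 0) + (f y - f 0) := by
    intro x y
    have h := hf ((2 : ℝ) • x) ((2 : ℝ) • y) (1 / 2)
    have e : (1 - (1 / 2 : ℝ)) • (2 : ℝ) • x + (1 / 2 : ℝ) • (2 : ℝ) • y = x + y := by module
    rw [e, sub_eq_iff_eq_add.mp (hsmul 2 x), sub_eq_iff_eq_add.mp (hsmul 2 y)] at h
    rw [h]
    module
  let φ : E →ₗ[ℝ] E' :=
    { toFun := fun x => f x - f 0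
      map_add' := hadd
      map_smul' := hsmul }
  refine ⟨φ.toAffineMap + AffineMap.const ℝ E (f 0), fun x => ?_⟩
  simp [φ]

/-- Two sets are affinely equivalent: there are affine maps that restrict to mutually inverse
bijections between them. -/
def AffEq {E E' : Type*} [AddCommGroup E] [Module ℝ E] [AddCommGroup E'] [Module ℝ E']
    (P : Set E) (P' : Set E') : Prop :=
  ∃ (f : E →ᵃ[ℝ] E') (g : E' →ᵃ[ℝ] E),
    (∀ x ∈ P, f x ∈ P' ∧ g (f x) = x) ∧ (∀ y ∈ P', g y ∈ P ∧ f (g y) = y)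

namespace AffEq

variable {E E' E'' : Type*} [AddCommGroup E] [Module ℝ E] [AddCommGroup E'] [Module ℝ E']
  [AddCommGroup E''] [Module ℝ E''] {P : Set E} {P' : Set E'} {P'' : Set E''}

/-- Equivalences are given below by explicit coordinate formulas; this lemma spares building them as
bundled affine maps. -/
theorem of_preservesLines (f : E → E') (g : E' → E) (hf : PreservesLines f)
    (hg : PreservesLines g) (h₁ : ∀ x ∈ P, f x ∈ P' ∧ g (f x) = x)
    (h₂ : ∀ y ∈ P', g y ∈ P ∧ f (g y) = y) : AffEq P P' := by
  obtain ⟨f', hf'⟩ := hf.exists_affineMap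
  obtain ⟨g', hg'⟩ := hg.exists_affineMap
  refine ⟨f', g', fun x hx => ?_, fun y hy => ?_⟩
  · rw [hf', hg']; exact h₁ x hx
  · rw [hg', hf']; exact h₂ y hy

theorem symm : AffEq P P' → AffEq P' P := fun ⟨f, g, h₁, h₂⟩ => ⟨g, f, h₂, h₁⟩

theorem trans : AffEq P P' → AffEq P' P'' → AffEq P P'' := by
  rintro ⟨f, g, h₁, h₂⟩ ⟨f', g', h₁', h₂'⟩
  refine ⟨f'.comp f, g.comp g', fun x hx => ?_, fun y hy => ?_⟩
  · obtain ⟨ha, hb⟩ := h₁ x hx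
    obtain ⟨hc, hd⟩ := h₁' _ ha
    exact ⟨hc, by simp [hd, hb]⟩
  · obtain ⟨ha, hb⟩ := h₂' y hy
    obtain ⟨hc, hd⟩ := h₂ _ ha
    exact ⟨hc, by simp [hd, hb]⟩

theorem prod {F F' : Type*} [AddCommGroup F] [Module ℝ F] [AddCommGroup F'] [Module ℝ F']
    {R : Set F} {R' : Set F'} : AffEq P P' → AffEq R R' → AffEq (P ×ˢ R) (P' ×ˢ R') := by
  rintro ⟨f, g, h₁, h₂⟩ ⟨f', g', h₁', h₂'⟩
  refine ⟨(f.comp AffineMap.fst).prod (f'.comp AffineMap.snd),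
    (g.comp AffineMap.fst).prod (g'.comp AffineMap.snd), fun x hx => ?_, fun y hy => ?_⟩
  · exact ⟨⟨(h₁ _ hx.1).1, (h₁' _ hx.2).1⟩, Prod.ext (h₁ _ hx.1).2 (h₁' _ hx.2).2⟩
  · exact ⟨⟨(h₂ _ hy.1).1, (h₂' _ hy.2).1⟩, Prod.ext (h₂ _ hy.1).2 (h₂' _ hy.2).2⟩

theorem nonempty (h : AffEq P P') (hP : P.Nonempty) : P'.Nonempty := by
  obtain ⟨f, g, h₁, h₂⟩ := h
  obtain ⟨x, hx⟩ := hP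
  exact ⟨f x, (h₁ x hx).1⟩

theorem polytopeDim_le [FiniteDimensional ℝ E] (h : AffEq P P') :
    polytopeDim P' ≤ polytopeDim P := by
  obtain ⟨f, g, h₁, h₂⟩ := h
  have him : f '' P = P' := by
    ext y
    exact ⟨fun ⟨x, hx, hxy⟩ => hxy ▸ (h₁ x hx).1, fun hy => ⟨g y, (h₂ y hy).1, (h₂ y hy).2⟩⟩
  rw [polytopeDim, polytopeDim, ← him, ← AffineMap.map_vectorSpan]
  exact Submodule.finrank_map_le _ _

theorem polytopeDim_eq [FiniteDimensional ℝ E] [FiniteDimensional ℝ E'] (h : AffEq P P') :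
    polytopeDim P = polytopeDim P' :=
  le_antisymm h.symm.polytopeDim_le h.polytopeDim_le

section Faces

variable [TopologicalSpace E] [TopologicalSpace E'] [IsTopologicalAddGroup E']
  [ContinuousSMul ℝ E'] [T2Space E'] [FiniteDimensional ℝ E']

/-- If `m` exposes `F`, then `m` composed with the linear part of `g` exposes the image: it differs
from `m ∘ g` only by the constant `m (g 0)`. -/
theorem isExposed_image {f : E →ᵃ[ℝ] E'} {g : E' →ᵃ[ℝ] E}
    (h₁ : ∀ x ∈ P, f x ∈ P' ∧ g (f x) = x) (h₂ : ∀ y ∈ P', g y ∈ P ∧ f (g y) = y)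
    {F : Set E} (hF : IsExposed ℝ P F) : IsExposed ℝ P' (f '' F) := by
  intro hne
  obtain ⟨m, hm⟩ := hF hne.of_image
  let m' : E' →L[ℝ] ℝ := LinearMap.toContinuousLinearMap ((m : E →ₗ[ℝ] ℝ) ∘ₗ g.linear)
  have key : ∀ y y' : E', m' y ≤ m' y' ↔ m (g y) ≤ m (g y') := by
    intro y y'
    have h : ∀ z : E', m (g z) = m' z + m (g 0) := by
      intro z
      have : g z = g.linear z + g 0 := by
        have := congrFun g.decomp z
        simpa using this
      rw [this, map_add]
      rfl
    rw [h y, h y']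
    simp
  refine ⟨m', ?_⟩
  subst hm
  ext y
  constructor
  · rintro ⟨x, ⟨hx, hmax⟩, rfl⟩
    refine ⟨(h₁ x hx).1, fun y hy => ?_⟩
    rw [key, (h₁ x hx).2]
    exact hmax _ (h₂ y hy).1
  · rintro ⟨hy, hmax⟩
    refine ⟨g y, ⟨(h₂ y hy).1, fun x hx => ?_⟩, (h₂ y hy).2⟩
    have := hmax (f x) (h₁ x hx).1
    rwa [key, (h₁ x hx).2] at this

/-- Taking images under the two affine maps gives mutually inverse, inclusion-preserving maps
between exposed faces. -/
theorem realizes [IsTopologicalAddGroup E] [ContinuousSMul ℝ E] [T2Space E]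
    [FiniteDimensional ℝ E] (h : AffEq P P') {L : Type*} [PartialOrder L] (hP : Realizes P L) :
    Realizes P' L := by
  obtain ⟨f, g, h₁, h₂⟩ := h
  obtain ⟨e⟩ := hP
  have hgf : ∀ F : Set E, F ⊆ P → g '' (f '' F) = F := by
    intro F hF
    rw [Set.image_image]
    exact (Set.image_congr fun x hx => (h₁ x (hF hx)).2).trans (Set.image_id _)
  have hfg : ∀ F : Set E', F ⊆ P' → f '' (g '' F) = F := by
    intro F hF
    rw [Set.image_image]
    exact (Set.image_congr fun x hx => (h₂ x (hF hx)).2).trans (Set.image_id _)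
  refine ⟨e.trans
    { toFun := fun F => ⟨f '' F.1, isExposed_image h₁ h₂ F.2⟩
      invFun := fun F => ⟨g '' F.1, isExposed_image h₂ h₁ F.2⟩
      left_inv := fun F => Subtype.ext (hgf F.1 F.2.subset)
      right_inv := fun F => Subtype.ext (hfg F.1 F.2.subset)
      map_rel_iff' := ?_ }⟩
  intro F F'
  constructor
  · intro hle
    have : g '' (f '' F.1) ⊆ g '' (f '' F'.1) := Set.image_mono hle
    rwa [hgf _ F.2.subset, hgf _ F'.2.subset] at this
  · intro hle
    exact Set.image_mono hle

end Faces

end AffEq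

/-! ### Fractional perfect matchings of bipartite multigraphs -/

section Systems

variable {E A B : Type} [Fintype E]

open Classical in
/-- The sum of the weights `x` over the fibre of `l` above `a`. -/
noncomputable def fiberSum (l : E → A) (x : E → ℝ) (a : A) : ℝ :=
  ∑ e with l e = a, x e

/-- The fractional perfect matchings of the bipartite multigraph with edge set `E` and
end points `l : E → A` and `r : E → B`. -/
def matchPoly (l : E → A) (r : E → B) : Set (E → ℝ) :=
  {x | (∀ e, 0 ≤ x e) ∧ (∀ a, fiberSum l x a = 1) ∧ ∀ b, fiberSum r x b = 1}

theorem matchPoly_swap (l : E → A) (r : E → B) : matchPoly l r = matchPoly r l := by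
  ext x
  simp only [matchPoly, Set.mem_ofPred_eq]
  tauto

theorem sum_fiberSum [Fintype A] (l : E → A) (x : E → ℝ) : ∑ a, fiberSum l x a = ∑ e, x e := by
  classical
  unfold fiberSum
  exact Finset.sum_fiberwise _ _ _

theorem fiberSum_linear (l : E → A) (x y : E → ℝ) (s t : ℝ) (a : A) :
    fiberSum l (s • x + t • y) a = s * fiberSum l x a + t * fiberSum l y a := by
  simp [fiberSum, Finset.sum_add_distrib, Finset.mul_sum]

theorem fiberSum_eq_sum_filter [DecidableEq A] (l : E → A) (x : E → ℝ) (a : A) :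
    fiberSum l x a = ∑ e with l e = a, x e := by
  unfold fiberSum
  congr

theorem fiberSum_eq_sum_sum [DecidableEq A] [DecidableEq B] [Fintype B] (l : E → A) (r : E → B)
    (x : E → ℝ) (a : A) : fiberSum l x a = ∑ b, ∑ e with l e = a ∧ r e = b, x e := by
  rw [fiberSum_eq_sum_filter, ← Finset.sum_fiberwise (Finset.univ.filter fun e => l e = a) r x]
  simp only [Finset.filter_filter]

theorem fiberSum_eq_sum_ite [DecidableEq A] (l : E → A) (x : E → ℝ) (a : A) :
    fiberSum l x a = ∑ e, if l e = a then x e else 0 := by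
  rw [fiberSum_eq_sum_filter, Finset.sum_filter]

theorem fiberSum_congr (l : E → A) {x y : E → ℝ} {a : A} (h : ∀ e, l e = a → x e = y e) :
    fiberSum l x a = fiberSum l y a :=
  Finset.sum_congr rfl fun e he => h e (by simpa using he)

theorem fiberSum_le_one_of_mem {l : E → A} {x : E → ℝ} (h0 : ∀ e, 0 ≤ x e)
    (h1 : ∀ a, fiberSum l x a = 1) (e : E) : x e ≤ 1 := by
  classical
  rw [← h1 (l e)]
  exact Finset.single_le_sum (f := x) (fun e _ => h0 e) (by simp)

/-- Both numbers equal the total weight of all edges. -/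
theorem card_eq_of_mem_matchPoly [Fintype A] [Fintype B] {l : E → A} {r : E → B} {x : E → ℝ} (hx : x ∈ matchPoly l r) :
    Fintype.card A = Fintype.card B := by
  have h1 := sum_fiberSum l x
  have h2 := sum_fiberSum r x
  simp only [hx.2.1, hx.2.2, Finset.sum_const, Finset.card_univ, nsmul_eq_mul, mul_one] at h1 h2
  exact_mod_cast h1.trans h2.symm

end Systems

/-! ### Doubly stochastic matrices with prescribed zeros -/

/-- This is the Birkhoff–von Neumann theorem. -/
theorem mem_birkhoffPolytope_iff {n : ℕ} {M : Matrix (Fin n) (Fin n) ℝ} :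
    M ∈ birkhoffPolytope n ↔
      (∀ i j, 0 ≤ M i j) ∧ (∀ i, ∑ j, M i j = 1) ∧ ∀ j, ∑ i, M i j = 1 := by
  rw [← mem_doublyStochastic_iff_sum, ← SetLike.mem_coe, doublyStochastic_eq_convexHull_permMatrix]
  rfl

/-- Prescribing zero entries of a doubly stochastic matrix cuts out a face. -/
theorem isBirkhoffFace_support {n : ℕ} (T : Fin n → Fin n → Prop)
    (hne : {M ∈ birkhoffPolytope n | ∀ i j, M i j ≠ 0 → T i j}.Nonempty) :
    IsBirkhoffFace n {M ∈ birkhoffPolytope n | ∀ i j, M i j ≠ 0 → T i j} := by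
  classical
  refine ⟨hne, fun _ => ?_⟩
  -- Minus the total weight outside `T`. It is nonpositive on the polytope and vanishes exactly on
  -- the claimed face; since that face is nonempty, the maximum is `0`.
  let m : Matrix (Fin n) (Fin n) ℝ →ₗ[ℝ] ℝ :=
    { toFun := fun M => -∑ i, ∑ j, if T i j then 0 else M i j
      map_add' := by
        intro M N
        rw [← neg_add, ← Finset.sum_add_distrib]
        congr 1
        refine Finset.sum_congr rfl fun i _ => ?_
        rw [← Finset.sum_add_distrib]
        refine Finset.sum_congr rfl fun j _ => ?_
        split_ifs <;> simp
      map_smul' := by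
        intro c M
        simp only [RingHom.id_apply, smul_eq_mul, mul_neg, Finset.mul_sum]
        congr 1
        refine Finset.sum_congr rfl fun i _ => Finset.sum_congr rfl fun j _ => ?_
        split_ifs <;> simp }
  have hm : ∀ M, m M = -∑ i, ∑ j, if T i j then 0 else M i j := fun _ => rfl
  have hzero : ∀ M : Matrix (Fin n) (Fin n) ℝ, (∀ i j, M i j ≠ 0 → T i j) → m M = 0 := by
    intro M hM
    rw [hm, neg_eq_zero]
    refine Finset.sum_eq_zero fun i _ => Finset.sum_eq_zero fun j _ => ?_
    split_ifs with h
    · rfl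
    · by_contra h'
      exact h (hM i j h')
  have hterm : ∀ M ∈ birkhoffPolytope n, ∀ i j, 0 ≤ if T i j then 0 else M i j := by
    intro M hM i j
    split_ifs
    · exact le_rfl
    · exact (mem_birkhoffPolytope_iff.1 hM).1 i j
  refine ⟨LinearMap.toContinuousLinearMap m, ?_⟩
  ext M
  simp only [Set.mem_ofPred_eq, LinearMap.coe_toContinuousLinearMap']
  refine and_congr_right fun hM => ⟨fun h N hN => ?_, fun h i j hij => ?_⟩
  · rw [hzero M h, hm, neg_nonpos]
    exact Finset.sum_nonneg fun i _ => Finset.sum_nonneg fun j _ => hterm N hN i j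
  · obtain ⟨N, hN, hN'⟩ := hne
    have h1 := h N hN
    rw [hzero N hN', hm] at h1
    have h2 : ∑ i, ∑ j, (if T i j then 0 else M i j) = 0 :=
      le_antisymm (by linarith)
        (Finset.sum_nonneg fun i _ => Finset.sum_nonneg fun j _ => hterm M hM i j)
    rw [Finset.sum_eq_zero_iff_of_nonneg
      (fun i _ => Finset.sum_nonneg fun j _ => hterm M hM i j)] at h2
    have h3 := h2 i (Finset.mem_univ _)
    rw [Finset.sum_eq_zero_iff_of_nonneg (fun j _ => hterm M hM i j)] at h3
    have h4 := h3 j (Finset.mem_univ _)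
    by_contra hT
    rw [if_neg hT] at h4
    exact hij h4

/-- The fractional matchings of a simple bipartite graph are a set of doubly stochastic matrices
with prescribed zeros. -/
theorem matchPoly_affEq_support {E : Type} [Fintype E] {n : ℕ} (l r : E → Fin n)
    (hinj : ∀ e e', l e = l e' → r e = r e' → e = e') :
    AffEq (matchPoly l r)
      {M ∈ birkhoffPolytope n | ∀ i j, M i j ≠ 0 → ∃ e, l e = i ∧ r e = j} := by
  classical
  refine AffEq.of_preservesLines (E := E → ℝ) (E' := Matrix (Fin n) (Fin n) ℝ)
    (fun x i j => ∑ e with l e = i ∧ r e = j, x e)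
    (fun M e => M (l e) (r e)) ?_ ?_ ?_ ?_
  · intro x y t
    ext i j
    simp only [Matrix.add_apply, Pi.add_apply, Pi.smul_apply, smul_eq_mul,
      Finset.sum_add_distrib, ← Finset.mul_sum]
    rfl
  · intro x y t
    ext e
    simp
  · rintro x ⟨h0, hl, hr⟩
    refine ⟨⟨mem_birkhoffPolytope_iff.2 ⟨fun i j => Finset.sum_nonneg fun e _ => h0 e,
      fun i => ?_, fun j => ?_⟩, fun i j hij => ?_⟩, ?_⟩
    · rw [← hl i, fiberSum_eq_sum_sum l r]
    · rw [← hr j, fiberSum_eq_sum_sum r l]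
      simp only [and_comm]
    · obtain ⟨e, he, -⟩ := Finset.exists_ne_zero_of_sum_ne_zero hij
      exact ⟨e, by simpa using he⟩
    · funext e
      have : (Finset.univ.filter fun e' => l e' = l e ∧ r e' = r e) = {e} := by
        ext e'
        simp only [Finset.mem_filter, Finset.mem_univ, true_and, Finset.mem_singleton]
        exact ⟨fun h => hinj _ _ h.1 h.2, fun h => h ▸ ⟨rfl, rfl⟩⟩
      simp [this]
  · rintro M ⟨hM, hT⟩
    obtain ⟨h0, hrow, hcol⟩ := mem_birkhoffPolytope_iff.1 hM
    have hentry : ∀ i j, ∑ e with l e = i ∧ r e = j, M (l e) (r e) = M i j := by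
      intro i j
      by_cases hex : ∃ e, l e = i ∧ r e = j
      · obtain ⟨e, rfl, rfl⟩ := hex
        have : (Finset.univ.filter fun e' => l e' = l e ∧ r e' = r e) = {e} := by
          ext e'
          simp only [Finset.mem_filter, Finset.mem_univ, true_and, Finset.mem_singleton]
          exact ⟨fun h => hinj _ _ h.1 h.2, fun h => h ▸ ⟨rfl, rfl⟩⟩
        simp [this]
      · have : M i j = 0 := by
          by_contra h
          exact hex (hT i j h)
        rw [this]
        refine Finset.sum_eq_zero fun e he => absurd ⟨e, ?_⟩ hex
        simpa using he
    refine ⟨⟨fun e => h0 _ _, fun i => ?_, fun j => ?_⟩, ?_⟩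
    · rw [← hrow i, fiberSum_eq_sum_sum l r]
      exact Finset.sum_congr rfl fun j _ => hentry i j
    · rw [← hcol j, fiberSum_eq_sum_sum r l]
      refine Finset.sum_congr rfl fun i _ => ?_
      rw [← hentry i j]
      simp only [and_comm]
    · funext i j
      exact hentry i j

theorem fiberSum_equiv_comp {E A A' : Type} [Fintype E] (l : E → A) (φ : A ≃ A') (x : E → ℝ)
    (a : A') : fiberSum (φ ∘ l) x a = fiberSum l x (φ.symm a) := by
  classical
  simp only [fiberSum_eq_sum_ite, Function.comp_apply, Equiv.eq_symm_apply]

theorem matchPoly_equiv_comp {E A B A' B' : Type} [Fintype E] (l : E → A) (r : E → B)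
    (φ : A ≃ A') (ψ : B ≃ B') : matchPoly (φ ∘ l) (ψ ∘ r) = matchPoly l r := by
  ext x
  simp only [matchPoly, fiberSum_equiv_comp, Set.mem_ofPred_eq]
  exact and_congr_right fun _ => and_congr
    ⟨fun h a => by simpa using h (φ a), fun h a => h _⟩
    ⟨fun h a => by simpa using h (ψ a), fun h a => h _⟩

/-! ### Replacing edges by paths of length three -/

section Subdivision

variable {E A B : Type} [Fintype E]

/-- Left end points after each edge of `D` is replaced by a path of length three. -/
def subdivLeft (l : E → A) (D : Finset E) : E ⊕ (D ⊕ D) → A ⊕ D :=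
  Sum.elim (fun e => Sum.inl (l e)) (Sum.elim Sum.inr Sum.inr)

open Classical in
/-- Right end points after each edge of `D` is replaced by a path of length three. -/
noncomputable def subdivRight (r : E → B) (D : Finset E) : E ⊕ (D ⊕ D) → B ⊕ D :=
  Sum.elim (fun e => if h : e ∈ D then Sum.inr ⟨e, h⟩ else Sum.inl (r e))
    (Sum.elim Sum.inr (fun d => Sum.inl (r d)))

/-- The two new vertices of a path have degree two, so if the first edge has weight `t`, the middle
one has weight `1 - t` and the last one `t` again. The old end points see the same weights as
before. -/
theorem matchPoly_affEq_subdiv (l : E → A) (r : E → B) (D : Finset E) :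
    AffEq (matchPoly l r) (matchPoly (subdivLeft l D) (subdivRight r D)) := by
  classical
  have hli : ∀ (x : E ⊕ (D ⊕ D) → ℝ) (a : A), fiberSum (subdivLeft l D) x (Sum.inl a) =
      fiberSum l (fun e => x (Sum.inl e)) a := by
    intro x a
    simp [fiberSum_eq_sum_ite, Fintype.sum_sum_type, subdivLeft]
  have hlr : ∀ (x : E ⊕ (D ⊕ D) → ℝ) (d : D), fiberSum (subdivLeft l D) x (Sum.inr d) =
      x (Sum.inr (Sum.inl d)) + x (Sum.inr (Sum.inr d)) := by
    intro x d
    simp [fiberSum_eq_sum_ite, Fintype.sum_sum_type, subdivLeft]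
  have hri : ∀ (x : E ⊕ (D ⊕ D) → ℝ) (b : B), fiberSum (subdivRight r D) x (Sum.inl b) =
      fiberSum r (fun e => if h : e ∈ D then x (Sum.inr (Sum.inr ⟨e, h⟩)) else x (Sum.inl e)) b := by
    intro x b
    simp only [fiberSum_eq_sum_ite, Fintype.sum_sum_type, subdivRight, Sum.elim_inl, Sum.elim_inr,
      Sum.inl.injEq, reduceCtorEq, if_false, Finset.sum_const_zero, zero_add]
    have h2 : (∑ d : D, if r d = b then x (Sum.inr (Sum.inr d)) else 0) =
        ∑ e, if h : e ∈ D then (if r e = b then x (Sum.inr (Sum.inr ⟨e, h⟩)) else 0) else 0 := by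
      rw [Finset.sum_dite]
      simp only [Finset.sum_const_zero, add_zero]
      symm
      refine Finset.sum_bij (fun e _ => ⟨e.1, (Finset.mem_filter.1 e.2).2⟩) ?_ ?_ ?_ ?_
      · simp
      · rintro ⟨a, ha⟩ - ⟨b, hb⟩ - h
        simpa using h
      · rintro ⟨d, hd⟩ -
        exact ⟨⟨d, by simp [hd]⟩, by simp, rfl⟩
      · simp
    rw [h2, ← Finset.sum_add_distrib]
    refine Finset.sum_congr rfl fun e _ => ?_
    by_cases h : e ∈ D <;> simp [h]
  have hrr : ∀ (x : E ⊕ (D ⊕ D) → ℝ) (d : D), fiberSum (subdivRight r D) x (Sum.inr d) =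
      x (Sum.inl d) + x (Sum.inr (Sum.inl d)) := by
    intro x d
    simp only [fiberSum_eq_sum_ite, Fintype.sum_sum_type, subdivRight, Sum.elim_inl, Sum.elim_inr,
      Sum.inr.injEq, reduceCtorEq, if_false, Finset.sum_const_zero, add_zero]
    congr 1
    · rw [Finset.sum_eq_single d.1]
      · simp
      · intro e _ he
        by_cases h : e ∈ D
        · simp only [h, dite_true, Sum.inr.injEq]
          rw [if_neg]
          rintro rfl
          exact he rfl
        · simp [h]
      · simp
    · simp
  refine AffEq.of_preservesLines
    (fun x => Sum.elim x (Sum.elim (fun d => 1 - x d) (fun d => x d)))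
    (fun x e => x (Sum.inl e)) ?_ ?_ ?_ ?_
  · intro x y t
    ext e
    rcases e with e | e | e <;> simp
    ring
  · intro x y t
    ext e
    simp
  · rintro x ⟨h0, hl, hr⟩
    refine ⟨⟨?_, ?_, ?_⟩, rfl⟩
    · rintro (e | e | e)
      · exact h0 e
      · simpa using fiberSum_le_one_of_mem h0 hl e
      · exact h0 e
    · rintro (a | d)
      · rw [hli]; exact hl a
      · rw [hlr]; simp
    · rintro (b | d)
      · rw [hri, ← hr b]
        refine fiberSum_congr _ fun e _ => ?_
        split_ifs <;> rfl
      · rw [hrr]; simp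
  · rintro x ⟨h0, hl, hr⟩
    have hmid : ∀ d : D, x (Sum.inr (Sum.inl d)) = 1 - x (Sum.inl d) := by
      intro d
      have := hr (Sum.inr d)
      rw [hrr] at this
      linarith
    have hend : ∀ d : D, x (Sum.inr (Sum.inr d)) = x (Sum.inl d) := by
      intro d
      have := hl (Sum.inr d)
      rw [hlr, hmid] at this
      linarith
    refine ⟨⟨fun e => h0 _, fun a => ?_, fun b => ?_⟩, ?_⟩
    · rw [← hli, hl]
    · rw [← hr (Sum.inl b), hri]
      refine fiberSum_congr _ fun e _ => ?_
      split_ifs with h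
      · rw [hend]
      · rfl
    · ext e
      rcases e with e | e | e
      · rfl
      · exact (hmid e).symm
      · exact (hend e).symm

/-- The pieces of a subdivided edge differ in which of their ends are new, and each new vertex
belongs to only one subdivided edge. -/
theorem subdiv_injective {E A B : Type} (l : E → A) (r : E → B) (D : Finset E)
    (hinj : ∀ e ∉ D, ∀ e' ∉ D, l e = l e' → r e = r e' → e = e') (e e' : E ⊕ (D ⊕ D))
    (hl : subdivLeft l D e = subdivLeft l D e') (hr : subdivRight r D e = subdivRight r D e') :
    e = e' := by
  classical
  rcases e with e | e | e <;> rcases e' with e' | e' | e' <;>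
    simp only [subdivLeft, subdivRight, Sum.elim_inl, Sum.elim_inr, Sum.inl.injEq, Sum.inr.injEq,
      reduceCtorEq] at hl hr
  · by_cases h : e ∈ D <;> by_cases h' : e' ∈ D <;> simp [h, h'] at hr
    · rw [hr]
    · rw [hinj e h e' h' hl hr]
  · rw [hl]
  · rw [hl]

/-- A bipartite multigraph whose edges outside `D` form a simple graph has its fractional perfect
matchings realized as a face of a Birkhoff polytope, at the cost of one row for each edge in `D`. -/
theorem exists_birkhoffFace_affEq [Fintype A] [Fintype B] (l : E → A) (r : E → B) (D : Finset E)
    (hinj : ∀ e ∉ D, ∀ e' ∉ D, l e = l e' → r e = r e' → e = e')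
    (hne : (matchPoly l r).Nonempty) {n : ℕ} (hn : Fintype.card A + D.card = n) :
    ∃ F : Set (Matrix (Fin n) (Fin n) ℝ), IsBirkhoffFace n F ∧ AffEq (matchPoly l r) F := by
  classical
  have hcard : Fintype.card A = Fintype.card B := card_eq_of_mem_matchPoly hne.some_mem
  let φ : A ⊕ D ≃ Fin n := Fintype.equivFinOfCardEq (by simp [hn])
  let ψ : B ⊕ D ≃ Fin n := Fintype.equivFinOfCardEq (by simp [← hn, hcard])
  have h1 := matchPoly_affEq_subdiv l r D
  rw [← matchPoly_equiv_comp _ _ φ ψ] at h1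
  have h2 := h1.trans (matchPoly_affEq_support (φ ∘ subdivLeft l D) (ψ ∘ subdivRight r D)
    fun e e' hl hr => subdiv_injective l r D hinj e e' (φ.injective hl) (ψ.injective hr))
  exact ⟨_, isBirkhoffFace_support _ (h2.nonempty hne), h2⟩

end Subdivision

/-! ### Birkhoff faces as matching polytopes -/

/-- A Birkhoff face consists of all doubly stochastic matrices with a certain support, which is the
support of one of them. -/
theorem IsBirkhoffFace.exists_matchPoly {n : ℕ} {F : Set (Matrix (Fin n) (Fin n) ℝ)}
    (hF : IsBirkhoffFace n F) :
    ∃ (E : Type) (_ : Fintype E) (l r : E → Fin n),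
      (∃ x ∈ matchPoly l r, ∀ e, 0 < x e) ∧ AffEq (matchPoly l r) F := by
  classical
  obtain ⟨hne, hexp⟩ := hF
  obtain ⟨m, hm⟩ := hexp hne
  have hsub : F ⊆ birkhoffPolytope n := hexp.subset
  have hconv : Convex ℝ F := hexp.convex (convex_convexHull ℝ _)
  -- a matrix of maximal support
  have hY : ∀ s : Finset (Fin n × Fin n), (∀ ij ∈ s, ∃ M ∈ F, M ij.1 ij.2 ≠ 0) →
      ∃ Y ∈ F, ∀ ij ∈ s, 0 < Y ij.1 ij.2 := by
    intro s
    induction s using Finset.induction_on with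
    | empty => exact fun _ => ⟨hne.some, hne.some_mem, by simp⟩
    | insert ij s _ ih =>
      intro h
      obtain ⟨Y, hYF, hYs⟩ := ih fun k hk => h k (Finset.mem_insert_of_mem hk)
      obtain ⟨M, hMF, hM⟩ := h ij (Finset.mem_insert_self _ _)
      have hY0 := (mem_birkhoffPolytope_iff.1 (hsub hYF)).1
      have hM0 := (mem_birkhoffPolytope_iff.1 (hsub hMF)).1
      refine ⟨(1 / 2 : ℝ) • Y + (1 / 2 : ℝ) • M,
        hconv hYF hMF (by norm_num) (by norm_num) (by norm_num), fun k hk => ?_⟩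
      simp only [Matrix.add_apply, Matrix.smul_apply, smul_eq_mul]
      rcases Finset.mem_insert.1 hk with rfl | hk
      · have := lt_of_le_of_ne (hM0 k.1 k.2) (Ne.symm hM)
        have := hY0 k.1 k.2
        linarith
      · have := hYs k hk
        have := hM0 k.1 k.2
        linarith
  let T : Finset (Fin n × Fin n) := Finset.univ.filter fun ij => ∃ M ∈ F, M ij.1 ij.2 ≠ 0
  obtain ⟨Y, hYF, hYpos⟩ := hY T (by simp [T])
  let E : Type := T
  let l : E → Fin n := fun e => e.1.1
  let r : E → Fin n := fun e => e.1.2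
  have hinj : ∀ e e' : E, l e = l e' → r e = r e' → e = e' :=
    fun e e' h h' => Subtype.ext (Prod.ext h h')
  have hYB := mem_birkhoffPolytope_iff.1 (hsub hYF)
  have hFeq : {M ∈ birkhoffPolytope n | ∀ i j, M i j ≠ 0 → ∃ e : E, l e = i ∧ r e = j} = F := by
    ext M
    constructor
    · rintro ⟨hM, hMT⟩
      have hMB := mem_birkhoffPolytope_iff.1 hM
      have hMle : ∀ i j, M i j ≤ 1 := fun i j => by
        rw [← hMB.2.1 i]
        exact Finset.single_le_sum (f := fun j => M i j) (fun j _ => hMB.1 i j) (Finset.mem_univ j)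
      obtain ⟨ε, hε0, hε1, hε⟩ : ∃ ε : ℝ, 0 < ε ∧ ε < 1 ∧ ∀ i j, ε * M i j ≤ Y i j := by
        have hfin : ∀ s : Finset (Fin n × Fin n), (∀ k ∈ s, 0 < Y k.1 k.2) →
            ∃ ε : ℝ, 0 < ε ∧ ε < 1 ∧ ∀ k ∈ s, ε ≤ Y k.1 k.2 := by
          intro s
          induction s using Finset.induction_on with
          | empty => exact fun _ => ⟨1 / 2, by norm_num, by norm_num, by simp⟩
          | insert k s _ ih =>
            intro h
            obtain ⟨ε, h0, h1, h2⟩ := ih fun k hk => h k (Finset.mem_insert_of_mem hk)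
            refine ⟨min ε (Y k.1 k.2), lt_min h0 (h k (Finset.mem_insert_self _ _)),
              (min_le_left _ _).trans_lt h1, fun k' hk' => ?_⟩
            rcases Finset.mem_insert.1 hk' with rfl | hk'
            · exact min_le_right _ _
            · exact (min_le_left _ _).trans (h2 k' hk')
        obtain ⟨ε, h0, h1, h2⟩ := hfin T hYpos
        refine ⟨ε, h0, h1, fun i j => ?_⟩
        by_cases hz : M i j = 0
        · rw [hz, mul_zero]; exact hYB.1 i j
        · obtain ⟨e, rfl, rfl⟩ := hMT i j hz
          exact (mul_le_of_le_one_right h0.le (hMle _ _)).trans (h2 e.1 e.2)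
      -- `N` is the point with `Y = ε M + (1 - ε) N`, and it is nonnegative by the choice of `ε`. A
      -- functional that is maximal at `Y` is then maximal at `M` as well.
      let N : Matrix (Fin n) (Fin n) ℝ := (1 - ε)⁻¹ • (Y - ε • M)
      have h1ε : 0 < 1 - ε := by linarith
      have hN : N ∈ birkhoffPolytope n := by
        refine mem_birkhoffPolytope_iff.2 ⟨fun i j => ?_, fun i => ?_, fun j => ?_⟩
        · simp only [N, Matrix.smul_apply, Matrix.sub_apply, smul_eq_mul]
          exact mul_nonneg (inv_nonneg.2 h1ε.le) (sub_nonneg.2 (hε i j))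
        · simp only [N, Matrix.smul_apply, Matrix.sub_apply, smul_eq_mul, ← Finset.mul_sum,
            Finset.sum_sub_distrib, hYB.2.1, hMB.2.1, mul_one]
          exact inv_mul_cancel₀ h1ε.ne'
        · simp only [N, Matrix.smul_apply, Matrix.sub_apply, smul_eq_mul, ← Finset.mul_sum,
            Finset.sum_sub_distrib, hYB.2.2, hMB.2.2, mul_one]
          exact inv_mul_cancel₀ h1ε.ne'
      have hYeq : Y = ε • M + (1 - ε) • N := by
        simp only [N, smul_smul, mul_inv_cancel₀ h1ε.ne', one_smul]
        abel
      have hY' := hYF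
      rw [hm] at hY' ⊢
      refine ⟨hM, fun Z hZ => ?_⟩
      have hmY : m Y = ε * m M + (1 - ε) * m N := by
        conv_lhs => rw [hYeq]
        simp
      have hNle := hY'.2 N hN
      have hZle := hY'.2 Z hZ
      have : (1 - ε) * m N ≤ (1 - ε) * m Y := mul_le_mul_of_nonneg_left hNle h1ε.le
      have : ε * m Y ≤ ε * m M := by linarith
      have := le_of_mul_le_mul_left this hε0
      linarith
    · intro hM
      exact ⟨hsub hM, fun i j hij => ⟨⟨(i, j), by simpa [T] using ⟨M, hM, hij⟩⟩, rfl, rfl⟩⟩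
  have haff : AffEq (matchPoly l r) F := hFeq ▸ matchPoly_affEq_support l r hinj
  refine ⟨E, inferInstance, l, r, ⟨fun e => Y (l e) (r e), ?_, fun e => hYpos e.1 e.2⟩, haff⟩
  have hYT : ∀ i j, Y i j ≠ 0 → (i, j) ∈ T := fun i j h => by simpa [T] using ⟨Y, hYF, h⟩
  refine ⟨fun e => hYB.1 _ _, fun i => ?_, fun j => ?_⟩
  · rw [← hYB.2.1 i, fiberSum_eq_sum_filter]
    refine Finset.sum_bij_ne_zero (fun e _ _ => r e) (by simp) ?_ ?_ ?_
    · intro e he _ e' he' _ h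
      simp only [Finset.mem_filter, Finset.mem_univ, true_and] at he he'
      exact hinj e e' (he.trans he'.symm) h
    · intro j _ hj
      exact ⟨⟨(i, j), hYT i j hj⟩, by simp [l], hj, rfl⟩
    · intro e he _
      simp only [Finset.mem_filter, Finset.mem_univ, true_and] at he
      rw [he]
  · rw [← hYB.2.2 j, fiberSum_eq_sum_filter]
    refine Finset.sum_bij_ne_zero (fun e _ _ => l e) (by simp) ?_ ?_ ?_
    · intro e he _ e' he' _ h
      simp only [Finset.mem_filter, Finset.mem_univ, true_and] at he he'
      exact hinj e e' h (he.trans he'.symm)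
    · intro i _ hi
      exact ⟨⟨(i, j), hYT i j hi⟩, by simp [r], hi, rfl⟩
    · intro e he _
      simp only [Finset.mem_filter, Finset.mem_univ, true_and] at he
      rw [he]

/-! ### Contraction of vertices of degree two -/

/-- Contracting a vertex of degree two. -/
theorem exists_contraction {E A B : Type} [Fintype E] [Fintype A] [Fintype B] {l : E → A}
    {r : E → B} {e f : E} (hef : r e ≠ r f) (hlf : l f = l e)
    (hdeg : ∀ g, l g = l e → g = e ∨ g = f) (hpos : ∃ x ∈ matchPoly l r, ∀ e, 0 < x e) :
    ∃ (E' A' B' : Type) (_ : Fintype E') (_ : Fintype A') (_ : Fintype B') (l' : E' → A')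
      (r' : E' → B'), Fintype.card A' < Fintype.card A ∧
        (∃ x ∈ matchPoly l' r', ∀ e, 0 < x e) ∧ AffEq (matchPoly l r) (matchPoly l' r') := by
  classical
  have hne : e ≠ f := fun h => hef (h ▸ rfl)
  let E' := {g : E // l g ≠ l e}
  let A' := {a : A // a ≠ l e}
  let B' := {b : B // b ≠ r f}
  let l' : E' → A' := fun g => ⟨l g.1, g.2⟩
  let r' : E' → B' := fun g => if h : r g.1 = r f then ⟨r e, hef⟩ else ⟨r g.1, h⟩
  -- `S b y` is the weight at `b` of the surviving edges. The vertices `r e` and `r f` are merged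
  -- into `r e`, where the surviving weight is `S (r e) y + S (r f) y`.
  let S : B → (E' → ℝ) → ℝ := fun b y => ∑ h : E', if r h.1 = b then y h else 0
  have hsum : ∀ F : E → ℝ, ∑ g, F g = (∑ g : E', F g.1) + (F e + F f) := by
    intro F
    rw [← Fintype.sum_subtype_add_sum_subtype (fun g => l g ≠ l e) F]
    congr 1
    have : (Finset.univ.filter fun g => ¬ l g ≠ l e) = {e, f} := by
      ext g
      simp only [not_not, Finset.mem_filter, Finset.mem_univ, true_and, Finset.mem_insert,
        Finset.mem_singleton]
      exact ⟨hdeg g, by rintro (rfl | rfl) <;> simp [hlf]⟩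
    rw [← Finset.sum_pair hne, ← this]
    exact (Finset.sum_subtype _ (by simp) _).symm
  have hSl : ∀ (x : E → ℝ) (a : A'), fiberSum l x a.1 = fiberSum l' (fun g => x g.1) a := by
    intro x a
    rw [fiberSum_eq_sum_ite, hsum, fiberSum_eq_sum_ite, hlf, if_neg a.2.symm,
      if_neg a.2.symm, add_zero, add_zero]
    exact Finset.sum_congr rfl fun g _ => if_congr (Subtype.ext_iff (a1 := l' g)).symm rfl rfl
  have hSv : ∀ x : E → ℝ, fiberSum l x (l e) = x e + x f := by
    intro x
    rw [fiberSum_eq_sum_ite, hsum, hlf, if_pos rfl, if_pos rfl, add_eq_right]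
    exact Finset.sum_eq_zero fun g _ => if_neg g.2
  have hSr : ∀ (x : E → ℝ) (b : B), fiberSum r x b = S b (fun g => x g.1) +
      ((if r e = b then x e else 0) + (if r f = b then x f else 0)) := by
    intro x b
    rw [fiberSum_eq_sum_ite, hsum]
  have hre : ∀ y : E' → ℝ, fiberSum r' y ⟨r e, hef⟩ = S (r e) y + S (r f) y := by
    intro y
    rw [fiberSum_eq_sum_ite, ← Finset.sum_add_distrib]
    refine Finset.sum_congr rfl fun g _ => ?_
    by_cases h : r g.1 = r f
    · simp [r', h, hef.symm]
    · have hg : r' g = ⟨r g.1, h⟩ := dif_neg h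
      rw [hg, if_neg h, add_zero]
      exact if_congr Subtype.ext_iff rfl rfl
  have hrb : ∀ (y : E' → ℝ) (b : B'), b.1 ≠ r e → fiberSum r' y b = S b.1 y := by
    intro y b hb
    rw [fiberSum_eq_sum_ite]
    refine Finset.sum_congr rfl fun g _ => ?_
    by_cases h : r g.1 = r f
    · have h1 : r' g ≠ b := fun h' => hb (by rw [← h']; simp [r', h])
      have h2 : r g.1 ≠ b.1 := fun h' => b.2 (h' ▸ h)
      rw [if_neg h1, if_neg h2]
    · have hg : r' g = ⟨r g.1, h⟩ := dif_neg h
      rw [hg]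
      exact if_congr Subtype.ext_iff rfl rfl
  have hfwd : ∀ x ∈ matchPoly l r, (fun g : E' => x g.1) ∈ matchPoly l' r' := by
    rintro x ⟨h0, hl, hr⟩
    have h1 := hl (l e)
    have h2 := hr (r e)
    have h3 := hr (r f)
    rw [hSv] at h1
    rw [hSr, if_pos rfl, if_neg hef.symm] at h2
    rw [hSr, if_pos rfl, if_neg hef] at h3
    refine ⟨fun g => h0 _, fun a => ?_, fun b => ?_⟩
    · rw [← hSl, hl]
    · by_cases hb : b.1 = r e
      · have : b = ⟨r e, hef⟩ := Subtype.ext hb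
        rw [this, hre]
        linarith
      · have h4 := hr b.1
        rw [hSr, if_neg (Ne.symm hb), if_neg b.2.symm, add_zero, add_zero] at h4
        rw [hrb _ _ hb, h4]
  refine ⟨E', A', B', inferInstance, inferInstance, inferInstance, l', r',
    Fintype.card_subtype_lt (x := l e) (by simp), ?_, ?_⟩
  · obtain ⟨x, hx, hx0⟩ := hpos
    exact ⟨_, hfwd x hx, fun g => hx0 _⟩
  -- The deleted edges are recovered from their right ends: `e` has to carry `1 - S (r e) y`, which
  -- equals `S (r f) y ≥ 0` because the sum at the merged vertex is one; likewise for `f`.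
  refine AffEq.of_preservesLines (fun x g => x g.1)
    (fun y g => if h : l g ≠ l e then y ⟨g, h⟩ else 1 - S (r g) y) ?_ ?_ ?_ ?_
  · intro x y t
    rfl
  · intro x y t
    have hS : ∀ b, S b ((1 - t) • x + t • y) = (1 - t) * S b x + t * S b y := by
      intro b
      simp only [S, Finset.mul_sum, ← Finset.sum_add_distrib]
      refine Finset.sum_congr rfl fun g _ => ?_
      split_ifs <;> simp
    ext g
    by_cases h : l g = l e
    · simp [h, hS]; ring
    · simp [h]
  · intro x hx
    refine ⟨hfwd x hx, ?_⟩
    obtain ⟨h0, hl, hr⟩ := hx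
    have h2 := hr (r e)
    have h3 := hr (r f)
    rw [hSr, if_pos rfl, if_neg hef.symm] at h2
    rw [hSr, if_pos rfl, if_neg hef] at h3
    ext g
    by_cases h : l g = l e
    · rcases hdeg g h with rfl | rfl
      · simp only [ne_eq, not_true, dite_false]; linarith
      · simp only [h, ne_eq, not_true, dite_false]; linarith
    · simp [h]
  · rintro y ⟨h0, hl, hr⟩
    have hS0 : ∀ b, 0 ≤ S b y := fun b => Finset.sum_nonneg fun g _ => by
      split_ifs
      exacts [h0 _, le_rfl]
    have h1 := hr ⟨r e, hef⟩
    rw [hre] at h1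
    have hback : (fun g : E' => if h : l g.1 ≠ l e then y ⟨g.1, h⟩ else 1 - S (r g.1) y) = y := by
      ext g
      rw [dif_pos g.2]
    refine ⟨⟨fun g => ?_, fun a => ?_, fun b => ?_⟩, hback⟩
    · by_cases h : l g = l e
      · rcases hdeg g h with rfl | rfl
        · simp only [ne_eq, not_true, dite_false]; linarith [hS0 (r f)]
        · simp only [h, ne_eq, not_true, dite_false]; linarith [hS0 (r e)]
      · simp [h, h0]
    · by_cases ha : a = l e
      · subst ha
        rw [hSv]
        simp only [hlf, ne_eq, not_true, dite_false]
        linarith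
      · have := hSl (fun g => if h : l g ≠ l e then y ⟨g, h⟩ else 1 - S (r g) y) ⟨a, ha⟩
        rw [hback] at this
        exact this.trans (hl _)
    · rw [hSr, hback]
      simp only [hlf, ne_eq, not_true, dite_false]
      by_cases hb : r e = b
      · subst hb
        rw [if_pos rfl, if_neg hef.symm]; ring
      · by_cases hb' : r f = b
        · subst hb'
          rw [if_pos rfl, if_neg hb]; ring
        · rw [if_neg hb, if_neg hb', add_zero, add_zero,
            ← hrb y ⟨b, Ne.symm hb'⟩ (Ne.symm hb), hr]

/-! ### Connectedness and products -/

section Splitting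

variable {E A B : Type} [Fintype E]

/-- The bipartite graph with end points `l` and `r` is connected. -/
def IsConn (l : E → A) (r : E → B) : Prop :=
  ∀ (p : A → Prop) (q : B → Prop), (∀ e, p (l e) ↔ q (r e)) →
    ((∀ a, p a) ∧ ∀ b, q b) ∨ ((∀ a, ¬ p a) ∧ ∀ b, ¬ q b)

theorem IsConn.swap {E A B : Type} {l : E → A} {r : E → B} (h : IsConn l r) : IsConn r l := by
  intro p q hpq
  have := h q p fun e => (hpq e).symm
  tauto

theorem exists_edge_left {l : E → A} {r : E → B} {x : E → ℝ} (hx : x ∈ matchPoly l r) (a : A) :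
    ∃ e, l e = a := by
  classical
  by_contra h
  push Not at h
  have h1 := hx.2.1 a
  rw [fiberSum_eq_sum_filter, Finset.filter_false_of_mem (fun e _ => h e)] at h1
  simp at h1

theorem exists_edge_right {l : E → A} {r : E → B} {x : E → ℝ} (hx : x ∈ matchPoly l r) (b : B) :
    ∃ e, r e = b :=
  exists_edge_left (l := r) (r := l) (matchPoly_swap l r ▸ hx) b

theorem fiberSum_subtype (l : E → A) (p : A → Prop) (s : E → Prop) [Fintype {e // s e}]
    (hs : ∀ e, s e ↔ p (l e)) (x : E → ℝ) (a : A) (ha : p a) :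
    fiberSum (fun e : {e // s e} => (⟨l e.1, (hs _).1 e.2⟩ : {a // p a})) (fun e => x e.1) ⟨a, ha⟩ =
      fiberSum l x a := by
  classical
  rw [fiberSum_eq_sum_ite, fiberSum_eq_sum_ite]
  symm
  have h0 : (∑ e, if l e = a then x e else 0) =
      ∑ e with s e, if l e = a then x e else 0 := by
    symm
    refine Finset.sum_subset (Finset.filter_subset _ _) fun e _ he => if_neg ?_
    rintro rfl
    exact he (by simpa using (hs e).2 ha)
  rw [h0, Finset.sum_subtype (Finset.univ.filter s) (p := s) (F := inferInstance) (by simp)]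
  exact Finset.sum_congr rfl fun e _ => if_congr
    ⟨fun h => Subtype.ext h, fun h => congrArg Subtype.val h⟩ rfl rfl

/-- The fractional matchings of a disjoint union of two graphs form a product. -/
theorem matchPoly_affEq_prod (l : E → A) (r : E → B) (p : A → Prop) (q : B → Prop)
    (hpq : ∀ e, p (l e) ↔ q (r e)) [Fintype {e // p (l e)}] [Fintype {e // ¬ p (l e)}] :
    AffEq (matchPoly l r)
      (matchPoly (fun e : {e // p (l e)} => (⟨l e.1, e.2⟩ : {a // p a}))
          (fun e => (⟨r e.1, (hpq _).1 e.2⟩ : {b // q b})) ×ˢ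
        matchPoly (fun e : {e // ¬ p (l e)} => (⟨l e.1, e.2⟩ : {a // ¬ p a}))
          (fun e => (⟨r e.1, (not_congr (hpq _)).1 e.2⟩ : {b // ¬ q b}))) := by
  classical
  have hl1 := fiberSum_subtype l p (fun e => p (l e)) (fun _ => Iff.rfl)
  have hl2 := fiberSum_subtype l (fun a => ¬ p a) (fun e => ¬ p (l e)) (fun _ => Iff.rfl)
  have hr1 := fiberSum_subtype r q (fun e => p (l e)) hpq
  have hr2 := fiberSum_subtype r (fun b => ¬ q b) (fun e => ¬ p (l e)) (fun e => not_congr (hpq e))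
  refine AffEq.of_preservesLines
    (fun x => (fun e : {e // p (l e)} => x e.1, fun e : {e // ¬ p (l e)} => x e.1))
    (fun y e => if h : p (l e) then y.1 ⟨e, h⟩ else y.2 ⟨e, h⟩) ?_ ?_ ?_ ?_
  · intro x y t
    rfl
  · intro x y t
    ext e
    by_cases h : p (l e) <;> simp [h]
  · rintro x ⟨h0, hl, hr⟩
    refine ⟨⟨⟨fun e => h0 _, fun a => ?_, fun b => ?_⟩, ⟨fun e => h0 _, fun a => ?_, fun b => ?_⟩⟩,
      ?_⟩
    · exact (hl1 x a.1 a.2).trans (hl _)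
    · exact (hr1 x b.1 b.2).trans (hr _)
    · exact (hl2 x a.1 a.2).trans (hl _)
    · exact (hr2 x b.1 b.2).trans (hr _)
    · ext e
      by_cases h : p (l e) <;> simp [h]
  · rintro ⟨y, z⟩ ⟨⟨hy0, hyl, hyr⟩, ⟨hz0, hzl, hzr⟩⟩
    have e1 : (fun e : {e // p (l e)} => if h : p (l e.1) then y ⟨e.1, h⟩ else z ⟨e.1, h⟩) = y := by
      ext e
      rw [dif_pos e.2]
    have e2 : (fun e : {e // ¬ p (l e)} =>
        if h : p (l e.1) then y ⟨e.1, h⟩ else z ⟨e.1, h⟩) = z := by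
      ext e
      rw [dif_neg e.2]
    refine ⟨⟨fun e => ?_, fun a => ?_, fun b => ?_⟩, Prod.ext e1 e2⟩
    · by_cases h : p (l e)
      · simpa [h] using hy0 _
      · simpa [h] using hz0 _
    · by_cases h : p a
      · rw [← hl1 _ a h]
        simp only [e1]
        exact hyl _
      · rw [← hl2 _ a h]
        simp only [e2]
        exact hzl _
    · by_cases h : q b
      · rw [← hr1 _ b h]
        simp only [e1]
        exact hyr _
      · rw [← hr2 _ b h]
        simp only [e2]
        exact hzr _

end Splitting

/-- A factor that is a point may be dropped. -/
theorem AffEq.prod_of_polytopeDim_eq_zero {E E' : Type*} [AddCommGroup E] [Module ℝ E]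
    [AddCommGroup E'] [Module ℝ E'] [FiniteDimensional ℝ E'] {P : Set E} {P' : Set E'}
    (hne : P'.Nonempty) (hdim : polytopeDim P' = 0) : AffEq (P ×ˢ P') P := by
  obtain ⟨c, hc⟩ := hne
  have hc' : ∀ y ∈ P', y = c := by
    intro y hy
    have h := vsub_mem_vectorSpan ℝ hy hc
    rw [Submodule.finrank_eq_zero.1 hdim] at h
    simpa [sub_eq_zero] using h
  refine AffEq.of_preservesLines Prod.fst (fun x => (x, c)) ?_ ?_ ?_ ?_
  · intro x y t
    rfl
  · intro x y t
    refine Prod.ext rfl ?_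
    simp only [Prod.snd_add, Prod.smul_snd]
    module
  · rintro ⟨x, y⟩ ⟨hx, hy⟩
    exact ⟨hx, by rw [hc' y hy]⟩
  · intro x hx
    exact ⟨⟨hx, hc⟩, rfl⟩

theorem AffEq.prod_comm {E E' : Type*} [AddCommGroup E] [Module ℝ E]
    [AddCommGroup E'] [Module ℝ E'] (P : Set E) (P' : Set E') : AffEq (P ×ˢ P') (P' ×ˢ P) :=
  AffEq.of_preservesLines Prod.swap Prod.swap (fun _ _ _ => rfl) (fun _ _ _ => rfl)
    (fun _ hx => ⟨⟨hx.2, hx.1⟩, rfl⟩) (fun _ hx => ⟨⟨hx.2, hx.1⟩, rfl⟩)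

/-! ### Lower bound for the dimension -/

section Dimension

variable {E A B : Type} [Fintype E]

/-- The linear map that sends a weighting of the edges to its sums at all vertices. -/
noncomputable def vertexSums (l : E → A) (r : E → B) : (E → ℝ) →ₗ[ℝ] (A → ℝ) × (B → ℝ) where
  toFun x := (fiberSum l x, fiberSum r x)
  map_add' x y := by
    refine Prod.ext (funext fun a => ?_) (funext fun b => ?_)
    · simpa using fiberSum_linear l x y 1 1 a
    · simpa using fiberSum_linear r x y 1 1 b
  map_smul' c x := by
    refine Prod.ext (funext fun a => ?_) (funext fun b => ?_)
    · simpa using fiberSum_linear l x 0 c 0 a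
    · simpa using fiberSum_linear r x 0 c 0 b

theorem mem_ker_vertexSums {l : E → A} {r : E → B} {z : E → ℝ} :
    z ∈ LinearMap.ker (vertexSums l r) ↔
      (∀ a, fiberSum l z a = 0) ∧ ∀ b, fiberSum r z b = 0 := by
  rw [LinearMap.mem_ker]
  constructor
  · intro h
    exact ⟨fun a => congrFun (congrArg Prod.fst h) a, fun b => congrFun (congrArg Prod.snd h) b⟩
  · rintro ⟨h, h'⟩
    exact Prod.ext (funext h) (funext h')

/-- The total over the left vertices equals the total over the right vertices, so the vertex sums
lie in a hyperplane and the rank is at most `|A| + |B| - 1`. -/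
theorem card_add_one_le_finrank_ker [Fintype A] [Fintype B] [Nonempty A] (l : E → A)
    (r : E → B) : Fintype.card E + 1 ≤
      Module.finrank ℝ (LinearMap.ker (vertexSums l r)) + Fintype.card A + Fintype.card B := by
  classical
  let φ : (A → ℝ) × (B → ℝ) →ₗ[ℝ] ℝ :=
    { toFun := fun u => ∑ a, u.1 a - ∑ b, u.2 b
      map_add' := fun u v => by simp [Finset.sum_add_distrib]; ring
      map_smul' := fun c u => by simp [Finset.mul_sum, mul_sub] }
  have hφ : ∀ u, φ u = ∑ a, u.1 a - ∑ b, u.2 b := fun _ => rfl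
  have hsurj : LinearMap.range φ = ⊤ := by
    rw [LinearMap.range_eq_top]
    intro c
    refine ⟨(Pi.single (Classical.arbitrary A) c, 0), ?_⟩
    simp [hφ]
  have hle : LinearMap.range (vertexSums l r) ≤ LinearMap.ker φ := by
    rintro _ ⟨x, rfl⟩
    rw [LinearMap.mem_ker, hφ]
    change ∑ a, fiberSum l x a - ∑ b, fiberSum r x b = 0
    rw [sum_fiberSum, sum_fiberSum, sub_self]
  have h1 := Submodule.finrank_mono hle
  have h2 := LinearMap.finrank_range_add_finrank_ker φ
  have h3 := LinearMap.finrank_range_add_finrank_ker (vertexSums l r)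
  rw [hsurj, finrank_top, Module.finrank_self, Module.finrank_prod, Module.finrank_fintype_fun_eq_card,
    Module.finrank_fintype_fun_eq_card] at h2
  rw [Module.finrank_fintype_fun_eq_card] at h3
  omega

/-- Starting from a strictly positive matching one can move a little in every direction that keeps
the vertex sums. -/
theorem finrank_ker_le_polytopeDim {l : E → A} {r : E → B}
    (hpos : ∃ x ∈ matchPoly l r, ∀ e, 0 < x e) :
    Module.finrank ℝ (LinearMap.ker (vertexSums l r)) ≤ polytopeDim (matchPoly l r) := by
  classical
  obtain ⟨x, hx, hx0⟩ := hpos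
  refine Submodule.finrank_mono fun z hz => ?_
  rw [mem_ker_vertexSums] at hz
  obtain ⟨ε, hε, hle⟩ : ∃ ε : ℝ, 0 < ε ∧ ∀ e, ε * |z e| ≤ x e := by
    have hfin : ∀ s : Finset E, ∃ ε : ℝ, 0 < ε ∧ ∀ e ∈ s, ε * |z e| ≤ x e := by
      intro s
      induction s using Finset.induction_on with
      | empty => exact ⟨1, one_pos, by simp⟩
      | insert e s _ ih =>
        obtain ⟨ε, h0, h1⟩ := ih
        have hz1 : 0 < |z e| + 1 := by positivity
        refine ⟨min ε (x e / (|z e| + 1)), lt_min h0 (div_pos (hx0 e) hz1), fun e' he' => ?_⟩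
        rcases Finset.mem_insert.1 he' with rfl | he'
        · calc min ε (x e' / (|z e'| + 1)) * |z e'|
              ≤ x e' / (|z e'| + 1) * |z e'| :=
                mul_le_mul_of_nonneg_right (min_le_right _ _) (abs_nonneg _)
            _ ≤ x e' / (|z e'| + 1) * (|z e'| + 1) :=
                mul_le_mul_of_nonneg_left (by linarith) (div_pos (hx0 e') hz1).le
            _ = x e' := div_mul_cancel₀ _ hz1.ne'
        · exact (mul_le_mul_of_nonneg_right (min_le_left _ _) (abs_nonneg _)).trans (h1 e' he')
    obtain ⟨ε, h0, h1⟩ := hfin Finset.univ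
    exact ⟨ε, h0, fun e => h1 e (Finset.mem_univ _)⟩
  have hy : (1 : ℝ) • x + ε • z ∈ matchPoly l r := by
    refine ⟨fun e => ?_, fun a => ?_, fun b => ?_⟩
    · have h1 := hle e
      have h2 := mul_le_mul_of_nonneg_left (neg_abs_le (z e)) hε.le
      simp only [one_smul, Pi.add_apply, Pi.smul_apply, smul_eq_mul]
      linarith
    · rw [fiberSum_linear, hz.1, hx.2.1]; ring
    · rw [fiberSum_linear, hz.2, hx.2.2]; ring
  have h := vsub_mem_vectorSpan ℝ hy hx
  have h2 := Submodule.smul_mem _ ε⁻¹ h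
  simpa [smul_smul, inv_mul_cancel₀ hε.ne'] using h2

/-- With a single left vertex all weights add up to one, so the polytope lies in a hyperplane of the
space of weightings. -/
theorem three_le_card_of_two_le_polytopeDim {l : E → A} {r : E → B} [Subsingleton A]
    (hd : 2 ≤ polytopeDim (matchPoly l r)) :
    3 ≤ Fintype.card E := by
  classical
  let φ : (E → ℝ) →ₗ[ℝ] ℝ := ∑ e, LinearMap.proj e
  have hφ : ∀ x, φ x = ∑ e, x e := fun x => by simp [φ]
  have hE : Nonempty E := by
    by_contra hE
    rw [not_nonempty_iff] at hE
    have : polytopeDim (matchPoly l r) ≤ Module.finrank ℝ (E → ℝ) := Submodule.finrank_le _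
    simp at this
    omega
  have hsurj : LinearMap.range φ = ⊤ := by
    rw [LinearMap.range_eq_top]
    exact fun c => ⟨Pi.single (Classical.arbitrary E) c, by simp [hφ]⟩
  have hone : ∀ x ∈ matchPoly l r, φ x = 1 := by
    intro x hx
    rw [hφ, ← hx.2.1 (l (Classical.arbitrary E)), fiberSum_eq_sum_filter, Finset.filter_true_of_mem]
    exact fun e _ => Subsingleton.elim _ _
  have hle : vectorSpan ℝ (matchPoly l r) ≤ LinearMap.ker φ := by
    refine Submodule.span_le.2 ?_
    rintro _ ⟨x, hx, y, hy, rfl⟩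
    simp [hone x hx, hone y hy]
  have h1 := Submodule.finrank_mono hle
  have h2 := LinearMap.finrank_range_add_finrank_ker φ
  rw [hsurj, finrank_top, Module.finrank_self, Module.finrank_fintype_fun_eq_card] at h2
  unfold polytopeDim at hd
  omega

end Dimension

/-! ### Minimal degree three -/

section Degrees

variable {E A B : Type} [Fintype E]

open Classical in
/-- The number of edges at the vertex `a`. -/
noncomputable def deg (l : E → A) (a : A) : ℕ :=
  (Finset.univ.filter fun e => l e = a).card

theorem deg_eq [DecidableEq A] (l : E → A) (a : A) :
    deg l a = (Finset.univ.filter fun e => l e = a).card := by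
  unfold deg
  congr

/-- In a connected graph a vertex with a single neighbour is the only one on its side. -/
theorem eq_of_unique_neighbour {l : E → A} {r : E → B}
    (hpos : ∃ x ∈ matchPoly l r, ∀ e, 0 < x e) (hconn : IsConn l r) {a : A} {b : B}
    (h : ∀ e, l e = a → r e = b) : (∀ a', a' = a) ∧ ∀ b', b' = b := by
  classical
  obtain ⟨x, hx, hx0⟩ := hpos
  -- The edges at `a` already bring weight one to `b`; a further edge at `b`, having positive
  -- weight, would exceed it.
  have hback : ∀ e, r e = b → l e = a := by
    intro e he
    by_contra hne
    have h1 := hx.2.1 a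
    have h2 := hx.2.2 b
    rw [fiberSum_eq_sum_filter] at h1 h2
    have hlt : ∑ e with l e = a, x e < ∑ e with r e = b, x e := by
      refine Finset.sum_lt_sum_of_subset (i := e) ?_ (by simpa using he) (by simpa using hne) (hx0 e)
        fun e _ _ => (hx0 e).le
      intro e' he'
      simp only [Finset.mem_filter, Finset.mem_univ, true_and] at he' ⊢
      exact h e' he'
    linarith
  rcases hconn (fun a' => a' = a) (fun b' => b' = b) fun e => ⟨h e, hback e⟩ with h | h
  · exact h
  · exact absurd rfl (h.1 a)

/-- If all edges at `a` are parallel, then connectedness leaves one vertex on each side and the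
dimension gives three edges. Otherwise there are two non-parallel edges at `a`, and a third one
because contraction is excluded by `hcontr`. -/
theorem three_le_deg {l : E → A} {r : E → B} (hpos : ∃ x ∈ matchPoly l r, ∀ e, 0 < x e)
    (hconn : IsConn l r) (hd : 2 ≤ polytopeDim (matchPoly l r))
    (hcontr : ∀ e f, r e ≠ r f → l f = l e → ¬ ∀ g, l g = l e → g = e ∨ g = f) (a : A) :
    3 ≤ deg l a := by
  classical
  have hne : (matchPoly l r).Nonempty := hpos.imp fun _ h => h.1
  obtain ⟨e, he⟩ := exists_edge_left hne.some_mem a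
  by_cases hall : ∀ f, l f = a → r f = r e
  · have hA := (eq_of_unique_neighbour hpos hconn hall).1
    have : Subsingleton A := ⟨fun x y => (hA x).trans (hA y).symm⟩
    have h3 := three_le_card_of_two_le_polytopeDim hd
    rwa [deg_eq, Finset.filter_true_of_mem (fun e _ => hA _), Finset.card_univ]
  · push Not at hall
    obtain ⟨f, hf, hfe⟩ := hall
    have h3 := hcontr e f (Ne.symm hfe) (hf.trans he.symm)
    push Not at h3
    obtain ⟨g, hg, hge, hgf⟩ := h3
    have hef : e ≠ f := fun h => hfe (h ▸ rfl)
    rw [deg_eq, ← Finset.card_eq_three.2 ⟨e, f, g, hef, Ne.symm hge, Ne.symm hgf, rfl⟩]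
    refine Finset.card_le_card ?_
    intro x hx
    simp only [Finset.mem_insert, Finset.mem_singleton] at hx
    rcases hx with rfl | rfl | rfl <;> simp [he, hf, hg]

end Degrees

/-! ### Reduction to connected graphs -/

/-- The size is irrelevant here, so all edges may be subdivided. -/
theorem exists_birkhoffFace_of_nonempty {E A B : Type} [Fintype E] [Fintype A] [Fintype B]
    (l : E → A) (r : E → B) (hne : (matchPoly l r).Nonempty) :
    ∃ (n : ℕ) (F : Set (Matrix (Fin n) (Fin n) ℝ)), IsBirkhoffFace n F ∧
      AffEq (matchPoly l r) F :=
  ⟨_, exists_birkhoffFace_affEq l r Finset.univ (by simp) hne rfl⟩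

/-- A face of dimension at least two of a Birkhoff polytope is a product of faces of positive
dimension, or it comes from a connected bipartite multigraph of minimal degree at least three. -/
theorem IsBirkhoffFace.exists_prod_or_reduced {n : ℕ} {F : Set (Matrix (Fin n) (Fin n) ℝ)}
    (hF : IsBirkhoffFace n F) (hd : 2 ≤ polytopeDim F) :
    (∃ (n₁ n₂ : ℕ) (F₁ : Set (Matrix (Fin n₁) (Fin n₁) ℝ)) (F₂ : Set (Matrix (Fin n₂) (Fin n₂) ℝ)),
      IsBirkhoffFace n₁ F₁ ∧ IsBirkhoffFace n₂ F₂ ∧ 1 ≤ polytopeDim F₁ ∧ 1 ≤ polytopeDim F₂ ∧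
        AffEq F (F₁ ×ˢ F₂)) ∨
    ∃ (E A B : Type) (_ : Fintype E) (_ : Fintype A) (_ : Fintype B) (l : E → A) (r : E → B),
      (∃ x ∈ matchPoly l r, ∀ e, 0 < x e) ∧ AffEq F (matchPoly l r) ∧ IsConn l r ∧
        (∀ a, 3 ≤ deg l a) ∧ ∀ b, 3 ≤ deg r b := by
  classical
  rw [or_iff_not_imp_left]
  intro hprod
  -- Representations are compared by their number of left vertices, and one with the smallest number
  -- is chosen.
  let Sys : ℕ → Prop := fun m =>
    ∃ (E A B : Type) (_ : Fintype E) (_ : Fintype A) (_ : Fintype B) (l : E → A) (r : E → B),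
      Fintype.card A = m ∧ (∃ x ∈ matchPoly l r, ∀ e, 0 < x e) ∧ AffEq F (matchPoly l r)
  have hSys : ∃ m, Sys m := by
    obtain ⟨E, _, l, r, hpos, haff⟩ := hF.exists_matchPoly
    exact ⟨_, E, Fin n, Fin n, inferInstance, inferInstance, inferInstance, l, r, rfl, hpos, haff.symm⟩
  obtain ⟨E, A, B, _, _, _, l, r, hcard, hpos, haff⟩ := Nat.find_spec hSys
  have hmin : ∀ {E' A' B' : Type} [Fintype E'] [Fintype A'] [Fintype B'] {l' : E' → A'}
      {r' : E' → B'}, (∃ x ∈ matchPoly l' r', ∀ e, 0 < x e) → AffEq F (matchPoly l' r') →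
      Fintype.card A ≤ Fintype.card A' := by
    intro E' A' B' _ _ _ l' r' h h'
    exact hcard ▸ Nat.find_min' hSys
      ⟨E', A', B', inferInstance, inferInstance, inferInstance, l', r', rfl, h, h'⟩
  have hdim : 2 ≤ polytopeDim (matchPoly l r) := haff.polytopeDim_eq ▸ hd
  have hconn : IsConn l r := by
    intro p q hpq
    by_contra hcon
    obtain ⟨x, hx, hx0⟩ := hpos
    have hallq : (∀ a, p a) → ∀ b, q b := fun h b => by
      obtain ⟨e, rfl⟩ := exists_edge_right hx b
      exact (hpq e).1 (h _)
    have hallq' : (∀ a, ¬ p a) → ∀ b, ¬ q b := fun h b hb => by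
      obtain ⟨e, rfl⟩ := exists_edge_right hx b
      exact h _ ((hpq e).2 hb)
    have hex : ∃ a, ¬ p a := by
      by_contra h
      push Not at h
      exact hcon (Or.inl ⟨h, hallq h⟩)
    have hex' : ∃ a, p a := by
      by_contra h
      push Not at h
      exact hcon (Or.inr ⟨h, hallq' h⟩)
    have h := matchPoly_affEq_prod l r p q hpq
    obtain ⟨f, g, h₁, -⟩ := id h
    have hne := (h₁ x hx).1
    have hpos1 : ∀ {l₁ : {e // p (l e)} → {a // p a}} {r₁ : {e // p (l e)} → {b // q b}},
        (∀ e, (l₁ e).1 = l e.1) → (∀ e, (r₁ e).1 = r e.1) →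
        (∃ x ∈ matchPoly l₁ r₁, ∀ e, 0 < x e) := by
      intro l₁ r₁ hl₁ hr₁
      obtain rfl : l₁ = fun e => ⟨l e.1, e.2⟩ := funext fun e => Subtype.ext (hl₁ e)
      obtain rfl : r₁ = fun e => ⟨r e.1, (hpq _).1 e.2⟩ := funext fun e => Subtype.ext (hr₁ e)
      refine ⟨fun e => x e.1, ⟨fun e => (hx0 _).le, fun a => ?_, fun b => ?_⟩, fun e => hx0 _⟩
      · exact (fiberSum_subtype l p (fun e => p (l e)) (fun _ => Iff.rfl) x a.1 a.2).trans (hx.2.1 _)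
      · exact (fiberSum_subtype r q (fun e => p (l e)) hpq x b.1 b.2).trans (hx.2.2 _)
    have hpos2 : ∀ {l₁ : {e // ¬ p (l e)} → {a // ¬ p a}} {r₁ : {e // ¬ p (l e)} → {b // ¬ q b}},
        (∀ e, (l₁ e).1 = l e.1) → (∀ e, (r₁ e).1 = r e.1) →
        (∃ x ∈ matchPoly l₁ r₁, ∀ e, 0 < x e) := by
      intro l₁ r₁ hl₁ hr₁
      obtain rfl : l₁ = fun e => ⟨l e.1, e.2⟩ := funext fun e => Subtype.ext (hl₁ e)
      obtain rfl : r₁ = fun e => ⟨r e.1, (not_congr (hpq _)).1 e.2⟩ :=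
        funext fun e => Subtype.ext (hr₁ e)
      refine ⟨fun e => x e.1, ⟨fun e => (hx0 _).le, fun a => ?_, fun b => ?_⟩, fun e => hx0 _⟩
      · exact (fiberSum_subtype l (fun a => ¬ p a) (fun e => ¬ p (l e)) (fun _ => Iff.rfl) x
          a.1 a.2).trans (hx.2.1 _)
      · exact (fiberSum_subtype r (fun b => ¬ q b) (fun e => ¬ p (l e)) (fun e => not_congr (hpq e))
          x b.1 b.2).trans (hx.2.2 _)
    obtain ⟨n₁, F₁, hF₁, hA₁⟩ := exists_birkhoffFace_of_nonempty _ _ ⟨_, hne.1⟩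
    obtain ⟨n₂, F₂, hF₂, hA₂⟩ := exists_birkhoffFace_of_nonempty _ _ ⟨_, hne.2⟩
    -- A factor that is a point can be dropped. The remaining component has fewer left vertices,
    -- against minimality.
    by_cases hd1 : polytopeDim F₁ = 0
    · rw [← hA₁.polytopeDim_eq] at hd1
      have h2 := (haff.trans h).trans ((AffEq.prod_comm _ _).trans
        (AffEq.prod_of_polytopeDim_eq_zero ⟨_, hne.1⟩ hd1))
      have h3 := hmin (hpos2 (fun _ => rfl) (fun _ => rfl)) h2
      obtain ⟨a, ha⟩ := hex'
      have h4 : Fintype.card {a // ¬ p a} < Fintype.card A :=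
        Fintype.card_subtype_lt (x := a) (not_not.2 ha)
      omega
    · by_cases hd2 : polytopeDim F₂ = 0
      · rw [← hA₂.polytopeDim_eq] at hd2
        have h2 := (haff.trans h).trans (AffEq.prod_of_polytopeDim_eq_zero ⟨_, hne.2⟩ hd2)
        have h3 := hmin (hpos1 (fun _ => rfl) (fun _ => rfl)) h2
        obtain ⟨a, ha⟩ := hex
        have h4 : Fintype.card {a // p a} < Fintype.card A := Fintype.card_subtype_lt (x := a) ha
        omega
      · exact hprod ⟨n₁, n₂, F₁, F₂, hF₁, hF₂, Nat.one_le_iff_ne_zero.2 hd1,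
          Nat.one_le_iff_ne_zero.2 hd2, (haff.trans h).trans (hA₁.prod hA₂)⟩
  have hcardAB : Fintype.card A = Fintype.card B := by
    obtain ⟨x, hx, -⟩ := hpos
    exact card_eq_of_mem_matchPoly hx
  refine ⟨E, A, B, inferInstance, inferInstance, inferInstance, l, r, hpos, haff, hconn, ?_, ?_⟩
  · refine three_le_deg hpos hconn hdim fun e f hef hlf hdeg => ?_
    obtain ⟨E', A', B', _, _, _, l', r', hlt, hpos', haff'⟩ := exists_contraction hef hlf hdeg hpos
    have := hmin hpos' (haff.trans haff')
    omega
  · have hpos' : ∃ x ∈ matchPoly r l, ∀ e, 0 < x e := matchPoly_swap l r ▸ hpos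
    refine three_le_deg hpos' hconn.swap (matchPoly_swap l r ▸ hdim) fun e f hef hlf hdeg => ?_
    obtain ⟨E', A', B', _, _, _, l', r', hlt, hpos', haff'⟩ := exists_contraction hef hlf hdeg hpos'
    rw [matchPoly_swap] at haff'
    have := hmin hpos' (haff.trans haff')
    omega

/-! ### Inequalities for Cayley sums of cubes -/

/-- A Cayley sum of products of cubes, each of which may have some of its factors replaced by zero,
described by inequalities. -/
theorem mem_cayleySum_cube_iff {ι K : Type} [Fintype K] [DecidableEq K] {k : ι → ℕ}
    (emb : ι → K) (Q : K → Set (∀ i, Fin (k i) → ℝ))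
    (hQ : ∀ o x, x ∈ Q o ↔ ∀ i t, 0 ≤ x i t ∧ x i t ≤ if o = emb i then 0 else 1)
    (x : ∀ i, Fin (k i) → ℝ) (w : K → ℝ) :
    (x, w) ∈ cayleySum Q ↔
      (∀ o, 0 ≤ w o) ∧ ∑ o, w o = 1 ∧ ∀ i t, 0 ≤ x i t ∧ x i t ≤ 1 - w (emb i) := by
  constructor
  · intro h
    let S : Set ((∀ i, Fin (k i) → ℝ) × (K → ℝ)) :=
      {p | (∀ o, 0 ≤ p.2 o) ∧ ∑ o, p.2 o = 1 ∧ ∀ i t, 0 ≤ p.1 i t ∧ p.1 i t ≤ 1 - p.2 (emb i)}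
    have hS : Convex ℝ S := by
      rintro ⟨x, w⟩ ⟨hw, hw1, hx⟩ ⟨y, v⟩ ⟨hv, hv1, hy⟩ a b ha hb hab
      refine ⟨fun o => ?_, ?_, fun i t => ⟨?_, ?_⟩⟩
      · exact add_nonneg (mul_nonneg ha (hw o)) (mul_nonneg hb (hv o))
      · simp only [Prod.snd_add, Prod.smul_snd, Pi.add_apply, Pi.smul_apply, smul_eq_mul,
          Finset.sum_add_distrib, ← Finset.mul_sum]
        rw [hw1, hv1]
        linarith
      · exact add_nonneg (mul_nonneg ha (hx i t).1) (mul_nonneg hb (hy i t).1)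
      · simp only [Prod.snd_add, Prod.smul_snd, Prod.fst_add, Prod.smul_fst, Pi.add_apply,
          Pi.smul_apply, smul_eq_mul]
        have h1 := mul_le_mul_of_nonneg_left (hx i t).2 ha
        have h2 := mul_le_mul_of_nonneg_left (hy i t).2 hb
        simp only at h1 h2
        linarith
    refine convexHull_min ?_ hS h
    rintro ⟨y, v⟩ hyv
    obtain ⟨o, hy, hv⟩ := Set.mem_iUnion.1 hyv
    rw [Set.mem_singleton_iff] at hv
    simp only at hv hy
    subst hv
    refine ⟨fun o' => ?_, by simp, fun i t => ?_⟩
    · by_cases h : o' = o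
      · subst h; simp
      · simp [h]
    · have := (hQ o y).1 hy i t
      refine ⟨this.1, this.2.trans ?_⟩
      by_cases h : o = emb i
      · subst h; simp
      · simp [h, Ne.symm h]
  · rintro ⟨hw, hw1, hx⟩
    -- The point `(x, w)` is the combination with coefficients `w o` of points `q o` of the
    -- summands. A coordinate in block `i` vanishes in the summand `emb i`, so in the others it must
    -- be scaled up by `1 / (1 - w (emb i))`.
    let q : K → ∀ i, Fin (k i) → ℝ := fun o i t => if o = emb i then 0 else x i t / (1 - w (emb i))
    have hwle : ∀ o, w o ≤ 1 := fun o => by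
      rw [← hw1]
      exact Finset.single_le_sum (fun o _ => hw o) (Finset.mem_univ o)
    have hmem : ∀ o, (q o, Pi.single o (1 : ℝ)) ∈ cayleySum Q := by
      intro o
      refine subset_convexHull ℝ _ (Set.mem_iUnion.2 ⟨o, (hQ o _).2 fun i t => ?_, rfl⟩)
      simp only [q]
      split_ifs with h
      · simp
      · have h0 : 0 ≤ 1 - w (emb i) := sub_nonneg.2 (hwle _)
        exact ⟨div_nonneg (hx i t).1 h0, div_le_one_of_le₀ (hx i t).2 h0⟩
    have hsum : (x, w) = ∑ o, w o • (q o, (Pi.single o (1 : ℝ) : K → ℝ)) := by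
      refine Prod.ext ?_ ?_
      · rw [Prod.fst_sum]
        ext i t
        simp only [Finset.sum_apply, Prod.smul_fst, Pi.smul_apply, smul_eq_mul, q]
        have h1 : ∀ o, (w o * if o = emb i then 0 else x i t / (1 - w (emb i))) =
            w o * (x i t / (1 - w (emb i))) -
              if o = emb i then w o * (x i t / (1 - w (emb i))) else 0 := by
          intro o
          split_ifs <;> ring
        simp only [h1, Finset.sum_sub_distrib, ← Finset.sum_mul, hw1]
        rw [Finset.sum_ite_eq' Finset.univ (emb i) _, if_pos (Finset.mem_univ _)]
        -- If `w (emb i) = 1`, the inequalities force `x i t = 0`, in accordance with division by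
        -- zero giving `0`.
        by_cases h : 1 - w (emb i) = 0
        · have := hx i t
          rw [h] at this ⊢
          simp
          linarith
        · field_simp
      · rw [Prod.snd_sum]
        ext o
        simp [Finset.sum_apply, Pi.single_apply]
    rw [hsum]
    exact (convex_convexHull ℝ _).sum_mem (fun o _ => hw o) hw1 fun o _ => hmem o

/-- The polytope of all `(w, y)` with `w` in the standard simplex on `K` and with
`0 ≤ y j ≤ 1 - w (c j)` for all `j`. -/
def classModel {K J : Type} [Fintype K] (c : J → K) : Set ((K → ℝ) × (J → ℝ)) :=
  {p | (∀ o, 0 ≤ p.1 o) ∧ ∑ o, p.1 o = 1 ∧ ∀ j, 0 ≤ p.2 j ∧ p.2 j ≤ 1 - p.1 (c j)}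

theorem classModel_affEq_relabel {K K' J : Type} [Fintype K] [Fintype K'] (c : J → K)
    (σ : K ≃ K') : AffEq (classModel c) (classModel (σ ∘ c)) := by
  refine AffEq.of_preservesLines (fun p => (fun o => p.1 (σ.symm o), p.2))
    (fun p => (fun o => p.1 (σ o), p.2)) (fun _ _ _ => rfl) (fun _ _ _ => rfl) ?_ ?_
  · rintro ⟨w, y⟩ ⟨hw, hw1, hy⟩
    refine ⟨⟨fun o => hw _, ?_, fun j => by simpa using hy j⟩, by simp⟩
    rw [← hw1]
    exact Equiv.sum_comp σ.symm w
  · rintro ⟨w, y⟩ ⟨hw, hw1, hy⟩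
    refine ⟨⟨fun o => hw _, ?_, fun j => by simpa using hy j⟩, by simp⟩
    rw [← hw1]
    exact Equiv.sum_comp σ w

/-- By `mem_cayleySum_cube_iff` the class model and the Cayley sum satisfy the same inequalities
once the indices `j` are sorted by their class. -/
theorem classModel_affEq_cayleySum {ι K J : Type} [DecidableEq ι] [Fintype K]
    [DecidableEq K] [Fintype J] (emb : ι → K) (c : J → ι)
    (Q : K → Set (∀ i, Fin (Fintype.card {j // c j = i}) → ℝ))
    (hQ : ∀ o x, x ∈ Q o ↔ ∀ i t, 0 ≤ x i t ∧ x i t ≤ if o = emb i then 0 else 1) :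
    AffEq (classModel (emb ∘ c)) (cayleySum Q) := by
  let φ : ∀ i, {j // c j = i} ≃ Fin (Fintype.card {j // c j = i}) := fun i => Fintype.equivFin _
  refine AffEq.of_preservesLines (fun p => (fun i t => p.2 ((φ i).symm t).1, p.1))
    (fun p => (p.2, fun j => p.1 (c j) (φ (c j) ⟨j, rfl⟩)))
    (fun _ _ _ => rfl) (fun _ _ _ => rfl) ?_ ?_
  · rintro ⟨w, y⟩ ⟨hw, hw1, hy⟩
    refine ⟨(mem_cayleySum_cube_iff emb Q hQ _ _).2 ⟨hw, hw1, fun i t => ?_⟩, ?_⟩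
    · have := hy ((φ i).symm t).1
      simp only [Function.comp_apply, ((φ i).symm t).2] at this
      exact this
    · simp
  · rintro ⟨x, w⟩ h
    obtain ⟨hw, hw1, hx⟩ := (mem_cayleySum_cube_iff emb Q hQ _ _).1 h
    refine ⟨⟨hw, hw1, fun j => hx _ _⟩, ?_⟩
    have key : ∀ i (s : {j // c j = i}), x (c s.1) (φ (c s.1) ⟨s.1, rfl⟩) = x i (φ i s) := by
      rintro i ⟨j, rfl⟩
      rfl
    refine Prod.ext (funext fun i => funext fun t => ?_) rfl
    simp only [key, Equiv.apply_symm_apply]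

theorem mem_omitFactor_cube_iff {ι : Type} [DecidableEq ι] {k : ι → ℕ} (o : ι)
    (x : ∀ i, Fin (k i) → ℝ) : x ∈ omitFactor (fun i => cube (k i)) o ↔
      ∀ i t, 0 ≤ x i t ∧ x i t ≤ if o = i then 0 else 1 := by
  simp only [omitFactor, Set.mem_univ_pi]
  refine forall_congr' fun i => ?_
  by_cases h : o = i
  · subst h
    simp only [Function.update_self, Set.mem_singleton_iff, if_true]
    constructor
    · intro h t
      simp [h]
    · intro h
      ext t
      exact le_antisymm (h t).2 (h t).1
  · simp only [Function.update_of_ne (Ne.symm h), cube, Set.mem_Icc, Pi.le_def, if_neg h]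
    exact ⟨fun h t => ⟨h.1 t, h.2 t⟩, fun h => ⟨fun t => (h t).1, fun t => (h t).2⟩⟩

/-- With three classes, the class model is a joined product of three cubes of positive dimension or
a reduced joined product of two cubes. -/
theorem classModel_affEq_product {J : Type} [Fintype J] (c : J → Fin 3) :
    (∃ k : Fin 2 → ℕ, AffEq (classModel c) (reducedJoinedProduct fun i => cube (k i))) ∨
    ∃ k : Fin 3 → ℕ, (∀ i, 1 ≤ k i) ∧ AffEq (classModel c) (joinedProduct fun i => cube (k i)) := by
  by_cases h : ∀ i, ∃ j, c j = i
  · refine Or.inr ⟨fun i => Fintype.card {j // c j = i}, fun i => ?_, ?_⟩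
    · obtain ⟨j, hj⟩ := h i
      exact Fintype.card_pos_iff.2 ⟨⟨j, hj⟩⟩
    · exact classModel_affEq_cayleySum id c _ fun o x => mem_omitFactor_cube_iff o x
  · push Not at h
    obtain ⟨i₀, hi₀⟩ := h
    -- The unused class `i₀` becomes the index `none`, that is, the summand in which no cube is
    -- replaced by zero.
    have hsome : ∀ j, ∃ i, finSuccEquiv' i₀ (c j) = some i := by
      intro j
      refine Option.ne_none_iff_exists'.1 fun h => hi₀ j ?_
      exact (finSuccEquiv' i₀).injective (h.trans (finSuccEquiv'_at i₀).symm)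
    choose c' hc' using hsome
    refine Or.inl ⟨fun i => Fintype.card {j // c' j = i}, ?_⟩
    refine (classModel_affEq_relabel c (finSuccEquiv' i₀)).trans ?_
    have : ⇑(finSuccEquiv' i₀) ∘ c = some ∘ c' := funext hc'
    rw [this]
    refine classModel_affEq_cayleySum some c' _ fun o x => ?_
    cases o with
    | none =>
      simp only [Option.elim_none, Set.mem_univ_pi, cube, Set.mem_Icc, Pi.le_def, reduceCtorEq,
        if_false]
      exact ⟨fun h i t => ⟨(h i).1 t, (h i).2 t⟩,
        fun h i => ⟨fun t => (h i t).1, fun t => (h i t).2⟩⟩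
    | some o => simpa using mem_omitFactor_cube_iff o x

/-! ### Inequalities for the pyramid over a cube times a triangle -/

/-- The slice at height `s` is the base scaled by `1 - s`. -/
theorem mem_pyramid_cube_triangle_iff {k : ℕ} (x : Fin k → ℝ) (y : Fin 3 → ℝ) (s : ℝ) :
    ((x, y), s) ∈ pyramid (cube k ×ˢ triangle) ↔
      0 ≤ s ∧ (∀ t, 0 ≤ x t ∧ x t ≤ 1 - s) ∧ (∀ i, 0 ≤ y i) ∧ ∑ i, y i = 1 - s := by
  constructor
  · intro h
    let S : Set (((Fin k → ℝ) × (Fin 3 → ℝ)) × ℝ) :=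
      {p | 0 ≤ p.2 ∧ (∀ t, 0 ≤ p.1.1 t ∧ p.1.1 t ≤ 1 - p.2) ∧ (∀ i, 0 ≤ p.1.2 i) ∧
        ∑ i, p.1.2 i = 1 - p.2}
    have hS : Convex ℝ S := by
      rintro ⟨⟨x, y⟩, s⟩ ⟨h1, h2, h3, h4⟩ ⟨⟨x', y'⟩, s'⟩ ⟨h1', h2', h3', h4'⟩ a b ha hb hab
      simp only at h1 h2 h3 h4 h1' h2' h3' h4'
      refine ⟨?_, fun t => ⟨?_, ?_⟩, fun i => ?_, ?_⟩
      · exact add_nonneg (mul_nonneg ha h1) (mul_nonneg hb h1')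
      · exact add_nonneg (mul_nonneg ha (h2 t).1) (mul_nonneg hb (h2' t).1)
      · simp only [Prod.snd_add, Prod.smul_snd, Prod.fst_add, Prod.smul_fst, Pi.add_apply,
          Pi.smul_apply, smul_eq_mul]
        have h5 := mul_le_mul_of_nonneg_left (h2 t).2 ha
        have h6 := mul_le_mul_of_nonneg_left (h2' t).2 hb
        linarith
      · exact add_nonneg (mul_nonneg ha (h3 i)) (mul_nonneg hb (h3' i))
      · simp only [Prod.snd_add, Prod.smul_snd, Prod.fst_add, Prod.smul_fst, Pi.add_apply,
          Pi.smul_apply, smul_eq_mul, Finset.sum_add_distrib, ← Finset.mul_sum, h4, h4']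
        linarith
    refine convexHull_min ?_ hS h
    rintro ⟨⟨x, y⟩, s⟩ (⟨⟨hx, hy⟩, hs⟩ | hp)
    · simp only [Set.mem_singleton_iff] at hs hx hy
      subst hs
      exact ⟨le_rfl, fun t => ⟨hx.1 t, by simpa using hx.2 t⟩, hy.1, by simpa using hy.2⟩
    · rw [Set.mem_singleton_iff] at hp
      obtain ⟨⟨rfl, rfl⟩, rfl⟩ : (x = 0 ∧ y = 0) ∧ s = 1 := by
        simpa [Prod.ext_iff] using hp
      simp [S]
  · rintro ⟨hs, hx, hy, hy1⟩
    have hs1 : 0 ≤ 1 - s := by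
      rw [← hy1]
      exact Finset.sum_nonneg fun i _ => hy i
    have hapex : ((0 : (Fin k → ℝ) × (Fin 3 → ℝ)), (1 : ℝ)) ∈ pyramid (cube k ×ˢ triangle) :=
      subset_convexHull ℝ _ (Or.inr rfl)
    rcases hs1.eq_or_lt with h | h
    · have hx0 : x = 0 := funext fun t => le_antisymm ((hx t).2.trans h.symm.le) (hx t).1
      have hy0 : y = 0 := by
        rw [← h, Finset.sum_eq_zero_iff_of_nonneg fun i _ => hy i] at hy1
        exact funext fun i => hy1 i (Finset.mem_univ i)
      have hs' : s = 1 := by linarith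
      subst hx0 hy0 hs'
      exact hapex
    · have hbase : (((1 - s)⁻¹ • x, (1 - s)⁻¹ • y), (0 : ℝ)) ∈ pyramid (cube k ×ˢ triangle) := by
        refine subset_convexHull ℝ _ (Or.inl ⟨⟨⟨fun t => ?_, fun t => ?_⟩, fun i => ?_, ?_⟩, rfl⟩)
        · exact mul_nonneg (inv_nonneg.2 h.le) (hx t).1
        · simp only [Pi.smul_apply, smul_eq_mul, Pi.one_apply]
          rw [inv_mul_le_iff₀ h, mul_one]
          exact (hx t).2
        · exact mul_nonneg (inv_nonneg.2 h.le) (hy i)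
        · simp only [Pi.smul_apply, smul_eq_mul, ← Finset.mul_sum, hy1]
          exact inv_mul_cancel₀ h.ne'
      have := (convex_convexHull ℝ _) hbase hapex hs1 hs (by ring)
      have heq : (1 - s) • (((1 - s)⁻¹ • x, (1 - s)⁻¹ • y), (0 : ℝ)) +
          s • ((0 : (Fin k → ℝ) × (Fin 3 → ℝ)), (1 : ℝ)) = ((x, y), s) := by
        simp [smul_smul, mul_inv_cancel₀ h.ne']
      rw [heq] at this
      exact this

/-! ### The 4-simplex in the fourth Birkhoff polytope -/

/-- A four-dimensional simplex is a face of the fourth Birkhoff polytope. -/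
theorem exists_birkhoffFace_affEq_stdSimplex :
    ∃ F : Set (Matrix (Fin 4) (Fin 4) ℝ), IsBirkhoffFace 4 F ∧ AffEq (stdSimplex ℝ (Fin 5)) F := by
  -- This is the complete bipartite graph on `3 + 3` vertices without the edge from `0` to `0`, and
  -- with the edge from `1` to `1` doubled (edges 3 and 4). It has five perfect matchings, and each
  -- of the edges 5, 8, 3, 4, 7 lies in exactly one of them. Subdividing edge 4 gives size `3 + 1`.
  let l : Fin 9 → Fin 3 := ![0, 0, 1, 1, 1, 1, 2, 2, 2]
  let r : Fin 9 → Fin 3 := ![1, 2, 0, 1, 1, 2, 0, 1, 2]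
  have hl0 : ∀ x : Fin 9 → ℝ, fiberSum l x 0 = x 0 + x 1 := fun x => by
    simp [fiberSum_eq_sum_ite, Fin.sum_univ_succ, l]
  have hl1 : ∀ x : Fin 9 → ℝ, fiberSum l x 1 = x 2 + x 3 + x 4 + x 5 := fun x => by
    simp [fiberSum_eq_sum_ite, Fin.sum_univ_succ, l]
    rw [← add_assoc, ← add_assoc]
  have hl2 : ∀ x : Fin 9 → ℝ, fiberSum l x 2 = x 6 + x 7 + x 8 := fun x => by
    simp [fiberSum_eq_sum_ite, Fin.sum_univ_succ, l]
    rw [← add_assoc]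
  have hr0 : ∀ x : Fin 9 → ℝ, fiberSum r x 0 = x 2 + x 6 := fun x => by
    simp [fiberSum_eq_sum_ite, Fin.sum_univ_succ, r]
  have hr1 : ∀ x : Fin 9 → ℝ, fiberSum r x 1 = x 0 + x 3 + x 4 + x 7 := fun x => by
    simp [fiberSum_eq_sum_ite, Fin.sum_univ_succ, r]
    rw [← add_assoc, ← add_assoc]
  have hr2 : ∀ x : Fin 9 → ℝ, fiberSum r x 2 = x 1 + x 5 + x 8 := fun x => by
    simp [fiberSum_eq_sum_ite, Fin.sum_univ_succ, r]
    rw [← add_assoc]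
  have haff : AffEq (matchPoly l r) (stdSimplex ℝ (Fin 5)) := by
    refine AffEq.of_preservesLines (fun x => ![x 5, x 8, x 3, x 4, x 7])
      (fun w => ![w 0 + w 1, w 2 + w 3 + w 4, w 1 + w 4, w 2, w 3, w 0, w 2 + w 3 + w 0, w 4, w 1])
      ?_ ?_ ?_ ?_
    · intro x y t
      ext i
      fin_cases i <;> simp
    · intro x y t
      ext i
      fin_cases i <;> simp <;> ring
    · rintro x ⟨h0, hl, hr⟩
      have e1 := hl 0
      have e2 := hl 1
      have e3 := hl 2
      have e4 := hr 0
      have e5 := hr 1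
      have e6 := hr 2
      rw [hl0] at e1
      rw [hl1] at e2
      rw [hl2] at e3
      rw [hr0] at e4
      rw [hr1] at e5
      rw [hr2] at e6
      refine ⟨⟨fun i => ?_, ?_⟩, ?_⟩
      · fin_cases i <;> simp [h0]
      · simp [Fin.sum_univ_succ]
        linarith
      · ext i
        fin_cases i <;> simp <;> linarith
    · rintro w ⟨h0, h1⟩
      simp only [Fin.sum_univ_five] at h1
      have a0 := h0 0
      have a1 := h0 1
      have a2 := h0 2
      have a3 := h0 3
      have a4 := h0 4
      refine ⟨⟨fun i => ?_, fun i => ?_, fun i => ?_⟩, ?_⟩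
      · fin_cases i <;> simp <;> linarith
      · fin_cases i
        · refine (hl0 _).trans ?_
          simp; linarith
        · refine (hl1 _).trans ?_
          simp; linarith
        · refine (hl2 _).trans ?_
          simp; linarith
      · fin_cases i
        · refine (hr0 _).trans ?_
          simp; linarith
        · refine (hr1 _).trans ?_
          simp; linarith
        · refine (hr2 _).trans ?_
          simp; linarith
      · ext i
        fin_cases i <;> simp
  have hne : (matchPoly l r).Nonempty := haff.symm.nonempty ⟨_, single_mem_stdSimplex ℝ 0⟩
  obtain ⟨F, hF, hF'⟩ := exists_birkhoffFace_affEq l r {4} (by decide) hne (n := 4) (by simp)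
  exact ⟨F, hF, haff.symm.trans hF'⟩

/-! ### Economical realizations of joins of two cubes -/

/-- The join of a cube with coordinates `I` and a cube with coordinates `J`. -/
def joinModel (I J : Type) : Set (ℝ × (I → ℝ) × (J → ℝ)) :=
  {p | 0 ≤ p.1 ∧ p.1 ≤ 1 ∧ (∀ i, 0 ≤ p.2.1 i ∧ p.2.1 i ≤ p.1) ∧
    ∀ j, 0 ≤ p.2.2 j ∧ p.2.2 j ≤ 1 - p.1}

theorem joinModel_affEq_relabel {I J I' J' : Type} (φ : I ≃ I') (ψ : J ≃ J') :
    AffEq (joinModel I J) (joinModel I' J') := by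
  refine AffEq.of_preservesLines
    (fun p => (p.1, fun i => p.2.1 (φ.symm i), fun j => p.2.2 (ψ.symm j)))
    (fun p => (p.1, fun i => p.2.1 (φ i), fun j => p.2.2 (ψ j)))
    (fun _ _ _ => rfl) (fun _ _ _ => rfl) ?_ ?_
  · rintro ⟨w, y, z⟩ ⟨h0, h1, h2, h3⟩
    exact ⟨⟨h0, h1, fun i => h2 _, fun j => h3 _⟩, by simp⟩
  · rintro ⟨w, y, z⟩ ⟨h0, h1, h2, h3⟩
    exact ⟨⟨h0, h1, fun i => h2 _, fun j => h3 _⟩, by simp⟩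

theorem joinModel_affEq_swap (I J : Type) : AffEq (joinModel I J) (joinModel J I) := by
  refine AffEq.of_preservesLines (fun p => (1 - p.1, p.2.2, p.2.1))
    (fun p => (1 - p.1, p.2.2, p.2.1)) ?_ ?_ ?_ ?_
  · intro x y t
    refine Prod.ext ?_ rfl
    simp; ring
  · intro x y t
    refine Prod.ext ?_ rfl
    simp; ring
  · rintro ⟨w, y, z⟩ ⟨h0, h1, h2, h3⟩
    simp only at h0 h1 h2 h3
    exact ⟨⟨by simpa using h1, by simpa using h0, h3, by simpa using h2⟩, by simp⟩
  · rintro ⟨w, y, z⟩ ⟨h0, h1, h2, h3⟩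
    simp only at h0 h1 h2 h3
    exact ⟨⟨by simpa using h1, by simpa using h0, h3, by simpa using h2⟩, by simp⟩

section JoinOfCubes

variable {I J : Type} [Fintype I] [Fintype J] {m : ℕ} (α : I → Fin (m + 1)) (β : J → Fin m)

/-- Left end points of the edges of a graph that realizes a join of two cubes: a path, some of
whose edges are doubled as told by `α` and `β`, closed up by a small graph with eight edges. -/
def joinLeft : (Fin (m + 1) ⊕ I) ⊕ (Fin m ⊕ J) ⊕ Fin 8 → Fin (m + 1) ⊕ Fin 2 :=
  Sum.elim (Sum.elim Sum.inl fun i => Sum.inl (α i))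
    (Sum.elim (Sum.elim (fun i => Sum.inl i.succ) fun j => Sum.inl (β j).succ)
      ![Sum.inl 0, Sum.inl 0, Sum.inr 0, Sum.inr 0, Sum.inr 0, Sum.inr 1, Sum.inr 1, Sum.inr 1])

/-- Right end points for `joinLeft`. -/
def joinRight : (Fin (m + 1) ⊕ I) ⊕ (Fin m ⊕ J) ⊕ Fin 8 → Fin (m + 1) ⊕ Fin 2 :=
  Sum.elim (Sum.elim Sum.inl fun i => Sum.inl (α i))
    (Sum.elim (Sum.elim (fun i => Sum.inl i.castSucc) fun j => Sum.inl (β j).castSucc)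
      ![Sum.inr 1, Sum.inr 1, Sum.inr 0, Sum.inr 1, Sum.inl (Fin.last m),
        Sum.inr 0, Sum.inr 1, Sum.inl (Fin.last m)])

/-- A sum over the preimage of a point. -/
theorem sum_ite_le_of_injective {I K : Type} [Fintype I] [DecidableEq K] {α : I → K}
    (hα : Function.Injective α) {y : I → ℝ} {w : ℝ} (hw : 0 ≤ w) (hy : ∀ i, y i ≤ w) (k : K) :
    (∑ i, if α i = k then y i else 0) ≤ w := by
  classical
  by_cases h : ∃ i, α i = k
  · obtain ⟨i, rfl⟩ := h
    simp only [hα.eq_iff]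
    simpa using hy i
  · push Not at h
    simpa [h] using hw

/-- Along the path the parallel classes have weights `w` and `1 - w` alternately, and each doubled
edge contributes one cube coordinate. In the closing graph the pairs of edges `0, 1` and `4, 7` have
total weight `1 - w`, and the pair `3, 6` has total weight `w`. The remaining weights are `1 - y -
z` and `y + z`, with `y ≤ w` on edge 3 and `z ≤ 1 - w` on edge 4, so they are automatically
nonnegative. Thus this part adds three free coordinates but contains only one pair of parallel
edges. -/
theorem joinModel_affEq_matchPoly (hα : Function.Injective α) (hβ : Function.Injective β) :
    AffEq (matchPoly (joinLeft α β) (joinRight α β)) (joinModel (Option I) (Option (Option J))) := by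
  classical
  let O : ((Fin (m + 1) ⊕ I) ⊕ (Fin m ⊕ J) ⊕ Fin 8 → ℝ) → Fin (m + 1) → ℝ := fun x i =>
    x (Sum.inl (Sum.inl i)) + ∑ j, if α j = i then x (Sum.inl (Sum.inr j)) else 0
  let N : ((Fin (m + 1) ⊕ I) ⊕ (Fin m ⊕ J) ⊕ Fin 8 → ℝ) → Fin m → ℝ := fun x i =>
    x (Sum.inr (Sum.inl (Sum.inl i))) +
      ∑ j, if β j = i then x (Sum.inr (Sum.inl (Sum.inr j))) else 0
  let G : ((Fin (m + 1) ⊕ I) ⊕ (Fin m ⊕ J) ⊕ Fin 8 → ℝ) → Fin 8 → ℝ := fun x i =>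
    x (Sum.inr (Sum.inr i))
  have hl0 : ∀ x, fiberSum (joinLeft α β) x (Sum.inl 0) = O x 0 + G x 0 + G x 1 := fun x => by
    simp [fiberSum_eq_sum_ite, Fintype.sum_sum_type, joinLeft, Fin.sum_univ_eight, O, G,
      Fin.succ_ne_zero]
    ring
  have hls : ∀ x i, fiberSum (joinLeft α β) x (Sum.inl (Fin.succ i)) = N x i + O x i.succ :=
    fun x i => by
    simp [fiberSum_eq_sum_ite, Fintype.sum_sum_type, joinLeft, Fin.sum_univ_eight, O, N,
      (Fin.succ_ne_zero _).symm]
    ring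
  have hl1 : ∀ x, fiberSum (joinLeft α β) x (Sum.inr 0) = G x 2 + G x 3 + G x 4 := fun x => by
    simp [fiberSum_eq_sum_ite, Fintype.sum_sum_type, joinLeft, Fin.sum_univ_eight, G]
  have hl2 : ∀ x, fiberSum (joinLeft α β) x (Sum.inr 1) = G x 5 + G x 6 + G x 7 := fun x => by
    simp [fiberSum_eq_sum_ite, Fintype.sum_sum_type, joinLeft, Fin.sum_univ_eight, G]
  have hrl : ∀ x, fiberSum (joinRight α β) x (Sum.inl (Fin.last m)) =
      O x (Fin.last m) + G x 4 + G x 7 := fun x => by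
    simp [fiberSum_eq_sum_ite, Fintype.sum_sum_type, joinRight, Fin.sum_univ_eight, O, G,
      Fin.castSucc_ne_last]
    ring
  have hrs : ∀ x i, fiberSum (joinRight α β) x (Sum.inl (Fin.castSucc i)) =
      O x i.castSucc + N x i := fun x i => by
    simp [fiberSum_eq_sum_ite, Fintype.sum_sum_type, joinRight, Fin.sum_univ_eight, O, N,
      (Fin.castSucc_ne_last _).symm]
  have hr1 : ∀ x, fiberSum (joinRight α β) x (Sum.inr 0) = G x 2 + G x 5 := fun x => by
    simp [fiberSum_eq_sum_ite, Fintype.sum_sum_type, joinRight, Fin.sum_univ_eight, G]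
  have hr2 : ∀ x, fiberSum (joinRight α β) x (Sum.inr 1) = G x 0 + G x 1 + G x 3 + G x 6 :=
    fun x => by
    simp [fiberSum_eq_sum_ite, Fintype.sum_sum_type, joinRight, Fin.sum_univ_eight, G]
  refine AffEq.of_preservesLines
    (fun x => (O x 0, fun i => i.elim (G x 3) fun i => x (Sum.inl (Sum.inr i)),
      fun j => j.elim (G x 0) fun j => j.elim (G x 4) fun j => x (Sum.inr (Sum.inl (Sum.inr j)))))
    (fun p => Sum.elim
      (Sum.elim (fun i => p.1 - ∑ j, if α j = i then p.2.1 (some j) else 0)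
        fun i => p.2.1 (some i))
      (Sum.elim (Sum.elim (fun i => 1 - p.1 - ∑ j, if β j = i then p.2.2 (some (some j)) else 0)
        fun j => p.2.2 (some (some j)))
        ![p.2.2 none, 1 - p.1 - p.2.2 none, 1 - p.2.1 none - p.2.2 (some none), p.2.1 none,
          p.2.2 (some none), p.2.1 none + p.2.2 (some none), p.1 - p.2.1 none,
          1 - p.1 - p.2.2 (some none)])) ?_ ?_ ?_ ?_
  · intro x y t
    refine Prod.ext ?_ (Prod.ext ?_ ?_)
    · simp only [O, Pi.add_apply, Pi.smul_apply, smul_eq_mul, Prod.fst_add, Prod.smul_fst]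
      rw [mul_add, mul_add, Finset.mul_sum, Finset.mul_sum, add_add_add_comm,
        ← Finset.sum_add_distrib]
      congr 1
      refine Finset.sum_congr rfl fun j _ => ?_
      split_ifs <;> ring
    · ext i
      cases i <;> simp [G]
    · ext j
      rcases j with _ | _ | j <;> simp [G]
  · intro p p' t
    ext e
    rcases e with (i | i) | (i | j) | g
    · simp only [Sum.elim_inl, Pi.add_apply, Pi.smul_apply, smul_eq_mul, Prod.fst_add,
        Prod.smul_fst, Prod.snd_add, Prod.smul_snd]
      rw [mul_sub, mul_sub, Finset.mul_sum, Finset.mul_sum, sub_add_sub_comm,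
        ← Finset.sum_add_distrib]
      congr 1
      refine Finset.sum_congr rfl fun j _ => ?_
      split_ifs <;> ring
    · simp
    · simp only [Sum.elim_inl, Sum.elim_inr, Pi.add_apply, Pi.smul_apply, smul_eq_mul, Prod.fst_add,
        Prod.smul_fst, Prod.snd_add, Prod.smul_snd]
      rw [mul_sub, mul_sub _ (1 - p'.1), Finset.mul_sum, Finset.mul_sum, sub_add_sub_comm,
        ← Finset.sum_add_distrib]
      congr 1
      · ring
      · refine Finset.sum_congr rfl fun j _ => ?_
        split_ifs <;> ring
    · simp
    · fin_cases g <;> simp <;> ring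
  · rintro x ⟨h0, hl, hr⟩
    -- Each class `N` meets the classes `O` with indices `i.succ` and `i.castSucc`, and its weight
    -- complements both to one.
    have hO : ∀ i, O x i = O x 0 := by
      intro i
      induction i using Fin.induction with
      | zero => rfl
      | succ i ih =>
        have h1 := hl (Sum.inl i.succ)
        have h2 := hr (Sum.inl i.castSucc)
        rw [hls] at h1
        rw [hrs] at h2
        linarith
    have hN : ∀ i, N x i = 1 - O x 0 := by
      intro i
      have h1 := hl (Sum.inl i.succ)
      rw [hls, hO] at h1
      linarith
    have hG : ∀ i, 0 ≤ G x i := fun i => h0 _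
    have e1 := hl (Sum.inl 0)
    have e2 := hl (Sum.inr 0)
    have e3 := hl (Sum.inr 1)
    have e4 := hr (Sum.inl (Fin.last m))
    have e5 := hr (Sum.inr 0)
    have e6 := hr (Sum.inr 1)
    rw [hl0] at e1
    rw [hl1] at e2
    rw [hl2] at e3
    rw [hrl, hO] at e4
    rw [hr1] at e5
    rw [hr2] at e6
    have hOge : ∀ i, x (Sum.inl (Sum.inr i)) ≤ O x 0 := by
      intro i
      rw [← hO (α i)]
      have h1 : (if α i = α i then x (Sum.inl (Sum.inr i)) else 0) ≤
          ∑ j, if α j = α i then x (Sum.inl (Sum.inr j)) else 0 :=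
        Finset.single_le_sum (f := fun j => if α j = α i then x (Sum.inl (Sum.inr j)) else 0)
          (fun j _ => by split_ifs; exacts [h0 _, le_rfl]) (Finset.mem_univ i)
      rw [if_pos rfl] at h1
      have h2 := h0 (Sum.inl (Sum.inl (α i)))
      simp only [O]
      linarith
    have hNge : ∀ i, x (Sum.inr (Sum.inl (Sum.inr i))) ≤ 1 - O x 0 := by
      intro i
      rw [← hN (β i)]
      have h1 : (if β i = β i then x (Sum.inr (Sum.inl (Sum.inr i))) else 0) ≤
          ∑ j, if β j = β i then x (Sum.inr (Sum.inl (Sum.inr j))) else 0 :=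
        Finset.single_le_sum
          (f := fun j => if β j = β i then x (Sum.inr (Sum.inl (Sum.inr j))) else 0)
          (fun j _ => by split_ifs; exacts [h0 _, le_rfl]) (Finset.mem_univ i)
      rw [if_pos rfl] at h1
      have h2 := h0 (Sum.inr (Sum.inl (Sum.inl (β i))))
      simp only [N]
      linarith
    have g0 := hG 0
    have g1 := hG 1
    have g3 := hG 3
    have g4 := hG 4
    have g6 := hG 6
    have g7 := hG 7
    refine ⟨⟨?_, ?_, ?_, ?_⟩, ?_⟩
    · show 0 ≤ O x 0
      linarith
    · show O x 0 ≤ 1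
      linarith
    · rintro (_ | i)
      · exact ⟨g3, by show G x 3 ≤ O x 0; linarith⟩
      · exact ⟨h0 _, hOge i⟩
    · rintro (_ | _ | j)
      · exact ⟨g0, by show G x 0 ≤ 1 - O x 0; linarith⟩
      · exact ⟨g4, by show G x 4 ≤ 1 - O x 0; linarith⟩
      · exact ⟨h0 _, hNge j⟩
    · ext e
      rcases e with (i | i) | (i | j) | g
      · simp only [Sum.elim_inl, Option.elim_some]
        have := hO i
        simp only [O] at this ⊢
        linarith
      · rfl
      · simp only [Sum.elim_inl, Sum.elim_inr, Option.elim_some]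
        have := hN i
        simp only [N] at this ⊢
        linarith
      · rfl
      · change _ = G x g
        simp only [Sum.elim_inr, Option.elim_none, Option.elim_some]
        fin_cases g <;> simp <;> linarith
  · rintro ⟨w, y, z⟩ ⟨h0, h1, h2, h3⟩
    simp only at h0 h1 h2 h3
    set X : (Fin (m + 1) ⊕ I) ⊕ (Fin m ⊕ J) ⊕ Fin 8 → ℝ := Sum.elim
      (Sum.elim (fun i => w - ∑ j, if α j = i then y (some j) else 0)
        fun i => y (some i))
      (Sum.elim (Sum.elim (fun i => 1 - w - ∑ j, if β j = i then z (some (some j)) else 0)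
        fun j => z (some (some j)))
        ![z none, 1 - w - z none, 1 - y none - z (some none), y none,
          z (some none), y none + z (some none), w - y none,
          1 - w - z (some none)]) with hX
    have hOX : ∀ i, O X i = w := fun i => by simp [O, hX]
    have hNX : ∀ i, N X i = 1 - w := fun i => by simp [N, hX]
    have a1 := h2 none
    have a2 := h3 none
    have a3 := h3 (some none)
    refine ⟨⟨?_, ?_, ?_⟩, ?_⟩
    · rintro ((i | i) | (i | j) | g)
      · exact sub_nonneg.2 (sum_ite_le_of_injective hα h0 (fun i => (h2 _).2) i)
      · exact (h2 _).1
      · exact sub_nonneg.2 (sum_ite_le_of_injective hβ (sub_nonneg.2 h1) (fun i => (h3 _).2) i)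
      · exact (h3 _).1
      · fin_cases g <;> simp [hX] <;> linarith
    · rintro (i | i)
      · refine Fin.cases ?_ (fun i => ?_) i
        · rw [hl0, hOX]; simp [G, hX]
        · rw [hls, hOX, hNX]; ring
      · fin_cases i
        · refine (hl1 _).trans ?_
          simp [G, hX]
          ring
        · refine (hl2 _).trans ?_
          simp [G, hX]
          ring
    · rintro (i | i)
      · refine Fin.lastCases ?_ (fun i => ?_) i
        · rw [hrl, hOX]; simp [G, hX]
        · rw [hrs, hOX, hNX]; ring
      · fin_cases i
        · refine (hr1 _).trans ?_
          simp [G, hX]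
        · refine (hr2 _).trans ?_
          simp [G, hX]
    · refine Prod.ext (hOX 0) (Prod.ext ?_ ?_)
      · ext i
        cases i <;> simp [G, hX]
      · ext j
        rcases j with _ | _ | j <;> simp [G, hX]

/-- With `k + 1` and `j + 2` coordinates the graph has `k + j + 3` left vertices and `k + j + 1`
superfluous parallel edges, so the size is `2 (k + j) + 4`. The closing graph accounts for the one
coordinate in `I` and the two in `J` that the hypotheses require. -/
theorem exists_birkhoffFace_affEq_joinModel {I J : Type} [Fintype I] [Fintype J]
    (hI : 1 ≤ Fintype.card I) (hJ : 2 ≤ Fintype.card J) {n : ℕ}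
    (hn : n + 2 = 2 * (Fintype.card I + Fintype.card J)) :
    ∃ F : Set (Matrix (Fin n) (Fin n) ℝ), IsBirkhoffFace n F ∧ AffEq (joinModel I J) F := by
  classical
  obtain ⟨k, hk⟩ : ∃ k, Fintype.card I = k + 1 := ⟨Fintype.card I - 1, by omega⟩
  obtain ⟨j, hj⟩ : ∃ j, Fintype.card J = j + 2 := ⟨Fintype.card J - 2, by omega⟩
  let φ : I ≃ Option (Fin k) := Fintype.equivOfCardEq (by simp [hk])
  let ψ : J ≃ Option (Option (Fin j)) := Fintype.equivOfCardEq (by simp [hj])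
  let α : Fin k → Fin (k + j + 1) := Fin.castLE (by omega)
  let β : Fin j → Fin (k + j) := Fin.castLE (by omega)
  have h := (joinModel_affEq_relabel φ ψ).trans
    (joinModel_affEq_matchPoly α β (Fin.castLE_injective _) (Fin.castLE_injective _)).symm
  have hne : (matchPoly (joinLeft α β) (joinRight α β)).Nonempty := by
    refine h.nonempty ⟨(0, 0, 0), ?_⟩
    simp [joinModel]
  -- The edges to be subdivided: the second copies of the doubled path edges, and edge 1 of the
  -- closing graph, which is parallel to edge 0.
  let f : (Fin k ⊕ Fin j) ⊕ Unit → (Fin (k + j + 1) ⊕ Fin k) ⊕ (Fin (k + j) ⊕ Fin j) ⊕ Fin 8 :=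
    Sum.elim (Sum.elim (fun i => Sum.inl (Sum.inr i)) fun i => Sum.inr (Sum.inl (Sum.inr i)))
      fun _ => Sum.inr (Sum.inr 1)
  have hf : Function.Injective f := by
    rintro ((a | a) | a) ((b | b) | b) hab <;> simp_all [f]
  let D := Finset.univ.image f
  have hD : D.card = k + j + 1 := by
    rw [Finset.card_image_of_injective _ hf]
    simp
  have hD1 : ∀ i, Sum.inl (Sum.inr i) ∈ D := fun i =>
    Finset.mem_image.2 ⟨Sum.inl (Sum.inl i), Finset.mem_univ _, rfl⟩
  have hD2 : ∀ i, Sum.inr (Sum.inl (Sum.inr i)) ∈ D := fun i =>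
    Finset.mem_image.2 ⟨Sum.inl (Sum.inr i), Finset.mem_univ _, rfl⟩
  have hD3 : Sum.inr (Sum.inr 1) ∈ D := Finset.mem_image.2 ⟨Sum.inr (), Finset.mem_univ _, rfl⟩
  have hinj : ∀ e ∉ D, ∀ e' ∉ D, joinLeft α β e = joinLeft α β e' →
      joinRight α β e = joinRight α β e' → e = e' := by
    rintro ((a | a) | (a | a) | a) ha ((b | b) | (b | b) | b) hb hl hr
    any_goals exact absurd (hD1 _) ‹_›
    any_goals exact absurd (hD2 _) ‹_›
    · simpa [joinLeft] using hl
    · simp only [joinLeft, joinRight, Sum.elim_inl, Sum.elim_inr, Sum.inl.injEq] at hl hr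
      exact absurd (hl.symm.trans hr) Fin.castSucc_lt_succ.ne'
    · simp only [joinLeft, joinRight, Sum.elim_inl, Sum.elim_inr] at hl hr
      fin_cases b <;> simp at hl hr
    · simp only [joinLeft, joinRight, Sum.elim_inl, Sum.elim_inr, Sum.inl.injEq] at hl hr
      exact absurd (hl.trans hr.symm) Fin.castSucc_lt_succ.ne'
    · simpa [joinLeft] using hl
    · simp only [joinLeft, joinRight, Sum.elim_inl, Sum.elim_inr] at hl hr
      fin_cases b <;> simp at hl hr
    · simp only [joinLeft, joinRight, Sum.elim_inl, Sum.elim_inr] at hl hr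
      fin_cases a <;> simp at hl hr
    · simp only [joinLeft, joinRight, Sum.elim_inl, Sum.elim_inr] at hl hr
      fin_cases a <;> simp at hl hr
    · simp only [joinLeft, joinRight, Sum.elim_inr] at hl hr
      have ha1 : a ≠ 1 := fun h => ha (h ▸ hD3)
      have hb1 : b ≠ 1 := fun h => hb (h ▸ hD3)
      fin_cases a <;> fin_cases b <;> simp at hl hr ha1 hb1 ⊢
  obtain ⟨F, hF, hF'⟩ := exists_birkhoffFace_affEq (joinLeft α β) (joinRight α β) D hinj hne
    (n := n) (by simp [hD]; omega)
  exact ⟨F, hF, h.trans hF'⟩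

end JoinOfCubes

/-! ### Degrees and multiplicities -/

section Counting

variable {E A B : Type} [Fintype E]

theorem sum_deg [Fintype A] (l : E → A) : ∑ a, deg l a = Fintype.card E := by
  classical
  simp only [deg_eq]
  rw [← Finset.card_univ]
  exact (Finset.card_eq_sum_card_fiberwise fun _ _ => Finset.mem_coe.2 (Finset.mem_univ _)).symm

theorem eq_of_sum_eq [Fintype A] {f : A → ℕ} {c : ℕ} (hf : ∀ a, c ≤ f a)
    (hsum : ∑ a, f a = c * Fintype.card A) (a : A) : f a = c := by
  have h : ∑ a, f a = ∑ _a : A, c := by simp [hsum, mul_comm]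
  exact ((Finset.sum_eq_sum_iff_of_le fun a _ => hf a).1 h.symm a (Finset.mem_univ a)).symm

theorem exists_eq_add_one_of_sum_eq [Fintype A] {f : A → ℕ} {c : ℕ} (hf : ∀ a, c ≤ f a)
    (hsum : ∑ a, f a = c * Fintype.card A + 1) :
    ∃ u, f u = c + 1 ∧ ∀ a, a ≠ u → f a = c := by
  classical
  obtain ⟨u, hu⟩ : ∃ u, c < f u := by
    by_contra h
    push Not at h
    have : ∑ a, f a = ∑ _a : A, c := Finset.sum_congr rfl fun a _ => le_antisymm (h a) (hf a)
    simp [hsum, mul_comm] at this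
  have h1 : ∑ a, (f a - c) = 1 := by
    have h2 : ∑ a, (f a - c) + ∑ _a : A, c = ∑ a, f a := by
      rw [← Finset.sum_add_distrib]
      exact Finset.sum_congr rfl fun a _ => Nat.sub_add_cancel (hf a)
    simp only [Finset.sum_const, Finset.card_univ, smul_eq_mul, hsum] at h2
    rw [mul_comm c] at h2
    omega
  rw [← Finset.add_sum_erase _ _ (Finset.mem_univ u)] at h1
  have h3 : ∑ a ∈ Finset.univ.erase u, (f a - c) = 0 := by omega
  refine ⟨u, by omega, fun a ha => ?_⟩
  have := (Finset.sum_eq_zero_iff.1 h3) a (by simp [ha])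
  have := hf a
  omega

/-- The edges of the simple graph underlying a bipartite multigraph. -/
abbrev SimpleEdge {E A B : Type} (l : E → A) (r : E → B) : Type := {p : A × B // ∃ e, (l e, r e) = p}

/-- The simple edge underlying an edge. -/
def toSimple (l : E → A) (r : E → B) (e : E) : SimpleEdge l r := ⟨(l e, r e), e, rfl⟩

/-- The left end point of a simple edge. -/
def simpleLeft (l : E → A) (r : E → B) (p : SimpleEdge l r) : A := p.1.1

/-- The right end point of a simple edge. -/
def simpleRight (l : E → A) (r : E → B) (p : SimpleEdge l r) : B := p.1.2

theorem simpleLeft_toSimple {E A B : Type} (l : E → A) (r : E → B) (e : E) :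
    simpleLeft l r (toSimple l r e) = l e := rfl

theorem exists_toSimple_eq {E A B : Type} (l : E → A) (r : E → B) (p : SimpleEdge l r) :
    ∃ e, toSimple l r e = p := by
  obtain ⟨p, e, rfl⟩ := p
  exact ⟨e, rfl⟩

noncomputable instance (l : E → A) (r : E → B) : Fintype (SimpleEdge l r) := by
  classical exact Fintype.ofSurjective (toSimple l r) (exists_toSimple_eq l r)

theorem toSimple_eq_iff {E A B : Type} {l : E → A} {r : E → B} {e f : E} :
    toSimple l r e = toSimple l r f ↔ l e = l f ∧ r e = r f := by
  rw [toSimple, toSimple, Subtype.mk.injEq, Prod.mk.injEq]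

/-- The multigraph has a simple subgraph with the same underlying simple graph. -/
theorem exists_simple_complement (l : E → A) (r : E → B) :
    ∃ D : Finset E, (∀ e ∉ D, ∀ e' ∉ D, l e = l e' → r e = r e' → e = e') ∧
      D.card + Fintype.card (SimpleEdge l r) = Fintype.card E := by
  classical
  choose g hg using exists_toSimple_eq l r
  have hginj : Function.Injective g := fun p q h => by rw [← hg p, ← hg q, h]
  refine ⟨(Finset.univ.image g)ᶜ, ?_, ?_⟩
  · intro e he e' he' h h'
    simp only [Finset.mem_compl, Finset.mem_image, Finset.mem_univ, true_and, not_not] at he he'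
    obtain ⟨p, rfl⟩ := he
    obtain ⟨q, rfl⟩ := he'
    rw [← hg p, ← hg q, toSimple_eq_iff.2 ⟨h, h'⟩]
  · rw [← Finset.card_univ (α := SimpleEdge l r), ← Finset.card_image_of_injective _ hginj,
      Finset.card_compl_add_card]

/-- The number of edges parallel to `e`, itself included. -/
noncomputable def mult (l : E → A) (r : E → B) (e : E) : ℕ := deg (toSimple l r) (toSimple l r e)

theorem mult_eq [DecidableEq A] [DecidableEq B] (l : E → A) (r : E → B) (e : E) :
    mult l r e = (Finset.univ.filter fun f => l f = l e ∧ r f = r e).card := by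
  classical
  simp only [mult, deg_eq, toSimple_eq_iff]

theorem mult_pos (l : E → A) (r : E → B) (e : E) : 1 ≤ mult l r e := by
  classical
  rw [mult_eq]
  exact Finset.card_pos.2 ⟨e, by simp⟩

theorem mult_swap (l : E → A) (r : E → B) (e : E) : mult r l e = mult l r e := by
  classical
  simp only [mult_eq, and_comm]

theorem mult_congr {l : E → A} {r : E → B} {e f : E} (hl : l e = l f) (hr : r e = r f) :
    mult l r e = mult l r f := by
  rw [mult, mult, toSimple_eq_iff.2 ⟨hl, hr⟩]

theorem eq_of_mult_eq_one {l : E → A} {r : E → B} {e f : E} (h : mult l r e = 1)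
    (hl : l f = l e) (hr : r f = r e) : f = e := by
  classical
  rw [mult_eq, Finset.card_eq_one] at h
  obtain ⟨g, hg⟩ := h
  have h1 : f ∈ ({g} : Finset E) := hg ▸ by simp [hl, hr]
  have h2 : e ∈ ({g} : Finset E) := hg ▸ by simp
  rw [Finset.mem_singleton] at h1 h2
  rw [h1, h2]

theorem deg_simpleRight_swap (l : E → A) (r : E → B) (b : B) :
    deg (simpleLeft r l) b = deg (simpleRight l r) b := by
  classical
  rw [deg_eq, deg_eq]
  refine Finset.card_bij (fun p _ => ⟨(p.1.2, p.1.1), ?_⟩) ?_ ?_ ?_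
  · obtain ⟨e, he⟩ := p.2
    exact ⟨e, by rw [← he]⟩
  · intro p hp
    exact Finset.mem_filter.2 ⟨Finset.mem_univ _, (Finset.mem_filter.1 hp).2⟩
  · rintro ⟨⟨p, p'⟩, hp⟩ - ⟨⟨q, q'⟩, hq⟩ - h
    simp only [Subtype.mk.injEq, Prod.mk.injEq] at h ⊢
    exact ⟨h.2, h.1⟩
  · rintro ⟨⟨p, p'⟩, e, he⟩ h
    refine ⟨⟨(p', p), e, ?_⟩, ?_, rfl⟩
    · simp only [Prod.mk.injEq] at he ⊢
      exact ⟨he.2, he.1⟩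
    · exact Finset.mem_filter.2 ⟨Finset.mem_univ _, (Finset.mem_filter.1 h).2⟩

/-- The edges at a vertex with two neighbours fall into two parallel classes. -/
theorem exists_of_deg_simple_eq_two {l : E → A} {r : E → B} {a : A}
    (h : deg (simpleLeft l r) a = 2) :
    ∃ e₁ e₂, l e₁ = a ∧ l e₂ = a ∧ r e₁ ≠ r e₂ ∧ (∀ e, l e = a → r e = r e₁ ∨ r e = r e₂) ∧
      (∀ x : E → ℝ, fiberSum l x a = fiberSum (toSimple l r) x (toSimple l r e₁) +
        fiberSum (toSimple l r) x (toSimple l r e₂)) ∧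
      deg l a = mult l r e₁ + mult l r e₂ := by
  classical
  rw [deg_eq, Finset.card_eq_two] at h
  obtain ⟨p, q, hpq, hfib⟩ := h
  obtain ⟨e₁, rfl⟩ := exists_toSimple_eq l r p
  obtain ⟨e₂, rfl⟩ := exists_toSimple_eq l r q
  have hfib' : ∀ e, l e = a ↔ toSimple l r e = toSimple l r e₁ ∨ toSimple l r e = toSimple l r e₂ := by
    intro e
    have : toSimple l r e ∈ (Finset.univ.filter fun p => simpleLeft l r p = a) ↔
        toSimple l r e ∈ ({toSimple l r e₁, toSimple l r e₂} : Finset _) := by rw [hfib]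
    simpa [simpleLeft_toSimple] using this
  have h1 : l e₁ = a := (hfib' _).2 (Or.inl rfl)
  have h2 : l e₂ = a := (hfib' _).2 (Or.inr rfl)
  have hunion : (Finset.univ.filter fun e => l e = a) =
      (Finset.univ.filter fun e => toSimple l r e = toSimple l r e₁) ∪
        Finset.univ.filter fun e => toSimple l r e = toSimple l r e₂ := by
    ext e
    simp [hfib']
  have hdisj : Disjoint (Finset.univ.filter fun e => toSimple l r e = toSimple l r e₁)
      (Finset.univ.filter fun e => toSimple l r e = toSimple l r e₂) := by
    rw [Finset.disjoint_filter]
    exact fun e _ h h' => hpq (h.symm.trans h')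
  refine ⟨e₁, e₂, h1, h2, fun h => hpq (toSimple_eq_iff.2 ⟨h1.trans h2.symm, h⟩), fun e he => ?_,
    fun x => ?_, ?_⟩
  · exact ((hfib' e).1 he).imp (fun h => (toSimple_eq_iff.1 h).2) fun h => (toSimple_eq_iff.1 h).2
  · simp only [fiberSum_eq_sum_filter]
    rw [hunion, Finset.sum_union hdisj]
  · rw [mult, mult, deg_eq, deg_eq, deg_eq, hunion, Finset.card_union_of_disjoint hdisj]

/-- If a vertex has as many neighbours as edges, then its edges are simple. -/
theorem mult_eq_one_of_deg_eq {l : E → A} {r : E → B} {a : A}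
    (h : deg l a = deg (simpleLeft l r) a) {e : E} (he : l e = a) : mult l r e = 1 := by
  classical
  have himg : (Finset.univ.filter fun e => l e = a).image (toSimple l r) =
      Finset.univ.filter fun p => simpleLeft l r p = a := by
    ext p
    simp only [Finset.mem_image, Finset.mem_filter, Finset.mem_univ, true_and]
    constructor
    · rintro ⟨e, he, rfl⟩
      exact he
    · intro hp
      obtain ⟨e, rfl⟩ := exists_toSimple_eq l r p
      exact ⟨e, hp, rfl⟩
  rw [deg_eq, deg_eq, ← himg, eq_comm, Finset.card_image_iff] at h
  rw [mult_eq, Finset.card_eq_one]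
  refine ⟨e, ?_⟩
  ext f
  simp only [Finset.mem_filter, Finset.mem_univ, true_and, Finset.mem_singleton]
  constructor
  · rintro ⟨h1, h2⟩
    exact h (by simp [h1, he]) (by simp [he]) (toSimple_eq_iff.2 ⟨h1, h2⟩)
  · rintro rfl
    exact ⟨rfl, rfl⟩

/-- In a connected graph with at least two vertices on a side, vertices have two neighbours. -/
theorem two_le_deg_simple [Fintype A] {l : E → A} {r : E → B}
    (hpos : ∃ x ∈ matchPoly l r, ∀ e, 0 < x e) (hconn : IsConn l r)
    (hA : 2 ≤ Fintype.card A) (a : A) : 2 ≤ deg (simpleLeft l r) a := by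
  classical
  obtain ⟨e, he⟩ := exists_edge_left hpos.choose_spec.1 a
  obtain ⟨f, hf, hfe⟩ : ∃ f, l f = a ∧ r f ≠ r e := by
    by_contra h
    push Not at h
    have := (eq_of_unique_neighbour hpos hconn h).1
    have : Subsingleton A := ⟨fun x y => (this x).trans (this y).symm⟩
    have := Fintype.card_le_one_iff_subsingleton.2 this
    omega
  have hne : toSimple l r e ≠ toSimple l r f := fun h => hfe (toSimple_eq_iff.1 h).2.symm
  rw [deg_eq, ← Finset.card_pair hne]
  refine Finset.card_le_card ?_
  intro p hp
  simp only [Finset.mem_insert, Finset.mem_singleton] at hp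
  rcases hp with rfl | rfl <;> simp [simpleLeft_toSimple, he, hf]

end Counting

/-! ### Polytopes of two-coloured graphs -/

section TwoColor

variable {E A B : Type} [Fintype E]

open Classical in
/-- The weightings for which at every left vertex the edges in `col` have total weight `w`,
and the other edges have total weight `1 - w`. -/
def twoColor (l : E → A) (col : E → Prop) : Set (ℝ × (E → ℝ)) :=
  {p | (∀ e, 0 ≤ p.2 e) ∧ ∀ a, (∑ e with l e = a ∧ col e, p.2 e) = p.1 ∧
    (∑ e with l e = a ∧ ¬ col e, p.2 e) = 1 - p.1}

/-- A colouring of the edges by two colours such that the edges at a vertex are parallel if and only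
if they have the same colour, and both colours appear at every right vertex. -/
structure IsTwoColoring {E A B : Type} (l : E → A) (r : E → B) (col : E → Prop) : Prop where
  left : ∀ e f, l e = l f → (r e = r f ↔ (col e ↔ col f))
  right : ∀ e f, r e = r f → (l e = l f ↔ (col e ↔ col f))
  exists_left : ∀ a, ∃ e, l e = a ∧ col e
  exists_left_not : ∀ a, ∃ e, l e = a ∧ ¬ col e
  exists_right : ∀ b, ∃ e, r e = b ∧ col e
  exists_right_not : ∀ b, ∃ e, r e = b ∧ ¬ col e

theorem fiberSum_eq_add (l : E → A) (col : E → Prop) [DecidableEq A] [DecidablePred col]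
    (x : E → ℝ) (a : A) : fiberSum l x a =
      (∑ e with l e = a ∧ col e, x e) + ∑ e with l e = a ∧ ¬ col e, x e := by
  rw [fiberSum_eq_sum_filter, ← Finset.sum_filter_add_sum_filter_not _ col, Finset.filter_filter,
    Finset.filter_filter]

/-- At both ends of an edge the edges of its colour are exactly those parallel to it, so that colour
has the same weight at both ends; taking complements, so does the other. By connectedness the weight
of `col` is the same at all vertices, and this number is `w`. -/
theorem matchPoly_affEq_twoColor [Nonempty A] {l : E → A} {r : E → B} {col : E → Prop}
    (hconn : IsConn l r) (hcol : IsTwoColoring l r col) :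
    AffEq (matchPoly l r) (twoColor l col) := by
  classical
  let a₀ : A := Classical.arbitrary A
  have hset : ∀ e, col e → (Finset.univ.filter fun f => l f = l e ∧ col f) =
      Finset.univ.filter fun f => r f = r e ∧ col f := by
    intro e he
    ext f
    simp only [Finset.mem_filter, Finset.mem_univ, true_and]
    refine and_congr_left fun hf => ⟨fun h => ?_, fun h => ?_⟩
    · exact (hcol.left f e h).2 (by tauto)
    · exact (hcol.right f e h).2 (by tauto)
  have hset' : ∀ e, ¬ col e → (Finset.univ.filter fun f => l f = l e ∧ ¬ col f) =
      Finset.univ.filter fun f => r f = r e ∧ ¬ col f := by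
    intro e he
    ext f
    simp only [Finset.mem_filter, Finset.mem_univ, true_and]
    refine and_congr_left fun hf => ⟨fun h => ?_, fun h => ?_⟩
    · exact (hcol.left f e h).2 (by tauto)
    · exact (hcol.right f e h).2 (by tauto)
  refine AffEq.of_preservesLines (fun x => (∑ e with l e = a₀ ∧ col e, x e, x)) Prod.snd ?_ ?_ ?_ ?_
  · intro x y t
    refine Prod.ext ?_ rfl
    simp only [Pi.add_apply, Pi.smul_apply, smul_eq_mul, Prod.fst_add, Prod.smul_fst,
      Finset.sum_add_distrib, Finset.mul_sum]
  · intro x y t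
    rfl
  · rintro x ⟨h0, hl, hr⟩
    refine ⟨⟨h0, ?_⟩, rfl⟩
    have key : ∀ e, (∑ f with l f = l e ∧ col f, x f) = ∑ f with r f = r e ∧ col f, x f := by
      intro e
      by_cases he : col e
      · rw [hset e he]
      · have h1 := fiberSum_eq_add l col x (l e)
        have h2 := fiberSum_eq_add r col x (r e)
        rw [hset' e he, hl] at h1
        rw [hr] at h2
        linarith
    have hconst : ∀ a, (∑ e with l e = a ∧ col e, x e) = ∑ e with l e = a₀ ∧ col e, x e := by
      rcases hconn (fun a => (∑ e with l e = a ∧ col e, x e) = ∑ e with l e = a₀ ∧ col e, x e)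
        (fun b => (∑ e with r e = b ∧ col e, x e) = ∑ e with l e = a₀ ∧ col e, x e)
        (fun e => by rw [key e]) with h | h
      · exact h.1
      · exact absurd rfl (h.1 a₀)
    intro a
    have h1 := fiberSum_eq_add l col x a
    rw [hl, hconst] at h1
    refine ⟨?_, ?_⟩
    · convert hconst a
    · have : (∑ e with l e = a ∧ ¬ col e, x e) = 1 - ∑ e with l e = a₀ ∧ col e, x e := by linarith
      convert this
  · rintro ⟨w, x⟩ ⟨h0, h⟩
    simp only at h0 h
    have h1 : ∀ a, (∑ e with l e = a ∧ col e, x e) = w := fun a => by convert (h a).1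
    have h2 : ∀ a, (∑ e with l e = a ∧ ¬ col e, x e) = 1 - w := fun a => by convert (h a).2
    refine ⟨⟨h0, fun a => ?_, fun b => ?_⟩, ?_⟩
    · rw [fiberSum_eq_add l col, h1, h2]; ring
    · obtain ⟨e, rfl, he⟩ := hcol.exists_right b
      obtain ⟨f, hf, hf'⟩ := hcol.exists_right_not (r e)
      have h3 := hset' f hf'
      simp only [hf] at h3
      rw [fiberSum_eq_add r col, ← hset e he, ← h3, h1, h2]
      ring
    · rw [h1]

theorem fiber_eq_of_col {l : E → A} {r : E → B} {col : E → Prop} [DecidableEq A] [DecidableEq B]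
    [DecidablePred col] (hcol : IsTwoColoring l r col) {e : E} (he : col e) :
    (Finset.univ.filter fun f => l f = l e ∧ col f) =
      Finset.univ.filter fun f => l f = l e ∧ r f = r e := by
  ext f
  simp only [Finset.mem_filter, Finset.mem_univ, true_and]
  refine and_congr_right fun h => ?_
  rw [hcol.left f e h]
  tauto

theorem IsTwoColoring.not {E A B : Type} {l : E → A} {r : E → B} {col : E → Prop}
    (hcol : IsTwoColoring l r col) : IsTwoColoring l r fun e => ¬ col e where
  left e f h := by rw [hcol.left e f h]; tauto
  right e f h := by rw [hcol.right e f h]; tauto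
  exists_left := hcol.exists_left_not
  exists_left_not a := by simpa using hcol.exists_left a
  exists_right := hcol.exists_right_not
  exists_right_not a := by simpa using hcol.exists_right a

theorem exists_pair_of_mult_le_two {l : E → A} {r : E → B} {col : E → Prop} [DecidableEq A]
    [DecidableEq B] [DecidableEq E] [DecidablePred col] (hcol : IsTwoColoring l r col)
    (hm : ∀ e, mult l r e ≤ 2) (a : A) :
    ∃ p p', (Finset.univ.filter fun f => l f = a ∧ col f) = {p, p'} := by
  obtain ⟨e, rfl, he⟩ := hcol.exists_left a
  rw [fiber_eq_of_col hcol he]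
  have h1 := mult_pos l r e
  have h2 := hm e
  rw [mult_eq] at h1 h2
  rcases Nat.lt_or_ge 1 (Finset.univ.filter fun f => l f = l e ∧ r f = r e).card with h | h
  · obtain ⟨p, p', -, h⟩ := Finset.card_eq_two.1 (le_antisymm h2 h)
    exact ⟨p, p', h⟩
  · obtain ⟨p, h⟩ := Finset.card_eq_one.1 (le_antisymm h h1)
    exact ⟨p, p, by simpa using h⟩

open Classical in
/-- If all edges have multiplicity at most two, then a coloured graph realizes a join of cubes. -/
theorem twoColor_affEq_joinModel [Fintype A] [Nonempty A] {l : E → A} {r : E → B} {col : E → Prop}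
    (hcol : IsTwoColoring l r col) (hm : ∀ e, mult l r e ≤ 2) :
    ∃ P Q : A → Prop, AffEq (twoColor l col) (joinModel {a // P a} {a // Q a}) ∧
      (∀ e, col e → (P (l e) ↔ mult l r e = 2)) ∧ (∀ e, ¬ col e → (Q (l e) ↔ mult l r e = 2)) ∧
      Fintype.card {a // P a} + Fintype.card {a // Q a} + 2 * Fintype.card A = Fintype.card E := by
  -- The class of colour `col` at `a` is `{p a, p' a}`, where `p a = p' a` if the class is a single
  -- edge; similarly for the other colour.
  choose p p' hp using exists_pair_of_mult_le_two hcol hm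
  choose q q' hq using exists_pair_of_mult_le_two hcol.not hm
  have hpair : ∀ (x : E → ℝ) (s t : E), ∑ e ∈ {s, t}, x e = if s ≠ t then x s + x t else x s := by
    intro x s t
    split_ifs with h
    · exact Finset.sum_pair h
    · push Not at h
      subst h
      simp
  have hcard : ∀ s t : E, ({s, t} : Finset E).card = 1 + if s ≠ t then 1 else 0 := by
    intro s t
    split_ifs with h
    · exact Finset.card_pair h
    · push Not at h
      subst h
      simp
  have hpm : ∀ e, col e → (e = p (l e) ∨ e = p' (l e)) := by
    intro e he
    have : e ∈ Finset.univ.filter fun f => l f = l e ∧ col f := by simp [he]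
    rw [hp] at this
    simpa using this
  have hqm : ∀ e, ¬ col e → (e = q (l e) ∨ e = q' (l e)) := by
    intro e he
    have : e ∈ Finset.univ.filter fun f => l f = l e ∧ ¬ col f := by simp [he]
    rw [hq] at this
    simpa using this
  have hp1 : ∀ a, l (p a) = a ∧ col (p a) := by
    intro a
    have : p a ∈ ({p a, p' a} : Finset E) := by simp
    rw [← hp] at this
    simpa using this
  have hp2 : ∀ a, l (p' a) = a ∧ col (p' a) := by
    intro a
    have : p' a ∈ ({p a, p' a} : Finset E) := by simp
    rw [← hp] at this
    simpa using this
  have hq1 : ∀ a, l (q a) = a ∧ ¬ col (q a) := by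
    intro a
    have : q a ∈ ({q a, q' a} : Finset E) := by simp
    rw [← hq] at this
    simpa using this
  have hq2 : ∀ a, l (q' a) = a ∧ ¬ col (q' a) := by
    intro a
    have : q' a ∈ ({q a, q' a} : Finset E) := by simp
    rw [← hq] at this
    simpa using this
  -- Every double edge contributes one cube coordinate, the weight of its second copy. The first
  -- copy carries the rest of `w` or `1 - w`.
  refine ⟨fun a => p a ≠ p' a, fun a => q a ≠ q' a, ?_, fun e he => ?_, fun e he => ?_, ?_⟩
  · refine AffEq.of_preservesLines (fun u => (u.1, fun a => u.2 (p' a), fun a => u.2 (q' a)))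
      (fun u => (u.1, fun e => if col e then
          (if h : p (l e) ≠ p' (l e) then
            (if e = p' (l e) then u.2.1 ⟨l e, h⟩ else u.1 - u.2.1 ⟨l e, h⟩) else u.1)
        else (if h : q (l e) ≠ q' (l e) then
            (if e = q' (l e) then u.2.2 ⟨l e, h⟩ else 1 - u.1 - u.2.2 ⟨l e, h⟩) else 1 - u.1)))
      (fun _ _ _ => rfl) ?_ ?_ ?_
    · intro u u' t
      refine Prod.ext rfl (funext fun e => ?_)
      simp only [Prod.fst_add, Prod.snd_add, Prod.smul_fst, Prod.smul_snd, Pi.add_apply,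
        Pi.smul_apply, smul_eq_mul]
      split_ifs <;> ring
    · rintro ⟨w, x⟩ ⟨h0, h⟩
      simp only at h0 h
      have h1 : ∀ a, (if p a ≠ p' a then x (p a) + x (p' a) else x (p a)) = w := fun a => by
        rw [← hpair, ← hp]; convert (h a).1
      have h2 : ∀ a, (if q a ≠ q' a then x (q a) + x (q' a) else x (q a)) = 1 - w := fun a => by
        rw [← hpair, ← hq]; convert (h a).2
      let a₀ : A := Classical.arbitrary A
      refine ⟨⟨?_, ?_, fun a => ⟨h0 _, ?_⟩, fun a => ⟨h0 _, ?_⟩⟩, ?_⟩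
      · simp only
        rw [← h1 a₀]
        split_ifs
        exacts [add_nonneg (h0 _) (h0 _), h0 _]
      · simp only
        have : 0 ≤ 1 - w := by
          rw [← h2 a₀]
          split_ifs
          exacts [add_nonneg (h0 _) (h0 _), h0 _]
        linarith
      · simp only
        rw [← h1 a.1, if_pos a.2]
        linarith [h0 (p a.1)]
      · simp only
        rw [← h2 a.1, if_pos a.2]
        linarith [h0 (q a.1)]
      · refine Prod.ext rfl (funext fun e => ?_)
        simp only
        by_cases he : col e
        · rw [if_pos he]
          have h3 := h1 (l e)
          by_cases hpp : p (l e) ≠ p' (l e)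
          · rw [dif_pos hpp]
            rw [if_pos hpp] at h3
            split_ifs with h4
            · rw [← h4]
            · have h5 := (hpm e he).resolve_right h4
              rw [← h5] at h3
              linarith
          · rw [dif_neg hpp]
            rw [if_neg hpp] at h3
            push Not at hpp
            rcases hpm e he with h4 | h4
            · rw [← h3, ← h4]
            · rw [← h3, hpp, ← h4]
        · rw [if_neg he]
          have h3 := h2 (l e)
          by_cases hqq : q (l e) ≠ q' (l e)
          · rw [dif_pos hqq]
            rw [if_pos hqq] at h3
            split_ifs with h4
            · rw [← h4]
            · have h5 := (hqm e he).resolve_right h4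
              rw [← h5] at h3
              linarith
          · rw [dif_neg hqq]
            rw [if_neg hqq] at h3
            push Not at hqq
            rcases hqm e he with h4 | h4
            · rw [← h3, ← h4]
            · rw [← h3, hqq, ← h4]
    · rintro ⟨w, y, z⟩ ⟨h0, h1, h2, h3⟩
      simp only at h0 h1 h2 h3
      set X : E → ℝ := fun e => if col e then
          (if h : p (l e) ≠ p' (l e) then
            (if e = p' (l e) then y ⟨l e, h⟩ else w - y ⟨l e, h⟩) else w)
        else (if h : q (l e) ≠ q' (l e) then
            (if e = q' (l e) then z ⟨l e, h⟩ else 1 - w - z ⟨l e, h⟩) else 1 - w) with hX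
      have hXp : ∀ a (h : p a ≠ p' a), X (p a) = w - y ⟨a, h⟩ := by
        intro a h
        simp only [hX, (hp1 a).1, (hp1 a).2, if_true, dif_pos h, if_neg h]
      have hXp' : ∀ a (h : p a ≠ p' a), X (p' a) = y ⟨a, h⟩ := by
        intro a h
        simp only [hX, (hp2 a).1, (hp2 a).2, if_true, dif_pos h]
      have hXp0 : ∀ a (_ : p a = p' a), X (p a) = w := by
        intro a h
        simp only [hX, (hp1 a).1, (hp1 a).2, if_true, dif_neg (not_not.2 h)]
      have hXq : ∀ a (h : q a ≠ q' a), X (q a) = 1 - w - z ⟨a, h⟩ := by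
        intro a h
        simp only [hX, (hq1 a).1, if_neg (hq1 a).2, dif_pos h, if_neg h]
      have hXq' : ∀ a (h : q a ≠ q' a), X (q' a) = z ⟨a, h⟩ := by
        intro a h
        simp only [hX, (hq2 a).1, if_neg (hq2 a).2, dif_pos h, if_true]
      have hXq0 : ∀ a (_ : q a = q' a), X (q a) = 1 - w := by
        intro a h
        simp only [hX, (hq1 a).1, if_neg (hq1 a).2, dif_neg (not_not.2 h)]
      refine ⟨⟨fun e => ?_, fun a => ⟨?_, ?_⟩⟩, ?_⟩
      · simp only [hX]
        split_ifs with c1 c2 c3 c4 c5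
        · exact (h2 _).1
        · exact sub_nonneg.2 (h2 _).2
        · exact h0
        · exact (h3 _).1
        · exact sub_nonneg.2 (h3 _).2
        · exact sub_nonneg.2 h1
      · have : ∑ e ∈ {p a, p' a}, X e = w := by
          rw [hpair]
          split_ifs with h
          · rw [hXp a h, hXp' a h]; ring
          · exact hXp0 a (not_not.1 h)
        rw [← hp] at this
        convert this
      · have : ∑ e ∈ {q a, q' a}, X e = 1 - w := by
          rw [hpair]
          split_ifs with h
          · rw [hXq a h, hXq' a h]; ring
          · exact hXq0 a (not_not.1 h)
        rw [← hq] at this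
        convert this
      · exact Prod.ext rfl (Prod.ext (funext fun a => hXp' a.1 a.2) (funext fun a => hXq' a.1 a.2))
  · rw [mult_eq, ← fiber_eq_of_col hcol he, hp, hcard]
    split_ifs with h <;> simp [h]
  · have := fiber_eq_of_col hcol.not he
    rw [mult_eq, ← this, hq, hcard]
    split_ifs with h <;> simp [h]
  · have hdeg : ∀ a, deg l a = (if p a ≠ p' a then 1 else 0) + (if q a ≠ q' a then 1 else 0) + 2 := by
      intro a
      have : deg l a = (Finset.univ.filter fun e => l e = a ∧ col e).card +
          (Finset.univ.filter fun e => l e = a ∧ ¬ col e).card := by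
        rw [deg_eq, ← Finset.card_filter_add_card_filter_not (p := col), Finset.filter_filter,
          Finset.filter_filter]
      rw [this, hp, hq, hcard, hcard]
      ring
    rw [← sum_deg l, Finset.sum_congr rfl fun a _ => hdeg a, Finset.sum_add_distrib,
      Finset.sum_add_distrib, Fintype.card_subtype, Fintype.card_subtype, Finset.card_filter,
      Finset.card_filter]
    simp [mul_comm]

/-- If the first colour is that of the simple edges, and the other edges are double but for one
triple edge, then the graph realizes a pyramid over the product of a cube and a triangle. -/
theorem twoColor_affEq_pyramid [Fintype A] {l : E → A} {r : E → B} {col : E → Prop}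
    (hcol : IsTwoColoring l r col) (h1 : ∀ e, col e → mult l r e = 1)
    {u : A} (h3 : ∀ e, ¬ col e → l e = u → mult l r e = 3)
    (h2 : ∀ e, ¬ col e → l e ≠ u → mult l r e = 2) :
    ∃ k : ℕ, AffEq (twoColor l col) (pyramid (cube k ×ˢ triangle)) := by
  classical
  have hs : ∀ a, ∃ s, (Finset.univ.filter fun f => l f = a ∧ col f) = {s} := by
    intro a
    obtain ⟨e, rfl, he⟩ := hcol.exists_left a
    have := h1 e he
    rw [mult_eq, ← fiber_eq_of_col hcol he] at this
    exact Finset.card_eq_one.1 this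
  have hd : ∀ a : {a // a ≠ u}, ∃ d d', d ≠ d' ∧
      (Finset.univ.filter fun f => l f = a.1 ∧ ¬ col f) = {d, d'} := by
    rintro ⟨a, ha⟩
    obtain ⟨e, rfl, he⟩ := hcol.exists_left_not a
    have := h2 e he ha
    rw [mult_eq, ← fiber_eq_of_col hcol.not he] at this
    exact Finset.card_eq_two.1 this
  have ht : ∃ t₀ t₁ t₂, t₀ ≠ t₁ ∧ t₀ ≠ t₂ ∧ t₁ ≠ t₂ ∧
      (Finset.univ.filter fun f => l f = u ∧ ¬ col f) = {t₀, t₁, t₂} := by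
    obtain ⟨e, hu, he⟩ := hcol.exists_left_not u
    have := h3 e he hu
    rw [mult_eq, ← fiber_eq_of_col hcol.not he, hu] at this
    exact Finset.card_eq_three.1 this
  choose s hs using hs
  choose d d' hdd hd using hd
  obtain ⟨t₀, t₁, t₂, ht01, ht02, ht12, ht⟩ := ht
  have hs1 : ∀ a, l (s a) = a ∧ col (s a) := by
    intro a
    have : s a ∈ ({s a} : Finset E) := by simp
    rw [← hs] at this
    simpa using this
  have hsm : ∀ e, col e → e = s (l e) := by
    intro e he
    have : e ∈ Finset.univ.filter fun f => l f = l e ∧ col f := by simp [he]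
    rw [hs] at this
    simpa using this
  have hdm : ∀ e (h : l e ≠ u), ¬ col e → e = d ⟨l e, h⟩ ∨ e = d' ⟨l e, h⟩ := by
    intro e h he
    have : e ∈ Finset.univ.filter fun f => l f = l e ∧ ¬ col f := by simp [he]
    rw [hd ⟨l e, h⟩] at this
    simpa using this
  have htm : ∀ e, l e = u → ¬ col e → e = t₀ ∨ e = t₁ ∨ e = t₂ := by
    intro e h he
    have : e ∈ Finset.univ.filter fun f => l f = u ∧ ¬ col f := by simp [he, h]
    rw [ht] at this
    simpa using this
  have hd1 : ∀ a, l (d a) = a.1 ∧ ¬ col (d a) := by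
    intro a
    have : d a ∈ ({d a, d' a} : Finset E) := by simp
    rw [← hd] at this
    simpa using this
  have hd2 : ∀ a, l (d' a) = a.1 ∧ ¬ col (d' a) := by
    intro a
    have : d' a ∈ ({d a, d' a} : Finset E) := by simp
    rw [← hd] at this
    simpa using this
  have ht1 : ∀ t ∈ ({t₀, t₁, t₂} : Finset E), l t = u ∧ ¬ col t := by
    intro t h
    rw [← ht] at h
    simpa using h
  have hl0 := ht1 t₀ (by simp)
  have hl1 := ht1 t₁ (by simp)
  have hl2 := ht1 t₂ (by simp)
  have htsum : ∀ x : E → ℝ, ∑ e ∈ {t₀, t₁, t₂}, x e = x t₀ + x t₁ + x t₂ := by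
    intro x
    rw [Finset.sum_insert (by simp [ht01, ht02]), Finset.sum_pair ht12, add_assoc]
  let φ : {a // a ≠ u} ≃ Fin (Fintype.card {a // a ≠ u}) := Fintype.equivFin _
  refine ⟨Fintype.card {a // a ≠ u}, ?_⟩
  -- The weight `w` of the simple edges is the height over the base. One copy of each double edge
  -- gives a cube coordinate and the triple edge gives the triangle, all scaled by `1 - w`.
  refine AffEq.of_preservesLines
    (fun v => ((fun i => v.2 (d (φ.symm i)), ![v.2 t₀, v.2 t₁, v.2 t₂]), v.1))
    (fun v => (v.2, fun e => if col e then v.2 else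
      if h : l e ≠ u then
        (if e = d ⟨l e, h⟩ then v.1.1 (φ ⟨l e, h⟩) else 1 - v.2 - v.1.1 (φ ⟨l e, h⟩))
      else if e = t₀ then v.1.2 0 else if e = t₁ then v.1.2 1 else v.1.2 2)) ?_ ?_ ?_ ?_
  · intro v v' t
    refine Prod.ext (Prod.ext rfl (funext fun i => ?_)) rfl
    fin_cases i <;> simp
  · intro v v' t
    refine Prod.ext rfl (funext fun e => ?_)
    simp only [Prod.fst_add, Prod.snd_add, Prod.smul_fst, Prod.smul_snd, Pi.add_apply,
      Pi.smul_apply, smul_eq_mul]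
    split_ifs <;> ring
  · rintro ⟨w, x⟩ ⟨h0, h⟩
    simp only at h0 h
    have e1 : ∀ a, x (s a) = w := fun a => by
      rw [← Finset.sum_singleton x (s a), ← hs]; convert (h a).1
    have e2 : ∀ a, x (d a) + x (d' a) = 1 - w := fun a => by
      rw [← Finset.sum_pair (hdd a), ← hd]; convert (h a).2
    have e3 : x t₀ + x t₁ + x t₂ = 1 - w := by
      rw [← htsum, ← ht]; convert (h u).2
    refine ⟨(mem_pyramid_cube_triangle_iff _ _ _).2 ⟨?_, fun i => ⟨h0 _, ?_⟩, fun i => ?_, ?_⟩, ?_⟩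
    · rw [← e1 u]; exact h0 _
    · rw [← e2 (φ.symm i)]; linarith [h0 (d' (φ.symm i))]
    · fin_cases i <;> simp [h0]
    · simpa [Fin.sum_univ_three] using e3
    · refine Prod.ext rfl (funext fun e => ?_)
      simp only [Equiv.symm_apply_apply]
      by_cases he : col e
      · rw [if_pos he, hsm e he, e1]
      · rw [if_neg he]
        by_cases hu : l e ≠ u
        · rw [dif_pos hu]
          have e4 := e2 ⟨l e, hu⟩
          split_ifs with c
          · rw [← c]
          · rw [← (hdm e hu he).resolve_left c] at e4
            linarith
        · rw [dif_neg hu]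
          push Not at hu
          split_ifs with c1 c2
          · simp [c1]
          · simp [c2]
          · have := ((htm e hu he).resolve_left c1).resolve_left c2
            simp [this]
  · rintro ⟨⟨x, y⟩, w⟩ hv
    obtain ⟨hw, hx, hy, hy1⟩ := (mem_pyramid_cube_triangle_iff _ _ _).1 hv
    set X : E → ℝ := fun e => if col e then w else
      if h : l e ≠ u then
        (if e = d ⟨l e, h⟩ then x (φ ⟨l e, h⟩) else 1 - w - x (φ ⟨l e, h⟩))
      else if e = t₀ then y 0 else if e = t₁ then y 1 else y 2 with hX
    have hw1 : 0 ≤ 1 - w := by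
      rw [← hy1]; exact Finset.sum_nonneg fun i _ => hy i
    have hXs : ∀ a, X (s a) = w := fun a => if_pos (hs1 a).2
    have hXd : ∀ a : {a // a ≠ u}, X (d a) = x (φ a) := by
      intro a
      have hu : l (d a) ≠ u := (hd1 a).1 ▸ a.2
      have ha : (⟨l (d a), hu⟩ : {a // a ≠ u}) = a := Subtype.ext (hd1 a).1
      simp only [hX, if_neg (hd1 a).2, dif_pos hu, ha, if_true]
    have hXd' : ∀ a : {a // a ≠ u}, X (d' a) = 1 - w - x (φ a) := by
      intro a
      have hu : l (d' a) ≠ u := (hd2 a).1 ▸ a.2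
      have ha : (⟨l (d' a), hu⟩ : {a // a ≠ u}) = a := Subtype.ext (hd2 a).1
      simp only [hX, if_neg (hd2 a).2, dif_pos hu, ha, if_neg (hdd a).symm]
    have hX0 : X t₀ = y 0 := by
      simp only [hX, if_neg hl0.2, hl0.1, ne_eq, not_true, dite_false, if_true]
    have hX1 : X t₁ = y 1 := by
      simp only [hX, if_neg hl1.2, hl1.1, ne_eq, not_true, dite_false, if_true, if_neg ht01.symm]
    have hX2 : X t₂ = y 2 := by
      simp only [hX, if_neg hl2.2, hl2.1, ne_eq, not_true, dite_false, if_neg ht02.symm,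
        if_neg ht12.symm]
    refine ⟨⟨fun e => ?_, fun a => ⟨?_, ?_⟩⟩, ?_⟩
    · simp only [hX]
      split_ifs with c1 c2 c3 c4 c5
      · exact hw
      · exact (hx _).1
      · exact sub_nonneg.2 (hx _).2
      · exact hy _
      · exact hy _
      · exact hy _
    · have : ∑ e ∈ {s a}, X e = w := by rw [Finset.sum_singleton, hXs]
      rw [← hs] at this
      convert this
    · by_cases ha : a = u
      · subst ha
        have : ∑ e ∈ {t₀, t₁, t₂}, X e = 1 - w := by
          rw [htsum, hX0, hX1, hX2, ← hy1, Fin.sum_univ_three]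
        rw [← ht] at this
        convert this
      · have : ∑ e ∈ {d ⟨a, ha⟩, d' ⟨a, ha⟩}, X e = 1 - w := by
          rw [Finset.sum_pair (hdd _), hXd, hXd']; ring
        rw [← hd] at this
        convert this
    · refine Prod.ext (Prod.ext (funext fun i => ?_) (funext fun i => ?_)) rfl
      · exact (hXd _).trans (by rw [Equiv.apply_symm_apply])
      · fin_cases i
        · exact hX0
        · exact hX1
        · exact hX2

end TwoColor

/-! ### Existence of two-colourings -/

section Colorings

variable {E A B : Type} [Fintype E]

theorem eq_or_eq_of_deg_simple_eq_two {l : E → A} {r : E → B} {e f g : E}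
    (h : deg (simpleLeft l r) (l e) = 2) (hf : l f = l e) (hg : l g = l e) (hef : r e ≠ r f) :
    r g = r e ∨ r g = r f := by
  obtain ⟨e₁, e₂, -, -, -, hall, -⟩ := exists_of_deg_simple_eq_two h
  rcases hall e rfl with h1 | h1 <;> rcases hall f hf with h2 | h2 <;>
    rcases hall g hg with h3 | h3 <;> simp_all

/-- Colouring an edge by whether it is simple. -/
theorem isTwoColoring_mult_eq_one {l : E → A} {r : E → B}
    (hl : ∀ a, deg (simpleLeft l r) a = 2) (hr : ∀ b, deg (simpleLeft r l) b = 2)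
    (hl1 : ∀ a, ∃ e, l e = a ∧ mult l r e = 1) (hl2 : ∀ a, ∃ e, l e = a ∧ mult l r e ≠ 1)
    (hr1 : ∀ b, ∃ e, r e = b ∧ mult l r e = 1) (hr2 : ∀ b, ∃ e, r e = b ∧ mult l r e ≠ 1) :
    IsTwoColoring l r fun e => mult l r e = 1 where
  left e f h := by
    refine ⟨fun h' => by rw [mult_congr h h'], fun h' => ?_⟩
    by_contra hne
    -- If `e` and `f` are not parallel, every edge at the vertex is parallel to one of them. Having
    -- equal colours, they cannot account for both a simple edge and one that is not simple.
    obtain ⟨g₁, hg₁, h₁⟩ := hl1 (l e)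
    obtain ⟨g₂, hg₂, h₂⟩ := hl2 (l e)
    rcases eq_or_eq_of_deg_simple_eq_two (hl _) h.symm hg₁ hne with c1 | c1 <;>
    rcases eq_or_eq_of_deg_simple_eq_two (hl _) h.symm hg₂ hne with c2 | c2
    · exact h₂ (mult_congr hg₂ c2 ▸ mult_congr hg₁ c1 ▸ h₁)
    · exact h₂ (mult_congr (hg₂.trans h) c2 ▸ h'.1 (mult_congr hg₁ c1 ▸ h₁))
    · exact h₂ (mult_congr hg₂ c2 ▸ h'.2 (mult_congr (hg₁.trans h) c1 ▸ h₁))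
    · exact h₂ (mult_congr (hg₂.trans h) c2 ▸ mult_congr (hg₁.trans h) c1 ▸ h₁)
  right e f h := by
    refine ⟨fun h' => by rw [mult_congr h' h], fun h' => ?_⟩
    by_contra hne
    obtain ⟨g₁, hg₁, h₁⟩ := hr1 (r e)
    obtain ⟨g₂, hg₂, h₂⟩ := hr2 (r e)
    rcases eq_or_eq_of_deg_simple_eq_two (hr _) h.symm hg₁ hne with c1 | c1 <;>
    rcases eq_or_eq_of_deg_simple_eq_two (hr _) h.symm hg₂ hne with c2 | c2
    · exact h₂ (mult_congr c2 hg₂ ▸ mult_congr c1 hg₁ ▸ h₁)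
    · exact h₂ (mult_congr c2 (hg₂.trans h) ▸ h'.1 (mult_congr c1 hg₁ ▸ h₁))
    · exact h₂ (mult_congr c2 hg₂ ▸ h'.2 (mult_congr c1 (hg₁.trans h) ▸ h₁))
    · exact h₂ (mult_congr c2 (hg₂.trans h) ▸ mult_congr c1 (hg₁.trans h) ▸ h₁)
  exists_left := hl1
  exists_left_not := hl2
  exists_right := hr1
  exists_right_not := hr2

/-- If all vertices of a connected graph have exactly two neighbours, then it is an even cycle and
has a two-colouring, given by the signs of a vector whose sums at all vertices vanish. -/
theorem exists_isTwoColoring [Fintype A] [Fintype B] [Nonempty A] {l : E → A} {r : E → B}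
    (hconn : IsConn l r) (hAB : Fintype.card A = Fintype.card B)
    (hl : ∀ a, deg (simpleLeft l r) a = 2) (hr : ∀ b, deg (simpleRight l r) b = 2) :
    ∃ col, IsTwoColoring l r col := by
  classical
  have hS : Fintype.card (SimpleEdge l r) = 2 * Fintype.card A := by
    rw [← sum_deg (simpleLeft l r), Finset.sum_congr rfl fun a _ => hl a]
    simp [mul_comm]
  have hker := card_add_one_le_finrank_ker (simpleLeft l r) (simpleRight l r)
  -- There are as many simple edges as vertices, while the vertex sums satisfy one linear relation;
  -- so the kernel is at least one-dimensional.
  have hne : LinearMap.ker (vertexSums (simpleLeft l r) (simpleRight l r)) ≠ ⊥ := by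
    intro h
    rw [h, finrank_bot] at hker
    omega
  obtain ⟨Z, hZ, hZ0⟩ := Submodule.exists_mem_ne_zero_of_ne_bot hne
  rw [mem_ker_vertexSums] at hZ
  have hfib : ∀ {C : Type} (g : SimpleEdge l r → C) (c : C), deg g c = 2 → fiberSum g Z c = 0 →
      ∃ p q, p ≠ q ∧ g p = c ∧ g q = c ∧ (∀ p', g p' = c → p' = p ∨ p' = q) ∧ Z p = -Z q := by
    intro C g c hdeg hsum
    rw [deg_eq, Finset.card_eq_two] at hdeg
    obtain ⟨p, q, hpq, hfib⟩ := hdeg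
    rw [fiberSum_eq_sum_filter, hfib, Finset.sum_pair hpq] at hsum
    have hmem : ∀ p', g p' = c ↔ p' = p ∨ p' = q := by
      intro p'
      have : p' ∈ (Finset.univ.filter fun e => g e = c) ↔ p' ∈ ({p, q} : Finset _) := by rw [hfib]
      simpa using this
    exact ⟨p, q, hpq, (hmem p).2 (Or.inl rfl), (hmem q).2 (Or.inr rfl), fun p' => (hmem p').1,
      eq_neg_of_add_eq_zero_left hsum⟩
  have hfl := fun a => hfib (simpleLeft l r) a (hl a) (hZ.1 a)
  have hfr := fun b => hfib (simpleRight l r) b (hr b) (hZ.2 b)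
  obtain ⟨p₀, hp₀⟩ : ∃ p, Z p ≠ 0 := by
    by_contra h
    push Not at h
    exact hZ0 (funext h)
  obtain ⟨e₀, he₀⟩ := exists_toSimple_eq l r p₀
  have habs : ∀ {C : Type} {g : SimpleEdge l r → C} {c : C}, (∃ p q, p ≠ q ∧ g p = c ∧ g q = c ∧
      (∀ p', g p' = c → p' = p ∨ p' = q) ∧ Z p = -Z q) → ∀ p', g p' = c →
      (|Z p'| = |Z p₀| ↔ ∀ p, g p = c → |Z p| = |Z p₀|) := by
    rintro C g c ⟨p, q, -, -, -, hall, hZpq⟩ p' hp'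
    have hsame : ∀ p'', g p'' = c → |Z p''| = |Z p| := by
      intro p'' h''
      rcases hall p'' h'' with rfl | rfl
      · rfl
      · rw [hZpq, abs_neg]
    refine ⟨fun h p'' h'' => ?_, fun h => h p' hp'⟩
    rw [hsame p'' h'', ← hsame p' hp', h]
  -- The two simple edges at a vertex have opposite values, so `|Z|` is constant along the connected
  -- graph and hence nowhere zero.
  have hall : ∀ e, |Z (toSimple l r e)| = |Z p₀| := by
    rcases hconn (fun a => ∀ p, simpleLeft l r p = a → |Z p| = |Z p₀|)
      (fun b => ∀ p, simpleRight l r p = b → |Z p| = |Z p₀|) (fun e =>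
        (habs (hfl (l e)) (toSimple l r e) rfl).symm.trans
          (habs (hfr (r e)) (toSimple l r e) rfl)) with h | h
    · exact fun e => h.1 (l e) _ rfl
    · refine absurd ((habs (hfl (l e₀)) (toSimple l r e₀) rfl).1 ?_) (h.1 (l e₀))
      rw [he₀]
  have hZne : ∀ e, Z (toSimple l r e) ≠ 0 := fun e h => by
    have := hall e
    rw [h, abs_zero, eq_comm, abs_eq_zero] at this
    exact hp₀ this
  have hsep : ∀ {C : Type} {g : SimpleEdge l r → C} {c : C}, (∃ p q, p ≠ q ∧ g p = c ∧ g q = c ∧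
      (∀ p', g p' = c → p' = p ∨ p' = q) ∧ Z p = -Z q) → ∀ e f, g (toSimple l r e) = c →
      g (toSimple l r f) = c →
      (toSimple l r e = toSimple l r f ↔ (0 < Z (toSimple l r e) ↔ 0 < Z (toSimple l r f))) := by
    rintro C g c ⟨p, q, -, -, -, hall, hZpq⟩ e f he hf
    have hqe := hZne e
    have hqf := hZne f
    refine ⟨fun h => by rw [h], fun h => ?_⟩
    rcases hall _ he with h1 | h1 <;> rcases hall _ hf with h2 | h2
    · rw [h1, h2]
    · rw [h1, h2, hZpq, neg_pos] at h
      rw [h2] at hqf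
      rcases lt_or_gt_of_ne hqf with h3 | h3
      · exact absurd (h.1 h3) h3.not_gt
      · exact absurd (h.2 h3) h3.not_gt
    · rw [h1, h2, hZpq, neg_pos] at h
      rw [h1] at hqe
      rcases lt_or_gt_of_ne hqe with h3 | h3
      · exact absurd (h.2 h3) h3.not_gt
      · exact absurd (h.1 h3) h3.not_gt
    · rw [h1, h2]
  have hboth : ∀ {C : Type} {g : SimpleEdge l r → C} {c : C}, (∃ p q, p ≠ q ∧ g p = c ∧ g q = c ∧
      (∀ p', g p' = c → p' = p ∨ p' = q) ∧ Z p = -Z q) →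
      (∃ e, g (toSimple l r e) = c ∧ 0 < Z (toSimple l r e)) ∧
        ∃ e, g (toSimple l r e) = c ∧ ¬ 0 < Z (toSimple l r e) := by
    rintro C g c ⟨p, q, -, hp, hq, -, hZpq⟩
    obtain ⟨e, rfl⟩ := exists_toSimple_eq l r p
    obtain ⟨f, rfl⟩ := exists_toSimple_eq l r q
    rcases lt_or_gt_of_ne (hZne f) with h | h
    · exact ⟨⟨e, hp, by rw [hZpq]; linarith⟩, f, hq, h.not_gt⟩
    · exact ⟨⟨f, hq, h⟩, e, hp, by rw [hZpq]; linarith⟩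
  refine ⟨fun e => 0 < Z (toSimple l r e), fun e f h => ?_, fun e f h => ?_,
    fun a => (hboth (hfl a)).1, fun a => (hboth (hfl a)).2, fun b => (hboth (hfr b)).1,
    fun b => (hboth (hfr b)).2⟩
  · rw [← hsep (hfl (l e)) e f rfl h.symm, toSimple_eq_iff]
    tauto
  · rw [← hsep (hfr (r e)) e f rfl h.symm, toSimple_eq_iff]
    tauto

end Colorings

/-! ### Pyramids over cubes and small simplices -/

/-- A join with a zero-dimensional cube is a pyramid over a cube. -/
theorem joinModel_affEq_classModel {I J : Type} [IsEmpty I] (j₀ : J) :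
    AffEq (joinModel I J) (classModel fun _ : {j : J // j ≠ j₀} => (0 : Fin 3)) := by
  classical
  -- The numbers `w`, `z j₀` and `1 - w - z j₀` are the coordinates of a point of the triangle. The
  -- other coordinates are bounded by `1 - w`, so they all belong to class `0`.
  refine AffEq.of_preservesLines
    (fun p => (![p.1, p.2.2 j₀, 1 - p.1 - p.2.2 j₀], fun j => p.2.2 j.1))
    (fun p => (p.1 0, fun _ => 0, fun j => if h : j ≠ j₀ then p.2 ⟨j, h⟩ else p.1 1)) ?_ ?_ ?_ ?_
  · intro p q t
    refine Prod.ext (funext fun i => ?_) rfl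
    fin_cases i <;> simp
    ring
  · intro p q t
    refine Prod.ext rfl (Prod.ext (funext fun i => isEmptyElim i) (funext fun j => ?_))
    by_cases h : j = j₀ <;> simp [h]
  · rintro ⟨w, y, z⟩ ⟨h0, h1, -, h3⟩
    simp only at h0 h1 h3
    refine ⟨⟨fun i => ?_, ?_, fun j => ?_⟩, ?_⟩
    · have := h3 j₀
      fin_cases i <;> simp <;> linarith
    · simp [Fin.sum_univ_three]
    · simpa using h3 j.1
    · refine Prod.ext rfl (Prod.ext (funext fun i => isEmptyElim i) (funext fun j => ?_))
      by_cases h : j = j₀ <;> simp [h]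
  · rintro ⟨w, y⟩ ⟨h0, h1, h2⟩
    simp only [Fin.sum_univ_three] at h0 h1 h2
    have a0 := h0 0
    have a1 := h0 1
    have a2 := h0 2
    refine ⟨⟨a0, ?_, fun i => isEmptyElim i, fun j => ?_⟩, ?_⟩
    · simp only
      linarith
    · simp only
      split_ifs with h
      · exact h2 _
      · exact ⟨a1, by linarith⟩
    · refine Prod.ext (funext fun i => ?_) (funext fun j => ?_)
      · fin_cases i <;> simp
        linarith
      · simp [j.2]

theorem stdSimplex_affEq_relabel {K K' : Type} [Fintype K] [Fintype K'] (σ : K ≃ K') :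
    AffEq (stdSimplex ℝ K) (stdSimplex ℝ K') := by
  refine AffEq.of_preservesLines (fun w o => w (σ.symm o)) (fun w o => w (σ o))
    (fun _ _ _ => rfl) (fun _ _ _ => rfl) ?_ ?_
  · rintro w ⟨hw, hw1⟩
    refine ⟨⟨fun o => hw _, ?_⟩, by simp⟩
    rw [← hw1]
    exact Equiv.sum_comp σ.symm w
  · rintro w ⟨hw, hw1⟩
    refine ⟨⟨fun o => hw _, ?_⟩, by simp⟩
    rw [← hw1]
    exact Equiv.sum_comp σ w

theorem stdSimplex_affEq_classModel {J : Type} [IsEmpty J] (c : J → Fin 3) :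
    AffEq (stdSimplex ℝ (Fin 3)) (classModel c) := by
  refine AffEq.of_preservesLines (fun w => (w, fun _ => 0)) Prod.fst ?_ (fun _ _ _ => rfl) ?_ ?_
  · intro p q t
    exact Prod.ext rfl (funext fun j => isEmptyElim j)
  · rintro w ⟨hw, hw1⟩
    exact ⟨⟨hw, hw1, fun j => isEmptyElim j⟩, rfl⟩
  · rintro ⟨w, y⟩ ⟨hw, hw1, -⟩
    exact ⟨⟨hw, hw1⟩, Prod.ext rfl (funext fun j => isEmptyElim j)⟩

theorem stdSimplex_affEq_pyramid :
    AffEq (stdSimplex ℝ (Fin 4)) (pyramid (cube 0 ×ˢ triangle)) := by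
  refine AffEq.of_preservesLines (fun w => ((0, ![w 1, w 2, w 3]), w 0))
    (fun p => ![p.2, p.1.2 0, p.1.2 1, p.1.2 2]) ?_ ?_ ?_ ?_
  · intro p q t
    refine Prod.ext (Prod.ext (by simp) (funext fun i => ?_)) rfl
    fin_cases i <;> simp
  · intro p q t
    ext i
    fin_cases i <;> simp
  · rintro w ⟨hw, hw1⟩
    rw [Fin.sum_univ_four] at hw1
    refine ⟨(mem_pyramid_cube_triangle_iff _ _ _).2 ⟨hw 0, fun i => i.elim0, fun i => ?_, ?_⟩, ?_⟩
    · fin_cases i <;> simp [hw]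
    · simp [Fin.sum_univ_three]
      linarith
    · ext i
      fin_cases i <;> simp
  · rintro ⟨⟨x, y⟩, s⟩ h
    obtain ⟨hs, -, hy, hy1⟩ := (mem_pyramid_cube_triangle_iff _ _ _).1 h
    rw [Fin.sum_univ_three] at hy1
    refine ⟨⟨fun i => ?_, ?_⟩, ?_⟩
    · fin_cases i <;> simp [hs, hy]
    · rw [Fin.sum_univ_four]
      simp
      linarith
    · refine Prod.ext (Prod.ext (Subsingleton.elim _ _) (funext fun i => ?_)) rfl
      fin_cases i <;> simp

/-! ### Three paths between two vertices -/

section ThreePaths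

variable {E A B : Type} [Fintype E]

/-- The vertex `a` has the three edges `s`, `d` and `d'`, of which exactly the last two are
parallel. -/
structure IsSimpleDouble {E A B : Type} (l : E → A) (r : E → B) (a : A) (s d d' : E) : Prop where
  left_s : l s = a
  left_d : l d = a
  left_d' : l d' = a
  ne : d ≠ d'
  right_eq : r d = r d'
  right_ne : r s ≠ r d
  eq_or : ∀ e, l e = a → e = s ∨ e = d ∨ e = d'

theorem exists_isSimpleDouble {l : E → A} {r : E → B} {a : A} (h3 : deg l a = 3)
    (h2 : deg (simpleLeft l r) a = 2) : ∃ s d d', IsSimpleDouble l r a s d d' := by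
  classical
  have key : ∀ e₁ e₂, l e₁ = a → l e₂ = a → r e₁ ≠ r e₂ →
      (∀ e, l e = a → r e = r e₁ ∨ r e = r e₂) → mult l r e₁ = 1 → mult l r e₂ = 2 →
      ∃ s d d', IsSimpleDouble l r a s d d' := by
    intro e₁ e₂ h1 h2 hne hall hm1 hm2
    rw [mult_eq, Finset.card_eq_two] at hm2
    obtain ⟨d, d', hdd, hfib⟩ := hm2
    have hmem : ∀ f, (l f = l e₂ ∧ r f = r e₂) ↔ f = d ∨ f = d' := by
      intro f
      have : f ∈ (Finset.univ.filter fun f => l f = l e₂ ∧ r f = r e₂) ↔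
        f ∈ ({d, d'} : Finset E) := by rw [hfib]
      simpa using this
    have hd := (hmem d).2 (Or.inl rfl)
    have hd' := (hmem d').2 (Or.inr rfl)
    refine ⟨e₁, d, d', h1, hd.1.trans h2, hd'.1.trans h2, hdd, hd.2.trans hd'.2.symm,
      fun h => hne (h.trans hd.2), fun e he => ?_⟩
    rcases hall e he with h | h
    · exact Or.inl (eq_of_mult_eq_one hm1 (he.trans h1.symm) h)
    · exact Or.inr ((hmem e).1 ⟨he.trans h2.symm, h⟩)
  obtain ⟨e₁, e₂, h1, h2, hne, hall, -, hm⟩ := exists_of_deg_simple_eq_two h2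
  have hp1 := mult_pos l r e₁
  have hp2 := mult_pos l r e₂
  rcases Nat.lt_or_ge 1 (mult l r e₁) with h | h
  · exact key e₂ e₁ h2 h1 hne.symm (fun e he => (hall e he).symm) (by omega) (by omega)
  · exact key e₁ e₂ h1 h2 hne hall (by omega) (by omega)

namespace IsSimpleDouble

variable {l : E → A} {r : E → B} {a : A} {s d d' : E}

theorem symm {E A B : Type} {l : E → A} {r : E → B} {a : A} {s d d' : E}
    (h : IsSimpleDouble l r a s d d') : IsSimpleDouble l r a s d' d :=
  ⟨h.left_s, h.left_d', h.left_d, h.ne.symm, h.right_eq.symm, h.right_eq ▸ h.right_ne,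
    fun e he => by have := h.eq_or e he; tauto⟩

theorem fiberSum_eq (h : IsSimpleDouble l r a s d d') (x : E → ℝ) :
    fiberSum l x a = x s + x d + x d' := by
  classical
  have hset : (Finset.univ.filter fun e => l e = a) = {s, d, d'} := by
    ext e
    simp only [Finset.mem_filter, Finset.mem_univ, true_and, Finset.mem_insert,
      Finset.mem_singleton]
    refine ⟨h.eq_or e, ?_⟩
    rintro (rfl | rfl | rfl)
    exacts [h.left_s, h.left_d, h.left_d']
  have h1 : s ≠ d := fun hs => h.right_ne (hs ▸ rfl)
  have h2 : s ≠ d' := fun hs => h.right_ne (by rw [h.right_eq, hs])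
  rw [fiberSum_eq_sum_filter, hset, Finset.sum_insert (by simp [h1, h2]), Finset.sum_pair h.ne,
    add_assoc]

theorem filter_eq [DecidableEq A] [DecidableEq B] [DecidableEq E]
    (h : IsSimpleDouble l r a s d d') :
    (Finset.univ.filter fun f => l f = l d ∧ r f = r d) = {d, d'} := by
  ext f
  simp only [Finset.mem_filter, Finset.mem_univ, true_and, Finset.mem_insert, Finset.mem_singleton]
  constructor
  · rintro ⟨h1, h2⟩
    refine (h.eq_or f (h1.trans h.left_d)).resolve_left ?_
    rintro rfl
    exact h.right_ne h2
  · rintro (rfl | rfl)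
    · exact ⟨rfl, rfl⟩
    · exact ⟨h.left_d'.trans h.left_d.symm, h.right_eq.symm⟩

theorem mult_s (h : IsSimpleDouble l r a s d d') : mult l r s = 1 := by
  classical
  rw [mult_eq, Finset.card_eq_one]
  refine ⟨s, ?_⟩
  ext f
  simp only [Finset.mem_filter, Finset.mem_univ, true_and, Finset.mem_singleton]
  constructor
  · rintro ⟨h1, h2⟩
    rcases h.eq_or f (h1.trans h.left_s) with rfl | rfl | rfl
    · rfl
    · exact absurd h2.symm h.right_ne
    · exact absurd (h2.symm.trans h.right_eq.symm) h.right_ne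
  · rintro rfl
    exact ⟨rfl, rfl⟩

theorem mult_d (h : IsSimpleDouble l r a s d d') : mult l r d = 2 := by
  classical
  rw [mult_eq, h.filter_eq, Finset.card_pair h.ne]

theorem mult_d' (h : IsSimpleDouble l r a s d d') : mult l r d' = 2 := h.symm.mult_d

end IsSimpleDouble

open Classical in
/-- For a weighting whose sums at all vertices are `c`: the weight of a simple edge, and `c` minus
the weight of the parallel class of an edge that is not simple. -/
noncomputable def edgeValue (l : E → A) (r : E → B) (c : ℝ) (x : E → ℝ) (e : E) : ℝ :=
  if mult l r e = 1 then x e else c - ∑ f with l f = l e ∧ r f = r e, x f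

theorem edgeValue_swap (l : E → A) (r : E → B) (c : ℝ) (x : E → ℝ) (e : E) :
    edgeValue r l c x e = edgeValue l r c x e := by
  classical
  unfold edgeValue
  rw [mult_swap]
  split_ifs
  · rfl
  · congr 2
    ext f
    simp only [Finset.mem_filter, Finset.mem_univ, true_and, and_comm]

theorem edgeValue_of_mult_eq_one {l : E → A} {r : E → B} {e : E} (h : mult l r e = 1) (c : ℝ)
    (x : E → ℝ) : edgeValue l r c x e = x e := if_pos h

theorem IsSimpleDouble.edgeValue_d {l : E → A} {r : E → B} {a : A} {s d d' : E}
    (h : IsSimpleDouble l r a s d d') (c : ℝ) (x : E → ℝ) :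
    edgeValue l r c x d = c - (x d + x d') := by
  classical
  rw [edgeValue, if_neg (by rw [h.mult_d]; norm_num)]
  have := congrArg (fun S => ∑ f ∈ S, x f) h.filter_eq
  simp only [Finset.sum_pair h.ne] at this
  rw [← this]

/-- The double edge carries `c - x s`, so its complement is `x s`. Hence `edgeValue` does not change
when passing such a vertex. It is used with `c = 1` for matchings and with `c = 0` for kernel
vectors. -/
theorem IsSimpleDouble.edgeValue_eq {l : E → A} {r : E → B} {a : A} {s d d' : E}
    (h : IsSimpleDouble l r a s d d') {c : ℝ} {x : E → ℝ} (hx : fiberSum l x a = c) {e : E}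
    (he : l e = a) : edgeValue l r c x e = x s := by
  rw [h.fiberSum_eq] at hx
  rcases h.eq_or e he with rfl | rfl | rfl
  · exact edgeValue_of_mult_eq_one h.mult_s c x
  · rw [h.edgeValue_d]; linarith
  · rw [h.symm.edgeValue_d]; linarith

/-- A connected graph in which one vertex on either side has three simple edges and all other
vertices have one simple and one double edge consists of three paths between these two vertices.
It realizes a class model with three classes. -/
theorem exists_classModel_of_three_paths [Fintype A] [Fintype B] {l : E → A} {r : E → B}
    (hconn : IsConn l r) (hAB : Fintype.card A = Fintype.card B) {u : A} {v : B}
    (hdl : ∀ a, deg l a = 3) (hdr : ∀ b, deg r b = 3)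
    (hu : deg (simpleLeft l r) u = 3) (hv : deg (simpleLeft r l) v = 3)
    (ha : ∀ a, a ≠ u → deg (simpleLeft l r) a = 2)
    (hb : ∀ b, b ≠ v → deg (simpleLeft r l) b = 2) :
    ∃ (J : Type) (_ : Fintype J) (c : J → Fin 3), AffEq (matchPoly l r) (classModel c) := by
  classical
  have hmu : ∀ e, l e = u → mult l r e = 1 := fun e he =>
    mult_eq_one_of_deg_eq ((hdl u).trans hu.symm) he
  have hmv : ∀ e, r e = v → mult l r e = 1 := fun e he =>
    (mult_swap l r e).symm.trans (mult_eq_one_of_deg_eq ((hdr v).trans hv.symm) he)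
  choose s d d' hA using fun a : {a // a ≠ u} =>
    exists_isSimpleDouble (hdl a.1) (ha a.1 a.2)
  choose s₂ d₂ d₂' hB using fun b : {b // b ≠ v} =>
    exists_isSimpleDouble (hdr b.1) (hb b.1 b.2)
  -- Edges are identified when they share a vertex other than `u` and `v`; the classes in `Quot R`
  -- are the paths from `u` to `v`.
  let R : E → E → Prop := fun e f => (l e = l f ∧ l e ≠ u) ∨ (r e = r f ∧ r e ≠ v)
  let κ : E → Quot R := Quot.mk R
  have hκl : ∀ e f, l e = l f → l e ≠ u → κ e = κ f := fun e f h h' =>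
    Quot.sound (Or.inl ⟨h, h'⟩)
  have hκr : ∀ e f, r e = r f → r e ≠ v → κ e = κ f := fun e f h h' =>
    Quot.sound (Or.inr ⟨h, h'⟩)
  have hsurjκ : ∀ q, ∃ e, κ e = q := fun q => Quot.exists_rep q
  have hval : ∀ (c : ℝ) (x : E → ℝ), (∀ a, fiberSum l x a = c) → (∀ b, fiberSum r x b = c) →
      ∀ e f, κ e = κ f → edgeValue l r c x e = edgeValue l r c x f := by
    intro c x hl hr
    have hR : ∀ e f, R e f → edgeValue l r c x e = edgeValue l r c x f := by
      rintro e f (⟨h, h'⟩ | ⟨h, h'⟩)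
      · rw [(hA ⟨l e, h'⟩).edgeValue_eq (hl _) rfl, (hA ⟨l e, h'⟩).edgeValue_eq (hl _) h.symm]
      · rw [← edgeValue_swap, ← edgeValue_swap l r c x f,
          (hB ⟨r e, h'⟩).edgeValue_eq (hr _) rfl, (hB ⟨r e, h'⟩).edgeValue_eq (hr _) h.symm]
    intro e f hef
    exact congrArg (Quot.lift (edgeValue l r c x) hR) hef
  -- every class has an edge at `u` if and only if it has an edge at `v`
  let H : Quot R → E → ℝ := fun q e =>
    if κ e = q then (if mult l r e = 1 then -2 else 1) else 0
  -- At a vertex other than `u` all three edges are in the same class, and their weights `-2`, `1`,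
  -- `1` cancel. At `u` all edges are simple, so the sum there is `-2` times the number of edges in
  -- `q`.
  have hHu : ∀ q, ∑ e, H q e = fiberSum l (H q) u := by
    intro q
    rw [← sum_fiberSum l]
    refine Finset.sum_eq_single u (fun a _ hau => ?_) (fun h => absurd (Finset.mem_univ _) h)
    have hD := hA ⟨a, hau⟩
    have hls : l (s ⟨a, hau⟩) ≠ u := hD.left_s ▸ hau
    have hκd := hκl _ _ (hD.left_s.trans hD.left_d.symm) hls
    have hκd' := hκl _ _ (hD.left_s.trans hD.left_d'.symm) hls
    rw [hD.fiberSum_eq]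
    simp only [H, ← hκd, ← hκd', hD.mult_s, hD.mult_d, hD.mult_d']
    split_ifs <;> norm_num at *
  have hHv : ∀ q, ∑ e, H q e = fiberSum r (H q) v := by
    intro q
    rw [← sum_fiberSum r]
    refine Finset.sum_eq_single v (fun b _ hbv => ?_) (fun h => absurd (Finset.mem_univ _) h)
    have hD := hB ⟨b, hbv⟩
    have hrs : r (s₂ ⟨b, hbv⟩) ≠ v := hD.left_s ▸ hbv
    have hκd := hκr _ _ (hD.left_s.trans hD.left_d.symm) hrs
    have hκd' := hκr _ _ (hD.left_s.trans hD.left_d'.symm) hrs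
    have m1 := hD.mult_s
    have m2 := hD.mult_d
    have m3 := hD.mult_d'
    rw [mult_swap] at m1 m2 m3
    rw [hD.fiberSum_eq]
    simp only [H, ← hκd, ← hκd', m1, m2, m3]
    split_ifs <;> norm_num at *
  have hHzero : ∀ {C : Type} (g : E → C) (c : C) (q : Quot R), (∀ e, g e = c → mult l r e = 1) →
      (fiberSum g (H q) c = 0 ↔ ∀ e, g e = c → κ e ≠ q) := by
    intro C g c q hg
    rw [fiberSum_eq_sum_filter, Finset.sum_eq_zero_iff_of_nonpos]
    · constructor
      · intro h e he hq
        have := h e (by simp [he])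
        simp [H, hq, hg e he] at this
      · intro h e he
        simp only [Finset.mem_filter, Finset.mem_univ, true_and] at he
        simp [H, h e he]
    · intro e he
      simp only [Finset.mem_filter, Finset.mem_univ, true_and] at he
      simp only [H, hg e he]
      split_ifs <;> norm_num
  have huv : ∀ q, (∀ e, l e = u → κ e ≠ q) ↔ ∀ e, r e = v → κ e ≠ q := fun q => by
    rw [← hHzero l u q hmu, ← hHzero r v q hmv, ← hHu, ← hHv]
  have hexu : ∀ q, ∃ e, l e = u ∧ κ e = q := by
    intro q
    by_contra hno
    push Not at hno
    have hnov := (huv q).1 hno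
    have hedge : ∃ e, l e = u := by
      have := hdl u
      rw [deg_eq] at this
      obtain ⟨e, he⟩ := Finset.card_pos.1 (by omega : 0 < (Finset.univ.filter fun e => l e = u).card)
      exact ⟨e, by simpa using he⟩
    obtain ⟨e₁, he₁⟩ := hsurjκ q
    obtain ⟨e₂, he₂⟩ := hedge
    -- A class that meets neither `u` nor `v` contains all edges at each vertex it touches. By
    -- connectedness it would be everything or nothing.
    have hclosed : ∀ e, (∀ f, l f = l e → κ f = q) ↔ ∀ f, r f = r e → κ f = q := by
      refine fun e => ⟨fun h f hf => ?_, fun h f hf => ?_⟩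
      · have hq := h e rfl
        rw [← hq]
        exact hκr f e hf fun h' => hnov e (hf ▸ h') hq
      · have hq := h e rfl
        rw [← hq]
        exact hκl f e hf fun h' => hno e (hf ▸ h') hq
    rcases hconn (fun a => ∀ e, l e = a → κ e = q) (fun b => ∀ e, r e = b → κ e = q) hclosed with
      h | h
    · exact hno e₂ he₂ (h.1 u e₂ he₂)
    · refine h.1 (l e₁) fun f hf => ?_
      rw [← he₁]
      exact hκl f e₁ hf fun h => hno e₁ (hf ▸ h) he₁
  have hexv : ∀ q, ∃ e, r e = v ∧ κ e = q := by
    intro q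
    by_contra hno
    push Not at hno
    obtain ⟨e, he, heq⟩ := hexu q
    exact (huv q).2 hno e he heq
  have hcardu : Fintype.card {e // l e = u} = 3 :=
    (Fintype.card_subtype _).trans ((deg_eq l u).symm.trans (hdl u))
  have hcardv : Fintype.card {e // r e = v} = 3 :=
    (Fintype.card_subtype _).trans ((deg_eq r v).symm.trans (hdr v))
  have hsu : Function.Surjective fun e : {e // l e = u} => κ e.1 := fun q => by
    obtain ⟨e, he, hq⟩ := hexu q
    exact ⟨⟨e, he⟩, hq⟩
  have hsv : Function.Surjective fun e : {e // r e = v} => κ e.1 := fun q => by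
    obtain ⟨e, he, hq⟩ := hexv q
    exact ⟨⟨e, he⟩, hq⟩
  let _ : Fintype (Quot R) := Fintype.ofSurjective _ hsu
  choose σ hσu hσκ using hexu
  -- the dimension forces three classes
  have hQ : Fintype.card (Quot R) = 3 := by
    refine le_antisymm (hcardu ▸ Fintype.card_le_of_surjective _ hsu) ?_
    have hE : Fintype.card E = 3 * Fintype.card A := by
      rw [← sum_deg l, Finset.sum_congr rfl fun a _ => hdl a]
      simp [mul_comm]
    have : Nonempty A := ⟨u⟩
    have hker := card_add_one_le_finrank_ker l r
    obtain ⟨e₀, he₀⟩ : ∃ e, l e = u := by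
      obtain ⟨e⟩ : Nonempty {e // l e = u} := Fintype.card_pos_iff.1 (by omega)
      exact ⟨e.1, e.2⟩
    let q₀ := κ e₀
    let Φ : LinearMap.ker (vertexSums l r) →ₗ[ℝ] ({q // q ≠ q₀} → ℝ) × ({a // a ≠ u} → ℝ) :=
      { toFun := fun z => (fun q => z.1 (σ q.1), fun a => z.1 (d a))
        map_add' := fun _ _ => rfl
        map_smul' := fun _ _ => rfl }
    -- A kernel vector is determined by its value on each class and by one edge of each double edge;
    -- the value on `q₀` follows from the sum at `u`. As the kernel has dimension at least `|A| +
    -- 1`, comparison with `(|Quot R| - 1) + (|A| - 1)` gives at least three classes.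
    have hΦ : Function.Injective Φ := by
      rw [← LinearMap.ker_eq_bot, LinearMap.ker_eq_bot']
      rintro ⟨z, hz⟩ hz0
      have hzq : ∀ q, q ≠ q₀ → z (σ q) = 0 := fun q hq =>
        congrFun (congrArg Prod.fst hz0) ⟨q, hq⟩
      have hzd : ∀ a, z (d a) = 0 := fun a => congrFun (congrArg Prod.snd hz0) a
      rw [mem_ker_vertexSums] at hz
      have hv' : ∀ e, edgeValue l r 0 z e = z (σ (κ e)) := fun e => by
        rw [hval 0 z hz.1 hz.2 e (σ (κ e)) (hσκ _).symm,
          edgeValue_of_mult_eq_one (hmu _ (hσu _))]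
      have hzq₀ : z (σ q₀) = 0 := by
        have h1 := hz.1 u
        rw [fiberSum_eq_sum_filter, Finset.sum_congr rfl (g := fun e =>
          if κ e = q₀ then z (σ q₀) else 0)] at h1
        · rw [← Finset.sum_filter, Finset.sum_const, nsmul_eq_mul, mul_eq_zero] at h1
          refine h1.resolve_left (Nat.cast_ne_zero.2 (Finset.card_ne_zero.2 ⟨e₀, ?_⟩))
          simp [he₀, q₀]
        · intro e he
          simp only [Finset.mem_filter, Finset.mem_univ, true_and] at he
          rw [← edgeValue_of_mult_eq_one (hmu e he) 0 z, hv' e]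
          split_ifs with h
          · rw [h]
          · exact hzq _ h
      have hall : ∀ e, edgeValue l r 0 z e = 0 := fun e => by
        rw [hv' e]
        by_cases h : κ e = q₀
        · rw [h, hzq₀]
        · exact hzq _ h
      refine Subtype.ext (funext fun e => ?_)
      change z e = 0
      by_cases he : l e = u
      · rw [← edgeValue_of_mult_eq_one (hmu e he) 0 z, hall]
      · have hD := hA ⟨l e, he⟩
        have h1 := hall (d ⟨l e, he⟩)
        rw [hD.edgeValue_d, hzd] at h1
        rcases hD.eq_or e rfl with h | h | h
        · have h2 : mult l r e = 1 := by rw [h]; exact hD.mult_s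
          rw [← edgeValue_of_mult_eq_one h2 0 z, hall]
        · rw [h, hzd]
        · rw [h]; linarith
    have hle := LinearMap.finrank_le_finrank_of_injective hΦ
    have hc1 : Fintype.card {q // q ≠ q₀} = Fintype.card (Quot R) - 1 := by
      simp [Fintype.card_subtype_compl]
    have hc2 : Fintype.card {a // a ≠ u} = Fintype.card A - 1 := by
      simp [Fintype.card_subtype_compl]
    rw [Module.finrank_prod, Module.finrank_fintype_fun_eq_card,
      Module.finrank_fintype_fun_eq_card, hc1, hc2] at hle
    have : 0 < Fintype.card A := Fintype.card_pos
    omega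
  have hbu : Function.Bijective fun e : {e // l e = u} => κ e.1 :=
    (Fintype.bijective_iff_surjective_and_card _).2 ⟨hsu, hcardu.trans hQ.symm⟩
  have hbv : Function.Bijective fun e : {e // r e = v} => κ e.1 :=
    (Fintype.bijective_iff_surjective_and_card _).2 ⟨hsv, hcardv.trans hQ.symm⟩
  have hsumu : ∀ w : Quot R → ℝ, fiberSum l (fun e => w (κ e)) u = ∑ q, w q := fun w => by
    rw [← hbu.sum_comp w, fiberSum_eq_sum_filter]
    exact Finset.sum_subtype _ (by simp) _
  have hsumv : ∀ w : Quot R → ℝ, fiberSum r (fun e => w (κ e)) v = ∑ q, w q := fun w => by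
    rw [← hbv.sum_comp w, fiberSum_eq_sum_filter]
    exact Finset.sum_subtype _ (by simp) _
  -- Each left vertex other than `u` has one double edge; its class is the path that runs through
  -- the vertex.
  let c : {a // a ≠ u} → Quot R := fun a => κ (s a)
  have hcκ : ∀ e (h : l e ≠ u), c ⟨l e, h⟩ = κ e := fun e h =>
    hκl _ _ (hA ⟨l e, h⟩).left_s ((hA ⟨l e, h⟩).left_s ▸ h)
  refine ⟨{a // a ≠ u}, inferInstance, Fintype.equivFinOfCardEq hQ ∘ c, ?_⟩
  refine AffEq.trans ?_ (classModel_affEq_relabel c (Fintype.equivFinOfCardEq hQ))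
  refine AffEq.of_preservesLines (fun x => (fun q => x (σ q), fun a => x (d a)))
    (fun p e => if h : l e ≠ u then
        (if e = d ⟨l e, h⟩ then p.2 ⟨l e, h⟩ else if e = d' ⟨l e, h⟩ then
          1 - p.1 (κ e) - p.2 ⟨l e, h⟩ else p.1 (κ e)) else p.1 (κ e))
    (fun _ _ _ => rfl) ?_ ?_ ?_
  · intro p p' t
    ext e
    simp only [Prod.fst_add, Prod.snd_add, Prod.smul_fst, Prod.smul_snd, Pi.add_apply,
      Pi.smul_apply, smul_eq_mul]
    split_ifs <;> ring
  · rintro x ⟨h0, hl, hr⟩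
    have hv' : ∀ e, edgeValue l r 1 x e = x (σ (κ e)) := fun e => by
      rw [hval 1 x hl hr e (σ (κ e)) (hσκ _).symm, edgeValue_of_mult_eq_one (hmu _ (hσu _))]
    refine ⟨⟨fun q => h0 _, ?_, fun a => ⟨h0 _, ?_⟩⟩, ?_⟩
    · simp only
      rw [← hsumu fun q => x (σ q), ← hl u]
      refine fiberSum_congr l fun e he => ?_
      rw [← hv' e, edgeValue_of_mult_eq_one (hmu e he)]
    · simp only [c]
      rw [← hv' (s a), edgeValue_of_mult_eq_one (hA a).mult_s]
      have := hl a.1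
      rw [(hA a).fiberSum_eq] at this
      linarith [h0 (d' a)]
    · ext e
      by_cases he : l e ≠ u
      · simp only [dif_pos he]
        have hD := hA ⟨l e, he⟩
        have h1 := hl (l e)
        rw [hD.fiberSum_eq] at h1
        have h2 := hv' e
        rw [hD.edgeValue_eq (hl _) rfl] at h2
        split_ifs with c1 c2
        · rw [← c1]
        · rw [← h2]
          rw [← c2] at h1
          linarith
        · rw [← h2]
          have := hD.eq_or e rfl
          simp only [c1, c2, or_false] at this
          rw [← this]
      · simp only [dif_neg he]
        rw [← hv' e, edgeValue_of_mult_eq_one (hmu e (not_not.1 he))]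
  · rintro ⟨w, y⟩ ⟨hw, hw1, hy⟩
    simp only at hw hw1 hy
    set X : E → ℝ := fun e => if h : l e ≠ u then
        (if e = d ⟨l e, h⟩ then y ⟨l e, h⟩ else if e = d' ⟨l e, h⟩ then
          1 - w (κ e) - y ⟨l e, h⟩ else w (κ e)) else w (κ e) with hX
    have hXd : ∀ a, X (d a) = y a := by
      intro a
      have hu' : l (d a) ≠ u := (hA a).left_d ▸ a.2
      have haa : (⟨l (d a), hu'⟩ : {a // a ≠ u}) = a := Subtype.ext (hA a).left_d
      simp only [hX, dif_pos hu', haa, if_true]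
    have hXd' : ∀ a, X (d' a) = 1 - w (κ (d' a)) - y a := by
      intro a
      have hu' : l (d' a) ≠ u := (hA a).left_d' ▸ a.2
      have haa : (⟨l (d' a), hu'⟩ : {a // a ≠ u}) = a := Subtype.ext (hA a).left_d'
      simp only [hX, dif_pos hu', haa, if_neg (hA a).ne.symm, if_true]
    have hX1 : ∀ e, mult l r e = 1 → X e = w (κ e) := by
      intro e he
      simp only [hX]
      split_ifs with c1 c2 c3
      · have := (hA ⟨l e, c1⟩).mult_d
        rw [← c2] at this
        omega
      · have := (hA ⟨l e, c1⟩).mult_d'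
        rw [← c3] at this
        omega
      · rfl
      · rfl
    have hwle : ∀ q, w q ≤ 1 := fun q => by
      rw [← hw1]
      exact Finset.single_le_sum (fun q _ => hw q) (Finset.mem_univ q)
    have hpair : ∀ a, X (d a) + X (d' a) = 1 - w (κ (d a)) := by
      intro a
      have hu' : l (d a) ≠ u := (hA a).left_d ▸ a.2
      rw [hXd, hXd', hκl (d a) (d' a) ((hA a).left_d.trans (hA a).left_d'.symm) hu']
      ring
    refine ⟨⟨fun e => ?_, fun a => ?_, fun b => ?_⟩, ?_⟩
    · simp only [hX]
      split_ifs with c1 c2 c3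
      · exact (hy _).1
      · rw [← hcκ e c1]
        exact sub_nonneg.2 (hy _).2
      · exact hw _
      · exact hw _
    · by_cases hau : a = u
      · subst hau
        rw [fiberSum_congr l fun e he => hX1 e (hmu e he), hsumu, hw1]
      · have hD := hA ⟨a, hau⟩
        have hls : l (s ⟨a, hau⟩) ≠ u := hD.left_s ▸ hau
        refine (hD.fiberSum_eq X).trans ?_
        rw [add_assoc, hpair, hX1 _ hD.mult_s,
          hκl _ _ (hD.left_s.trans hD.left_d.symm) hls]
        ring
    · by_cases hbv' : b = v
      · subst hbv'
        rw [fiberSum_congr r fun e he => hX1 e (hmv e he), hsumv, hw1]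
      · have hD := hB ⟨b, hbv'⟩
        have hrs : r (s₂ ⟨b, hbv'⟩) ≠ v := hD.left_s ▸ hbv'
        have m1 := hD.mult_s
        have m2 := hD.mult_d
        rw [mult_swap] at m1 m2
        have hlu : l (d₂ ⟨b, hbv'⟩) ≠ u := fun h => by
          have := hmu _ h
          omega
        -- The double edge at `b` is also the double edge at its left end, where the sum of its two
        -- weights is already known.
        have hsum : X (d₂ ⟨b, hbv'⟩) + X (d₂' ⟨b, hbv'⟩) = 1 - w (κ (d₂ ⟨b, hbv'⟩)) := by
          have hDA := hA ⟨l (d₂ ⟨b, hbv'⟩), hlu⟩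
          have m3 := mult_congr hD.right_eq (hD.left_d.trans hD.left_d'.symm)
          have h1 : d₂ ⟨b, hbv'⟩ ≠ s ⟨l (d₂ ⟨b, hbv'⟩), hlu⟩ := fun h => by
            have := hDA.mult_s
            rw [← h] at this
            omega
          have h2 : d₂' ⟨b, hbv'⟩ ≠ s ⟨l (d₂ ⟨b, hbv'⟩), hlu⟩ := fun h => by
            have := hDA.mult_s
            rw [← h] at this
            omega
          have h3 := (hDA.eq_or (d₂ ⟨b, hbv'⟩) rfl).resolve_left h1
          have h4 := (hDA.eq_or (d₂' ⟨b, hbv'⟩) hD.right_eq.symm).resolve_left h2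
          have h5 := hpair ⟨l (d₂ ⟨b, hbv'⟩), hlu⟩
          have h6 : κ (d ⟨l (d₂ ⟨b, hbv'⟩), hlu⟩) = κ (d₂ ⟨b, hbv'⟩) :=
            hκl _ _ hDA.left_d (hDA.left_d ▸ hlu)
          rw [h6] at h5
          have hne := hD.ne
          rcases h3 with h3 | h3 <;> rcases h4 with h4 | h4
          · exact absurd (h3.trans h4.symm) hne
          · rw [← h5, ← h3, ← h4]
          · rw [← h5, ← h3, ← h4, add_comm]
          · exact absurd (h3.trans h4.symm) hne
        refine (hD.fiberSum_eq X).trans ?_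
        rw [add_assoc, hsum, hX1 _ m1, hκr _ _ (hD.left_s.trans hD.left_d.symm) hrs]
        ring
    · refine Prod.ext (funext fun q => ?_) (funext fun a => hXd a)
      exact (hX1 _ (hmu _ (hσu q))).trans (by rw [hσκ])

end ThreePaths

/-! ### The extremal graphs -/

/-- Up to affine equivalence, `P` is a pyramid over the product of a cube and a triangle, a reduced
joined product of two cubes, or a joined product of three cubes. -/
def IsPyramidOrJoinedProduct {V : Type} [AddCommGroup V] [Module ℝ V] (P : Set V) : Prop :=
  (∃ k : ℕ, AffEq P (pyramid (cube k ×ˢ triangle))) ∨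
    (∃ k : Fin 2 → ℕ, AffEq P (reducedJoinedProduct fun i => cube (k i))) ∨
    ∃ k : Fin 3 → ℕ, (∀ i, 1 ≤ k i) ∧ AffEq P (joinedProduct fun i => cube (k i))

theorem AffEq.isPyramidOrJoinedProduct_of_classModel {V : Type} [AddCommGroup V] [Module ℝ V]
    {P : Set V} {J : Type} [Fintype J] {c : J → Fin 3} (h : AffEq P (classModel c)) :
    IsPyramidOrJoinedProduct P := by
  rcases classModel_affEq_product c with ⟨k, hk⟩ | ⟨k, hk1, hk⟩
  · exact Or.inr (Or.inl ⟨k, h.trans hk⟩)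
  · exact Or.inr (Or.inr ⟨k, hk1, h.trans hk⟩)

section Cases

variable {E A B : Type} [Fintype E]

/-- At a vertex with two neighbours, an edge and an edge that is not parallel to it. -/
theorem exists_not_parallel {l : E → A} {r : E → B} {e : E}
    (h : deg (simpleLeft l r) (l e) = 2) :
    ∃ f, l f = l e ∧ r f ≠ r e ∧ (∀ g, l g = l e → r g = r e ∨ r g = r f) ∧
      mult l r e + mult l r f = deg l (l e) := by
  obtain ⟨e₁, e₂, h₁, h₂, hne, hall, -, hdeg⟩ := exists_of_deg_simple_eq_two h
  rcases hall e rfl with he | he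
  · refine ⟨e₂, h₂, fun h => hne (he ▸ h.symm), fun g hg => he ▸ hall g hg, ?_⟩
    rw [hdeg, mult_congr h₁.symm he]
  · refine ⟨e₁, h₁, fun h => hne (he ▸ h), fun g hg => he ▸ (hall g hg).symm, ?_⟩
    rw [hdeg, mult_congr h₂.symm he, add_comm]

theorem exists_mult_of_deg_eq_three {l : E → A} {r : E → B} {a : A}
    (h : deg (simpleLeft l r) a = 2) (hd : deg l a = 3) :
    (∃ e, l e = a ∧ mult l r e = 1) ∧ ∃ e, l e = a ∧ mult l r e = 2 := by
  obtain ⟨e₁, e₂, h₁, h₂, -, -, -, hdeg⟩ := exists_of_deg_simple_eq_two h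
  have := mult_pos l r e₁
  have := mult_pos l r e₂
  rcases (by omega : mult l r e₁ = 1 ∨ mult l r e₁ = 2) with h | h
  · exact ⟨⟨e₁, h₁, h⟩, e₂, h₂, by omega⟩
  · exact ⟨⟨e₂, h₂, by omega⟩, e₁, h₁, h⟩

/-- A cycle in which simple and double edges alternate. -/
theorem isPyramidOrJoinedProduct_of_deg_eq_three [Fintype A] [Nonempty A] {l : E → A} {r : E → B}
    (hconn : IsConn l r) (hl : ∀ a, deg (simpleLeft l r) a = 2)
    (hr : ∀ b, deg (simpleLeft r l) b = 2) (hdl : ∀ a, deg l a = 3) (hdr : ∀ b, deg r b = 3) :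
    IsPyramidOrJoinedProduct (matchPoly l r) := by
  classical
  have hL := fun a => exists_mult_of_deg_eq_three (hl a) (hdl a)
  have hR := fun b => exists_mult_of_deg_eq_three (hr b) (hdr b)
  simp only [mult_swap l r] at hR
  have hcol := isTwoColoring_mult_eq_one hl hr (fun a => (hL a).1)
    (fun a => (hL a).2.imp fun e h => ⟨h.1, by omega⟩) (fun b => (hR b).1)
    (fun b => (hR b).2.imp fun e h => ⟨h.1, by omega⟩)
  have hm : ∀ e, mult l r e ≤ 2 := fun e => by
    obtain ⟨f, -, -, -, h⟩ := exists_not_parallel (hl (l e))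
    have := mult_pos l r f
    have := hdl (l e)
    omega
  obtain ⟨P, Q, haff, hP, hQ, -⟩ := twoColor_affEq_joinModel hcol hm
  have : IsEmpty {a // P a} := ⟨fun ⟨a, ha⟩ => by
    obtain ⟨e, rfl, he⟩ := (hL a).1
    have := (hP e he).1 ha
    omega⟩
  obtain ⟨e, he, he2⟩ := (hL (Classical.arbitrary A)).2
  have hq : Q (l e) := (hQ e (by omega)).2 he2
  exact (((matchPoly_affEq_twoColor hconn hcol).trans haff).trans
    (joinModel_affEq_classModel ⟨l e, hq⟩)).isPyramidOrJoinedProduct_of_classModel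

/-- A cycle in which simple edges alternate with double edges and one triple edge. -/
theorem isPyramidOrJoinedProduct_of_triple [Fintype A] {l : E → A} {r : E → B}
    (hconn : IsConn l r) (hl : ∀ a, deg (simpleLeft l r) a = 2)
    (hr : ∀ b, deg (simpleLeft r l) b = 2) {u : A} {v : B} (hu : deg l u = 4)
    (hdl : ∀ a, a ≠ u → deg l a = 3) (hdr : ∀ b, b ≠ v → deg r b = 3) (hv : deg r v = 4)
    {e : E} (heu : l e = u) (he : mult l r e = 1) :
    IsPyramidOrJoinedProduct (matchPoly l r) := by
  classical
  subst heu
  obtain ⟨f, hfl, -, hall, hf⟩ := exists_not_parallel (hl (l e))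
  obtain ⟨g, hgr, -, -, hg⟩ := exists_not_parallel (hr (r f))
  rw [mult_swap l r, mult_swap l r] at hg
  have := mult_pos l r g
  have hfv : r f = v := by
    by_contra h
    have := hdr _ h
    omega
  have hL : ∀ a, (∃ e, l e = a ∧ mult l r e = 1) ∧ ∃ e, l e = a ∧ mult l r e ≠ 1 := by
    intro a
    by_cases ha : a = l e
    · exact ⟨⟨e, ha.symm, he⟩, f, hfl.trans ha.symm, by omega⟩
    · have h := exists_mult_of_deg_eq_three (hl a) (hdl a ha)
      exact ⟨h.1, h.2.imp fun e h => ⟨h.1, by omega⟩⟩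
  have hR : ∀ b, (∃ e, r e = b ∧ mult l r e = 1) ∧ ∃ e, r e = b ∧ mult l r e ≠ 1 := by
    intro b
    by_cases hb : b = v
    · rw [hfv] at hg hgr
      rw [hb]
      exact ⟨⟨g, hgr, by omega⟩, f, hfv, by omega⟩
    · have h := exists_mult_of_deg_eq_three (hr b) (hdr b hb)
      simp only [mult_swap l r] at h
      exact ⟨h.1, h.2.imp fun e h => ⟨h.1, by omega⟩⟩
  have hcol := isTwoColoring_mult_eq_one hl hr (fun a => (hL a).1) (fun a => (hL a).2)
    (fun b => (hR b).1) fun b => (hR b).2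
  obtain ⟨k, hk⟩ := twoColor_affEq_pyramid hcol (fun e h => h) (u := l e)
    (fun e' h h' => by
      rcases hall e' h' with c | c
      · exact absurd ((mult_congr h' c).trans he) h
      · rw [mult_congr (h'.trans hfl.symm) c]
        omega)
    (fun e' h h' => by
      obtain ⟨f', -, -, -, hf'⟩ := exists_not_parallel (hl (l e'))
      have := hdl _ h'
      have := mult_pos l r f'
      have := mult_pos l r e'
      omega)
  have : Nonempty A := ⟨l e⟩
  exact Or.inl ⟨k, (matchPoly_affEq_twoColor hconn hcol).trans hk⟩

/-- A cycle with simple and double edges in which one left vertex has two double edges. -/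
theorem exists_birkhoffFace_of_double [Fintype A] [Fintype B] {l : E → A} {r : E → B}
    (hconn : IsConn l r) (hAB : Fintype.card A = Fintype.card B) (hA : 2 ≤ Fintype.card A)
    (hE : Fintype.card E = 3 * Fintype.card A + 1) (hl : ∀ a, deg (simpleLeft l r) a = 2)
    (hr : ∀ b, deg (simpleLeft r l) b = 2) {u : A} (hu : deg l u = 4)
    (hdl : ∀ a, a ≠ u → deg l a = 3) (hne : ∀ e, l e = u → mult l r e ≠ 1) :
    ∃ F : Set (Matrix (Fin (2 * Fintype.card A)) (Fin (2 * Fintype.card A)) ℝ),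
      IsBirkhoffFace (2 * Fintype.card A) F ∧ AffEq (matchPoly l r) F := by
  classical
  have : Nonempty A := ⟨u⟩
  obtain ⟨col, hcol⟩ := exists_isTwoColoring hconn hAB hl fun b => by
    rw [← deg_simpleRight_swap, hr]
  have hm : ∀ e, mult l r e ≤ 2 ∧ (l e = u → mult l r e = 2) := fun e => by
    obtain ⟨f, hf, -, -, h⟩ := exists_not_parallel (hl (l e))
    have := mult_pos l r f
    have := mult_pos l r e
    by_cases hc : l e = u
    · have := hne e hc
      have := hne f (hf.trans hc)
      rw [hc] at h
      omega
    · have := hdl _ hc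
      exact ⟨by omega, fun h => absurd h hc⟩
  obtain ⟨P, Q, haff, hP, hQ, hcard⟩ := twoColor_affEq_joinModel hcol fun e => (hm e).1
  have haff' := (matchPoly_affEq_twoColor hconn hcol).trans haff
  obtain ⟨e, heu, he⟩ := hcol.exists_left u
  obtain ⟨f, hfu, hf⟩ := hcol.not.exists_left u
  have hPu : P u := heu ▸ (hP e he).2 ((hm e).2 heu)
  have hQu : Q u := hfu ▸ (hQ f hf).2 ((hm f).2 hfu)
  have h1 : 1 ≤ Fintype.card {a // P a} := Fintype.card_pos_iff.2 ⟨⟨u, hPu⟩⟩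
  have h2 : 1 ≤ Fintype.card {a // Q a} := Fintype.card_pos_iff.2 ⟨⟨u, hQu⟩⟩
  -- The dimensions of the two cubes add up to `|A| + 1 ≥ 3`, so one of them is at least two.
  rcases (by omega : 2 ≤ Fintype.card {a // Q a} ∨ 2 ≤ Fintype.card {a // P a}) with h | h
  · obtain ⟨F, hF, hF'⟩ := exists_birkhoffFace_affEq_joinModel h1 h
      (n := 2 * Fintype.card A) (by omega)
    exact ⟨F, hF, haff'.trans hF'⟩
  · obtain ⟨F, hF, hF'⟩ := exists_birkhoffFace_affEq_joinModel h2 h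
      (n := 2 * Fintype.card A) (by omega)
    exact ⟨F, hF, (haff'.trans (joinModel_affEq_swap _ _)).trans hF'⟩

theorem matchPoly_eq_stdSimplex [Unique A] [Unique B] (l : E → A) (r : E → B) :
    matchPoly l r = stdSimplex ℝ E := by
  classical
  ext x
  have hl : ∀ e, l e = default := fun _ => Subsingleton.elim _ _
  have hr : ∀ e, r e = default := fun _ => Subsingleton.elim _ _
  simp [matchPoly, stdSimplex, fiberSum_eq_sum_ite, Unique.forall_iff, hl, hr]

/-- A graph with one vertex on each side. -/
theorem isPyramidOrJoinedProduct_of_card_eq_one [Fintype A] [Fintype B] (l : E → A) (r : E → B)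
    (hA : Fintype.card A = 1) (hB : Fintype.card B = 1) (h3 : 3 ≤ Fintype.card E)
    (h5 : Fintype.card E ≤ 5) :
    IsPyramidOrJoinedProduct (matchPoly l r) ∨ Fintype.card E = 5 ∧
      ∃ F : Set (Matrix (Fin 4) (Fin 4) ℝ), IsBirkhoffFace 4 F ∧ AffEq (matchPoly l r) F := by
  classical
  obtain ⟨_⟩ := Fintype.card_eq_one_iff_nonempty_unique.1 hA
  obtain ⟨_⟩ := Fintype.card_eq_one_iff_nonempty_unique.1 hB
  rw [matchPoly_eq_stdSimplex]
  rcases (by omega : Fintype.card E = 3 ∨ Fintype.card E = 4 ∨ Fintype.card E = 5) with h | h | h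
  · exact Or.inl ((stdSimplex_affEq_relabel (Fintype.equivFinOfCardEq h)).trans
      (stdSimplex_affEq_classModel fun i : Fin 0 => i.elim0)
      ).isPyramidOrJoinedProduct_of_classModel
  · exact Or.inl (Or.inl ⟨0, (stdSimplex_affEq_relabel (Fintype.equivFinOfCardEq h)).trans
      stdSimplex_affEq_pyramid⟩)
  · obtain ⟨F, hF, hF'⟩ := exists_birkhoffFace_affEq_stdSimplex
    exact Or.inr ⟨h, F, hF, (stdSimplex_affEq_relabel (Fintype.equivFinOfCardEq h)).trans hF'⟩

/-- A reduced connected graph whose polytope has dimension `d` and is not a face of any Birkhoff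
polytope of size less than `2 * d - 3`. -/
theorem isPyramidOrJoinedProduct_of_reduced [Fintype A] [Fintype B] {l : E → A} {r : E → B}
    (hpos : ∃ x ∈ matchPoly l r, ∀ e, 0 < x e) (hconn : IsConn l r) (hl : ∀ a, 3 ≤ deg l a)
    (hr : ∀ b, 3 ≤ deg r b) (hd : 2 ≤ polytopeDim (matchPoly l r))
    (hmin : ∀ (n : ℕ) (F : Set (Matrix (Fin n) (Fin n) ℝ)), IsBirkhoffFace n F →
      AffEq (matchPoly l r) F → 2 * polytopeDim (matchPoly l r) ≤ n + 3) :
    IsPyramidOrJoinedProduct (matchPoly l r) := by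
  classical
  have hne : (matchPoly l r).Nonempty := hpos.imp fun _ h => h.1
  have hAB : Fintype.card A = Fintype.card B := card_eq_of_mem_matchPoly hne.some_mem
  have hAne : Nonempty A := by
    by_contra h
    rw [not_nonempty_iff] at h
    have : IsEmpty E := ⟨fun e => h.elim (l e)⟩
    have : polytopeDim (matchPoly l r) = 0 := by
      unfold polytopeDim
      rw [Subsingleton.elim (vectorSpan ℝ (matchPoly l r)) ⊥, finrank_bot]
    omega
  have hsumA := sum_deg l
  have hsumB := sum_deg r
  have hE : 3 * Fintype.card A ≤ Fintype.card E := by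
    rw [← hsumA, mul_comm]
    simpa using Finset.sum_le_sum fun a (_ : a ∈ Finset.univ) => hl a
  have hdim := (card_add_one_le_finrank_ker l r).trans
    (Nat.add_le_add_right (Nat.add_le_add_right (finrank_ker_le_polytopeDim hpos) _) _)
  obtain ⟨D, hD, hDcard⟩ := exists_simple_complement l r
  obtain ⟨F, hF, hFaff⟩ := exists_birkhoffFace_affEq l r D hD hne rfl
  -- This is `2d ≤ a + (e - s) + 3`. Together with `d ≥ e - 2a + 1` from `hdim` it yields `e + s ≤
  -- 5a + 1`.
  have hbound := hmin _ F hF hFaff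
  have hSA := sum_deg (simpleLeft l r)
  have hSB : ∑ b, deg (simpleLeft r l) b = Fintype.card (SimpleEdge l r) := by
    simp only [deg_simpleRight_swap]
    exact sum_deg (simpleRight l r)
  have hA0 : 1 ≤ Fintype.card A := Fintype.card_pos
  rcases hA0.eq_or_lt with hA1 | hA2
  · have hS : 1 ≤ Fintype.card (SimpleEdge l r) := by
      obtain ⟨e, -⟩ := exists_edge_left hne.some_mem (Classical.arbitrary A)
      exact Fintype.card_pos_iff.2 ⟨toSimple l r e⟩
    rcases isPyramidOrJoinedProduct_of_card_eq_one l r hA1.symm (by omega) (by omega) (by omega)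
      with h | ⟨h, F', hF', hF'aff⟩
    · exact h
    -- Five parallel edges give dimension at least four, but a face of size 4 only allows `2d ≤ 7`.
    · have := hmin _ F' hF' hF'aff
      omega
  · have hsl := two_le_deg_simple hpos hconn hA2
    have hsr := two_le_deg_simple (matchPoly_swap l r ▸ hpos) hconn.swap (hAB ▸ hA2)
    have hS : 2 * Fintype.card A ≤ Fintype.card (SimpleEdge l r) := by
      rw [← hSA, mul_comm]
      simpa using Finset.sum_le_sum fun a (_ : a ∈ Finset.univ) => hsl a
    rcases (by omega : Fintype.card (SimpleEdge l r) = 2 * Fintype.card A ∨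
      Fintype.card (SimpleEdge l r) = 2 * Fintype.card A + 1) with hS2 | hS2
    · have hl2 := eq_of_sum_eq hsl (hSA.trans hS2)
      have hr2 := eq_of_sum_eq hsr (hSB.trans (hAB ▸ hS2))
      rcases (by omega : Fintype.card E = 3 * Fintype.card A ∨
        Fintype.card E = 3 * Fintype.card A + 1) with hE3 | hE3
      · exact isPyramidOrJoinedProduct_of_deg_eq_three hconn hl2 hr2
          (eq_of_sum_eq hl (hsumA.trans hE3)) (eq_of_sum_eq hr (hsumB.trans (hAB ▸ hE3)))
      · obtain ⟨u, hu, hu'⟩ := exists_eq_add_one_of_sum_eq hl (hsumA.trans hE3)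
        obtain ⟨v, hv, hv'⟩ := exists_eq_add_one_of_sum_eq hr (hsumB.trans (hAB ▸ hE3))
        by_cases he : ∃ e, l e = u ∧ mult l r e = 1
        · obtain ⟨e, heu, he⟩ := he
          exact isPyramidOrJoinedProduct_of_triple hconn hl2 hr2 hu hu' hv' hv heu he
        · obtain ⟨F', hF', hF'aff⟩ := exists_birkhoffFace_of_double hconn hAB hA2 hE3 hl2 hr2 hu hu'
            fun e h h' => he ⟨e, h, h'⟩
          -- Here `d ≥ a + 2`, whereas a face of size `2a` only allows `2d ≤ 2a + 3`.
          have := hmin _ F' hF' hF'aff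
          omega
    · have hE3 : Fintype.card E = 3 * Fintype.card A := by omega
      obtain ⟨u, hu, hu'⟩ := exists_eq_add_one_of_sum_eq hsl (hSA.trans hS2)
      obtain ⟨v, hv, hv'⟩ := exists_eq_add_one_of_sum_eq hsr (hSB.trans (hAB ▸ hS2))
      obtain ⟨J, _, c, h⟩ := exists_classModel_of_three_paths hconn hAB
        (eq_of_sum_eq hl (hsumA.trans hE3)) (eq_of_sum_eq hr (hsumB.trans (hAB ▸ hE3))) hu hv hu' hv'
      exact h.isPyramidOrJoinedProduct_of_classModel

end Cases

/-! ### The main theorem -/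

theorem mainTheorem2 (L : Type*) [PartialOrder L] (d : ℕ) (hd : 2 ≤ d)
    (hL : IsBirkhoffType L d) (hbdim : 2 * (d : ℤ) - 3 ≤ (bdim L : ℤ)) :
    -- a product of two faces of Birkhoff polytopes of positive dimension
    (∃ (n₁ n₂ : ℕ) (F₁ : Set (Matrix (Fin n₁) (Fin n₁) ℝ)) (F₂ : Set (Matrix (Fin n₂) (Fin n₂) ℝ)),
      IsBirkhoffFace n₁ F₁ ∧ IsBirkhoffFace n₂ F₂ ∧ 1 ≤ polytopeDim F₁ ∧ 1 ≤ polytopeDim F₂ ∧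
        Realizes (F₁ ×ˢ F₂) L) ∨
    -- a pyramid over a product of a cube and a triangle
    (∃ k : ℕ, Realizes (pyramid (cube k ×ˢ triangle)) L) ∨
    -- a reduced joined product of two cubes
    (∃ k : Fin 2 → ℕ, Realizes (reducedJoinedProduct fun i => cube (k i)) L) ∨
    -- a joined product of three cubes
    (∃ k : Fin 3 → ℕ, (∀ i, 1 ≤ k i) ∧ Realizes (joinedProduct fun i => cube (k i)) L) := by
  obtain ⟨n, F, hF, rfl, hFL⟩ := hL
  rcases hF.exists_prod_or_reduced hd with ⟨n₁, n₂, F₁, F₂, h₁, h₂, hd₁, hd₂, haff⟩ |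
    ⟨E, A, B, _, _, _, l, r, hpos, haff, hconn, hl, hr⟩
  · exact Or.inl ⟨n₁, n₂, F₁, F₂, h₁, h₂, hd₁, hd₂, haff.realizes hFL⟩
  · rw [haff.polytopeDim_eq] at hd hbdim
    have hM := haff.realizes hFL
    -- The bound on `bdim L` is used only through affinely equivalent faces: they have combinatorial
    -- type `L`, so their size is at least `bdim L`.
    have hmin : ∀ (n : ℕ) (F : Set (Matrix (Fin n) (Fin n) ℝ)), IsBirkhoffFace n F →
        AffEq (matchPoly l r) F → 2 * polytopeDim (matchPoly l r) ≤ n + 3 := by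
      intro m F' hF' h
      have : bdim L ≤ m := Nat.sInf_le ⟨F', hF', h.realizes hM⟩
      omega
    rcases isPyramidOrJoinedProduct_of_reduced hpos hconn hl hr hd hmin with
      ⟨k, h⟩ | ⟨k, h⟩ | ⟨k, hk, h⟩
    · exact Or.inr (Or.inl ⟨k, h.realizes hM⟩)
    · exact Or.inr (Or.inr (Or.inl ⟨k, h.realizes hM⟩))
    · exact Or.inr (Or.inr (Or.inr ⟨k, hk, h.realizes hM⟩))
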